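/- Let $K$ be an algebraically closed field of characteristic $0$, let $R$ be a smooth (finitely presented and formally smooth) commutative $K$-algebra, $X=\operatorname{Spec}R$, let $M$ be a finitely generated $R$-module and $\mathcal F=\widetilde M$. Let $(E^*,d)$ be a complex of projective $R$-modules with $E^i=0$ for $i\notin[-m,0]$, together with an $R$-linear map $E^0\to M$ such that $$0\to E^{-m}\xrightarrow{d}E^{-m+1}\xrightarrow{d}\cdots\xrightarrow{d}E^{-1}\xrightarrow{d}E^0\to M\to 0$$ is exact. Let $\mathbf{Art}_K$ be the category of local Artin $K$-algebras $A$ with residue field $K$; $\mathfrak m_A$ denotes the maximal ideal of $A$. *The algebraic side.* Let $D^*=D^*_K(R,E^*)$ be the DG-Lie algebra whose degree $n$ part consists of the pairs $(h,u)\in\operatorname{Der}^n_K(R,R)\times\operatorname{Hom}^n_K(E^*,E^*)$ with $u(rx)-r\,u(x)=h(r)x$ for all $r\in R$, $x\in E^*$, where $\operatorname{Der}^0_K(R,R)=\operatorname{Der}_K(R,R)$ and $\operatorname{Der}^n_K(R,R)=0$ for $n\neq0$; its bracket is the graded commutator in both components and its differential is $(h,u)\mapsto(0,[d,u])$. Let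 $\operatorname{Def}_{D^*}:\mathbf{Art}_K\to\mathbf{Set}$ be the functor sending $A$ to the set of solutions $x\in D^1\otimes_K\mathfrak m_A$ of the Maurer–Cartan equation $dx+\frac12[x,x]=0$ modulo the gauge action of $D^0\otimes_K\mathfrak m_A$, $$e^a*x=x+\sum_{n\ge0}\frac{[a,-]^n}{(n+1)!}\big([a,x]-da\big).$$ *The geometric side.* An infinitesimal deformation of $(X,\mathcal F)$ over $A\in\mathbf{Art}_K$ consists of a flat morphism $\pi:\mathcal X_A\to\operatorname{Spec}A$ of schemes and a morphism $\iota:X\to\mathcal X_A$ such that $$\begin{array}{ccc}X&\xrightarrow{\ \iota\ }&\mathcal X_A\\ \downarrow&&\downarrow{\scriptstyle\pi}\\ \operatorname{Spec}K&\to&\operatorname{Spec}A\end{array}$$ is a pull-back square, of a coherent sheaf $\mathcal F_A$ on $\mathcal X_A$, flat over $A$, and of a morphism $\mathcal F_A\to\mathcal F$ (that is, an $\mathcal O_{\mathcal X_A}$-linear morphism $\mathcal F_A\to\iota_*\mathcal F$) inducing an isomorphism $\iota^*\mathcal F_A\to\mathcal F$. Two deformations $(\mathcal X_A,\mathcal F_A)$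 and $(\mathcal X'_A,\mathcal F'_A)$ are isomorphic if there are an isomorphism of schemes $f:\mathcal X_A\to\mathcal X'_A$ over $\operatorname{Spec}A$ with $f\circ\iota=\iota'$ and an isomorphism $f^*\mathcal F'_A\to\mathcal F_A$ compatible with the given morphisms $\mathcal F_A\to\mathcal F$ and $\mathcal F'_A\to\mathcal F$. Let $\operatorname{Def}_{(X,\mathcal F)}:\mathbf{Art}_K\to\mathbf{Set}$ be the functor sending $A$ to the collection of isomorphism classes of deformations of $(X,\mathcal F)$ over $A$, and $A\to B$ to the pull-back of deformations along $\operatorname{Spec}B\to\operatorname{Spec}A$. Then the DG-Lie algebra $D^*_K(R,E^*)$ controls the infinitesimal deformations of the pair $(X,\mathcal F)$: there is an isomorphism of functors $\mathbf{Art}_K\to\mathbf{Set}$ $$\operatorname{Def}_{D^*_K(R,E^*)}\cong\operatorname{Def}_{(X,\mathcal F)}.$$ -/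

import Mathlib

open CategoryTheory
open scoped TensorProduct
universe u

/-- A differential graded Lie algebra over `K`, with homogeneous pieces `L n`, `n : ℤ`.
The equations `i + j = k` are arguments so that no casts between degrees are needed. -/
structure DGLieAlgebra (K : Type u) [Field K] where
  L : ℤ → Type u
  [addCommGroup : ∀ n, AddCommGroup (L n)]
  [module : ∀ n, Module K (L n)]
  d : ∀ i j : ℤ, i + 1 = j → L i →ₗ[K] L j
  bracket : ∀ i j k : ℤ, i + j = k → L i →ₗ[K] L j →ₗ[K] L k
  d_d : ∀ (i j k : ℤ) (hij : i + 1 = j) (hjk : j + 1 = k) (x : L i),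
    d j k hjk (d i j hij x) = 0
  skew : ∀ (i j k : ℤ) (hij : i + j = k) (hji : j + i = k) (x : L i) (y : L j),
    bracket i j k hij x y = -((i * j).negOnePow • bracket j i k hji y x)
  bracket_self_even : ∀ (i k : ℤ) (hi : i + i = k) (_ : Even i) (x : L i),
    bracket i i k hi x x = 0
  bracket_self_odd : ∀ (i k l : ℤ) (hi : i + i = k) (hk : i + k = l) (_ : Odd i) (x : L i),
    bracket i k l hk x (bracket i i k hi x x) = 0
  jacobi : ∀ (i j k ij jk ik ijk : ℤ) (hij : i + j = ij) (hjk : j + k = jk) (hik : i + k = ik)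
    (h₁ : i + jk = ijk) (h₂ : ij + k = ijk) (h₃ : j + ik = ijk) (x : L i) (y : L j) (z : L k),
    bracket i jk ijk h₁ x (bracket j k jk hjk y z) =
      bracket ij k ijk h₂ (bracket i j ij hij x y) z +
        (i * j).negOnePow • bracket j ik ijk h₃ y (bracket i k ik hik x z)
  leibniz : ∀ (i j k i' j' k' : ℤ) (hk : i + j = k) (hi' : i + 1 = i') (hj' : j + 1 = j')
    (hk' : k + 1 = k') (h₁ : i' + j = k') (h₂ : i + j' = k') (x : L i) (y : L j),
    d k k' hk' (bracket i j k hk x y) =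
      bracket i' j k' h₁ (d i i' hi' x) y + i.negOnePow • bracket i j' k' h₂ x (d j j' hj' y)

attribute [instance] DGLieAlgebra.addCommGroup DGLieAlgebra.module

namespace HomDGLie
open CochainComplex CochainComplex.HomComplex

variable {K : Type u} [Field K] {C : Type*} [Category C] [Preadditive C] [Linear K C]
  {F : CochainComplex C ℤ}

/-- The graded commutator `u ∘ v - (-1)^{ij} v ∘ u` of homogeneous endomorphisms of a complex
(`Cochain.comp` composes from left to right). -/
def gradedComm {i j k : ℤ} (h : i + j = k) (u : Cochain F F i) (v : Cochain F F j) :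
    Cochain F F k :=
  v.comp u ((add_comm j i).trans h) - (i * j).negOnePow • u.comp v h

lemma gradedComm_skew {i j k : ℤ} (h : i + j = k) (h' : j + i = k)
    (u : Cochain F F i) (v : Cochain F F j) :
    gradedComm h u v = -((i * j).negOnePow • gradedComm h' v u) := by
  simp only [gradedComm, smul_sub, smul_smul, mul_comm j i, ← Int.negOnePow_add]
  rw [Int.negOnePow_even (i * j + i * j) ⟨_, rfl⟩, one_smul]
  abel

lemma gradedComm_self_even {i k : ℤ} (h : i + i = k) (hi : Even i) (u : Cochain F F i) :
    gradedComm h u u = 0 := by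
  simp [gradedComm, Int.negOnePow_even (i * i) (hi.mul_left i)]

lemma gradedComm_jacobi {i j k ij jk ik ijk : ℤ} (hij : i + j = ij) (hjk : j + k = jk)
    (hik : i + k = ik) (h₁ : i + jk = ijk) (h₂ : ij + k = ijk) (h₃ : j + ik = ijk)
    (x : Cochain F F i) (y : Cochain F F j) (z : Cochain F F k) :
    gradedComm h₁ x (gradedComm hjk y z) = gradedComm h₂ (gradedComm hij x y) z +
        (i * j).negOnePow • gradedComm h₃ y (gradedComm hik x z) := by
  have e1 : (z.comp y (by omega : k + j = jk)).comp x (by omega : jk + i = ijk) =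
      z.comp (y.comp x (by omega : j + i = ij)) (by omega) :=
    Cochain.comp_assoc _ _ _ _ _ (by omega)
  have e2 : (y.comp z hjk).comp x (by omega : jk + i = ijk) =
      y.comp (z.comp x (by omega : k + i = ik)) (by omega) :=
    Cochain.comp_assoc _ _ _ _ _ (by omega)
  have e3 : (x.comp z hik).comp y (by omega : ik + j = ijk) =
      x.comp (z.comp y (by omega : k + j = jk)) (by omega) :=
    Cochain.comp_assoc _ _ _ _ _ (by omega)
  have e4 : (x.comp y hij).comp z (by omega : ij + k = ijk) =
      x.comp (y.comp z hjk) (by omega) :=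
    Cochain.comp_assoc _ _ _ _ _ (by omega)
  have e5 : (z.comp x (by omega : k + i = ik)).comp y (by omega : ik + j = ijk) =
      z.comp (x.comp y hij) (by omega) :=
    Cochain.comp_assoc _ _ _ _ _ (by omega)
  have e6 : (y.comp x (by omega : j + i = ij)).comp z (by omega : ij + k = ijk) =
      y.comp (x.comp z hik) (by omega) :=
    Cochain.comp_assoc _ _ _ _ _ (by omega)
  subst hij hjk hik
  simp only [gradedComm, Cochain.comp_sub, Cochain.sub_comp, Cochain.comp_units_smul,
    Cochain.units_smul_comp, smul_sub, smul_smul, e1, e2, e3, e4, e5, e6, mul_add, add_mul,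
    Int.negOnePow_add, mul_comm j i]
  have s : ∀ a b : ℤˣ, a * (a * b) = b := fun a b => by
    rw [← mul_assoc, Int.units_mul_self, one_mul]
  simp only [s, mul_comm, mul_left_comm, mul_assoc]
  abel

lemma gradedComm_self_odd {i k l : ℤ} (h : i + i = k) (hk : i + k = l) (hi : Odd i)
    (u : Cochain F F i) : gradedComm hk u (gradedComm h u u) = 0 := by
  have e : (u.comp u h).comp u (by omega : k + i = l) = u.comp (u.comp u h) (by omega) :=
    Cochain.comp_assoc _ _ _ _ _ (by omega)
  have hk' : Even (i * k) := Even.mul_left ⟨i, h.symm⟩ i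
  simp [gradedComm, Int.negOnePow_even _ hk', Int.negOnePow_odd _ (hi.mul hi), e]

lemma gradedComm_leibniz {i j k i' j' k' : ℤ} (hk : i + j = k) (hi' : i + 1 = i')
    (hj' : j + 1 = j') (hk' : k + 1 = k') (h₁ : i' + j = k') (h₂ : i + j' = k')
    (x : Cochain F F i) (y : Cochain F F j) :
    δ k k' (gradedComm hk x y) = gradedComm h₁ (δ i i' x) y +
      i.negOnePow • gradedComm h₂ x (δ j j' y) := by
  subst hi' hj'
  simp only [gradedComm, δ_sub, δ_units_smul,
    δ_comp x y hk _ _ _ hk' rfl rfl, δ_comp y x (by omega : j + i = k) _ _ _ hk' rfl rfl,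
    smul_add, smul_sub, smul_smul, mul_add, add_mul, mul_one, one_mul, Int.negOnePow_add]
  have s : ∀ a b : ℤˣ, a * (a * b) = b := fun a b => by
    rw [← mul_assoc, Int.units_mul_self, one_mul]
  simp only [s, mul_comm]
  abel

lemma gradedComm_add_left {i j k : ℤ} (h : i + j = k) (u u' : Cochain F F i) (v : Cochain F F j) :
    gradedComm h (u + u') v = gradedComm h u v + gradedComm h u' v := by
  simp only [gradedComm, Cochain.comp_add, Cochain.add_comp, smul_add]; abel

lemma gradedComm_add_right {i j k : ℤ} (h : i + j = k) (u : Cochain F F i)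
    (v v' : Cochain F F j) :
    gradedComm h u (v + v') = gradedComm h u v + gradedComm h u v' := by
  simp only [gradedComm, Cochain.comp_add, Cochain.add_comp, smul_add]; abel

lemma gradedComm_smul_left {i j k : ℤ} (h : i + j = k) (c : K) (u : Cochain F F i)
    (v : Cochain F F j) : gradedComm h (c • u) v = c • gradedComm h u v := by
  simp only [gradedComm, Cochain.comp_smul, Cochain.smul_comp, smul_sub]
  rw [smul_comm]

lemma gradedComm_smul_right {i j k : ℤ} (h : i + j = k) (c : K) (u : Cochain F F i)
    (v : Cochain F F j) : gradedComm h u (c • v) = c • gradedComm h u v := by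
  simp only [gradedComm, Cochain.comp_smul, Cochain.smul_comp, smul_sub]
  rw [smul_comm]

end HomDGLie

namespace PairDer
open CochainComplex CochainComplex.HomComplex HomDGLie

variable (K : Type u) [Field K] (R : Type u) [CommRing R] [Algebra K R]
  (E : CochainComplex (ModuleCat.{u} R) ℤ)

/-- The complex of `K`-vector spaces underlying a complex of `R`-modules. -/
noncomputable abbrev underlying : CochainComplex (ModuleCat.{u} K) ℤ :=
  ((ModuleCat.restrictScalars (algebraMap K R)).mapHomologicalComplex _).obj E

variable {K R E}

/-- The component `E p → E q` of a homogeneous `K`-linear endomorphism of degree `n` of `E`. -/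
noncomputable def component {n : ℤ} (u : Cochain (underlying K R E) (underlying K R E) n) {p q : ℤ}
    (hpq : p + n = q) (x : E.X p) : E.X q :=
  (u.v p q hpq).hom x

/-- The pairs `(h, u)` in `Der_K^n(R, R) × Hom_K^n(E, E)` such that `u (r x) - r u (x) = h(r) x`.
Since `R` is concentrated in degree zero, `Der_K^n(R, R) = 0` for `n ≠ 0`. -/
structure IsPairDer {n : ℤ} (h : Derivation K R R)
    (u : Cochain (underlying K R E) (underlying K R E) n) : Prop where
  eq_zero : n ≠ 0 → h = 0
  linear : n ≠ 0 → ∀ (p q : ℤ) (hpq : p + n = q) (r : R) (x : E.X p),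
    component u hpq (r • x) - r • component u hpq x = 0
  leibniz : ∀ (p : ℤ) (hp : p + n = p) (r : R) (x : E.X p),
    component u hp (r • x) - r • component u hp x = h r • x

/-- Multiplication by `r` as a `K`-linear endomorphism of `E` of degree `0`. -/
noncomputable def mulC (r : R) : Cochain (underlying K R E) (underlying K R E) 0 :=
  Cochain.ofHoms fun p => (ModuleCat.restrictScalars (algebraMap K R)).map
    (ModuleCat.ofHom (r • LinearMap.id : E.X p →ₗ[R] E.X p))

/-- The same cochain, in degree `n`; zero when `n ≠ 0`. -/
noncomputable def mulT (n : ℤ) (r : R) : Cochain (underlying K R E) (underlying K R E) n :=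
  if hn : n = 0 then hn ▸ mulC r else 0

lemma mulT_zero (r : R) : mulT (K := K) (E := E) 0 r = mulC r := by simp [mulT]

lemma mulT_ne {n : ℤ} (hn : n ≠ 0) (r : R) : mulT (K := K) (E := E) n r = 0 := by
  simp [mulT, hn]

lemma mulC_apply (r : R) (p : ℤ) (hp : p + 0 = p) (x : E.X p) :
    component (K := K) (mulC r) hp x = r • x := by
  simp [component, mulC]
  rfl

lemma component_gradedComm {n : ℤ} (r : R) (u : Cochain (underlying K R E) (underlying K R E) n)
    {p q : ℤ} (hpq : p + n = q) (x : E.X p) :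
    component (gradedComm (add_zero n) u (mulC r)) hpq x =
      component u hpq (r • x) - r • component u hpq x := by
  have h₂ : ∀ y : E.X q, ((mulC (K := K) (E := E) r).v q q (add_zero q)).hom y = r • y :=
    fun y => mulC_apply r q (add_zero q) y
  have h₁ : ∀ y : E.X p, ((mulC (K := K) (E := E) r).v p p (add_zero p)).hom y = r • y :=
    fun y => mulC_apply r p (add_zero p) y
  have h : (gradedComm (add_zero n) u (mulC r)).v p q hpq =
      (mulC r).v p p (add_zero p) ≫ u.v p q hpq - u.v p q hpq ≫ (mulC r).v q q (add_zero q) := by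
    simp [gradedComm]
  change ((gradedComm (add_zero n) u (mulC r)).v p q hpq).hom x = _
  rw [h]
  change (u.v p q hpq).hom (((mulC r).v p p (add_zero p)).hom x) -
    ((mulC r).v q q (add_zero q)).hom ((u.v p q hpq).hom x) = _
  rw [h₁]
  exact congrArg₂ (· - ·) rfl (h₂ _)

lemma cochain_ext {n : ℤ} {u v : Cochain (underlying K R E) (underlying K R E) n}
    (h : ∀ (p q : ℤ) (hpq : p + n = q) (x : E.X p), component u hpq x = component v hpq x) :
    u = v := by
  apply Cochain.ext
  intro p q hpq
  apply ModuleCat.hom_ext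
  apply LinearMap.ext
  intro x
  exact h p q hpq x

lemma isPairDer_iff {n : ℤ} (h : Derivation K R R)
    (u : Cochain (underlying K R E) (underlying K R E) n) :
    IsPairDer h u ↔ (n ≠ 0 → h = 0) ∧
      ∀ r, gradedComm (add_zero n) u (mulC r) = mulT n (h r) := by
  constructor
  · intro H
    refine ⟨H.eq_zero, fun r => cochain_ext fun p q hpq x => ?_⟩
    rw [component_gradedComm]
    by_cases hn : n = 0
    · subst hn
      obtain rfl : p = q := by omega
      rw [H.leibniz, mulT_zero, mulC_apply]
    · rw [H.linear hn, mulT_ne hn]; rfl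
  · rintro ⟨H₀, H⟩
    refine ⟨H₀, fun hn p q hpq r x => ?_, fun p hp r x => ?_⟩
    · rw [← component_gradedComm, H, mulT_ne hn]; rfl
    · obtain rfl : n = 0 := by omega
      rw [← component_gradedComm, H, mulT_zero, mulC_apply]

lemma mulC_sub (r s : R) : mulC (K := K) (E := E) (r - s) = mulC r - mulC s :=
  cochain_ext fun p q hpq x => by
    obtain rfl : p = q := by omega
    rw [mulC_apply, sub_smul, ← mulC_apply (K := K) r p hpq, ← mulC_apply (K := K) s p hpq]; rfl

lemma mulC_add (r s : R) : mulC (K := K) (E := E) (r + s) = mulC r + mulC s :=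
  cochain_ext fun p q hpq x => by
    obtain rfl : p = q := by omega
    rw [mulC_apply, add_smul, ← mulC_apply (K := K) r p hpq, ← mulC_apply (K := K) s p hpq]; rfl

lemma mulC_smul (c : K) (r : R) : mulC (K := K) (E := E) (c • r) = c • mulC r :=
  cochain_ext fun p q hpq x => by
    obtain rfl : p = q := by omega
    rw [mulC_apply, Algebra.smul_def, mul_smul, ← mulC_apply (K := K) r p hpq]; rfl

lemma mulT_add (n : ℤ) (r s : R) : mulT (K := K) (E := E) n (r + s) = mulT n r + mulT n s := by
  by_cases hn : n = 0
  · subst hn; simp only [mulT_zero, mulC_add]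
  · simp [mulT_ne hn]

lemma mulT_smul (n : ℤ) (c : K) (r : R) :
    mulT (K := K) (E := E) n (c • r) = c • mulT n r := by
  by_cases hn : n = 0
  · subst hn; simp only [mulT_zero, mulC_smul]
  · simp [mulT_ne hn]

lemma mulT_zero_right (n : ℤ) : mulT (K := K) (E := E) n (0 : R) = 0 := by
  have := mulT_smul (E := E) n (0 : K) (0 : R)
  simpa using this

lemma δ_mulC (r : R) : δ 0 1 (mulC (K := K) (E := E) r) = 0 :=
  cochain_ext fun p q hpq x => by
    have h₁ : (δ 0 1 (mulC (K := K) (E := E) r)).v p q hpq =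
        (mulC (K := K) (E := E) r).v p p (add_zero p) ≫ (underlying K R E).d p q -
          (underlying K R E).d p q ≫ (mulC (K := K) (E := E) r).v q q (add_zero q) :=
      δ_zero_cochain_v _ _ _ _
    have h₂ : ∀ y : E.X q, ((mulC (K := K) (E := E) r).v q q (add_zero q)).hom y = r • y :=
      fun y => mulC_apply r q (add_zero q) y
    have h₃ : ((mulC (K := K) (E := E) r).v p p (add_zero p)).hom x = r • x :=
      mulC_apply r p (add_zero p) x
    change ((δ 0 1 (mulC (K := K) (E := E) r)).v p q hpq).hom x = 0
    rw [h₁]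
    change ((underlying K R E).d p q).hom (((mulC (K := K) (E := E) r).v p p (add_zero p)).hom x) -
      ((mulC (K := K) (E := E) r).v q q (add_zero q)).hom ((E.d p q).hom x) = 0
    rw [h₃]
    exact sub_eq_zero.2 (((E.d p q).hom.map_smul r x).trans (h₂ _).symm)

variable (K R E)

/-- The degree `n` part of the DG-Lie algebra of derivations of the pair `(R, E)`. -/
noncomputable def degree (n : ℤ) :
    Submodule K (Derivation K R R × Cochain (underlying K R E) (underlying K R E) n) where
  carrier := {x | IsPairDer x.1 x.2}
  zero_mem' := by
    refine (isPairDer_iff _ _).2 ⟨fun _ => rfl, fun r => ?_⟩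
    have := gradedComm_smul_left (add_zero n) (0 : K)
      (0 : Cochain (underlying K R E) (underlying K R E) n) (mulC r)
    simpa [mulT_zero_right] using this
  add_mem' := by
    rintro ⟨h, u⟩ ⟨h', u'⟩ H H'
    obtain ⟨a, b⟩ := (isPairDer_iff _ _).1 H
    obtain ⟨a', b'⟩ := (isPairDer_iff _ _).1 H'
    refine (isPairDer_iff _ _).2 ⟨fun hn => ?_, fun r => ?_⟩
    · exact (congrArg₂ (· + ·) (a hn) (a' hn)).trans (add_zero 0)
    · refine (gradedComm_add_left _ _ _ _).trans ?_
      rw [b, b', ← mulT_add]; rfl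
  smul_mem' := by
    rintro c ⟨h, u⟩ H
    obtain ⟨a, b⟩ := (isPairDer_iff _ _).1 H
    refine (isPairDer_iff _ _).2 ⟨fun hn => ?_, fun r => ?_⟩
    · exact (congrArg (c • ·) (a hn)).trans (smul_zero c)
    · refine (gradedComm_smul_left _ _ _ _).trans ?_
      rw [b, ← mulT_smul]; rfl

variable {K R E}

lemma isPairDer_gradedComm {i j k : ℤ} (hk : i + j = k) {h h' : Derivation K R R}
    {u : Cochain (underlying K R E) (underlying K R E) i}
    {u' : Cochain (underlying K R E) (underlying K R E) j}
    (H : IsPairDer h u) (H' : IsPairDer h' u') :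
    IsPairDer ⁅h, h'⁆ (gradedComm hk u u') := by
  obtain ⟨a, b⟩ := (isPairDer_iff _ _).1 H
  obtain ⟨a', b'⟩ := (isPairDer_iff _ _).1 H'
  refine (isPairDer_iff _ _).2 ⟨fun hn => ?_, fun r => ?_⟩
  · by_cases hi : i = 0
    · rw [a' (by omega), lie_zero]
    · rw [a hi, zero_lie]
  · have J := gradedComm_jacobi hk (add_zero j) (add_zero i) hk (add_zero k)
      (by omega : j + i = k) u u' (mulC r)
    rw [b, b'] at J
    rw [eq_sub_of_add_eq J.symm, Derivation.commutator_apply]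
    by_cases hi : i = 0 <;> by_cases hj : j = 0
    · subst hi hj
      obtain rfl : k = 0 := by omega
      simp only [mulT_zero] at b b' ⊢
      simp [b, b', mulC_sub]
    · subst hi
      obtain rfl : j = k := by omega
      have := gradedComm_smul_right hk (0 : K) u
        (0 : Cochain (underlying K R E) (underlying K R E) j)
      rw [a' hj] at b' ⊢
      simp only [zero_smul] at this
      simp [mulT_ne hj, mulT_zero, b', this]
    · subst hj
      obtain rfl : i = k := by omega
      have := gradedComm_smul_right (by omega : 0 + i = i) (0 : K) u'
        (0 : Cochain (underlying K R E) (underlying K R E) i)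
      rw [a hi] at b ⊢
      simp only [zero_smul] at this
      simp [mulT_ne hi, mulT_zero, b, this]
    · have h1 := gradedComm_smul_right hk (0 : K) u
        (0 : Cochain (underlying K R E) (underlying K R E) j)
      have h2 := gradedComm_smul_right (by omega : j + i = k) (0 : K) u'
        (0 : Cochain (underlying K R E) (underlying K R E) i)
      simp only [zero_smul] at h1 h2
      rw [a hi, a' hj]
      simp [mulT_ne hi, mulT_ne hj, h1, h2, mulT_zero_right]

lemma isPairDer_δ {i j : ℤ} (hij : i + 1 = j) {h : Derivation K R R}
    {u : Cochain (underlying K R E) (underlying K R E) i} (H : IsPairDer h u) :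
    IsPairDer (0 : Derivation K R R) (δ i j u) := by
  obtain ⟨a, b⟩ := (isPairDer_iff _ _).1 H
  refine (isPairDer_iff _ _).2 ⟨fun _ => rfl, fun r => ?_⟩
  have J := gradedComm_leibniz (add_zero i) hij (zero_add 1) hij (add_zero j) hij u (mulC r)
  have h1 := gradedComm_smul_right hij (0 : K) u
        (0 : Cochain (underlying K R E) (underlying K R E) 1)
  simp only [zero_smul] at h1
  rw [b, δ_mulC, h1, smul_zero, add_zero] at J
  rw [← J]
  by_cases hi : i = 0
  · subst hi
    obtain rfl : 1 = j := by omega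
    rw [mulT_zero, δ_mulC]
    simp [mulT_zero_right]
  · rw [mulT_ne hi]
    simp [mulT_zero_right]

variable (K R E)

/-- The DG-Lie algebra `D^*_K(R, E)` of derivations of the pair `(R, E)`, for a complex `E` of
`R`-modules: the differential is `(h, u) ↦ (0, [d, u])` and the bracket is the graded commutator. -/
noncomputable def dgla : DGLieAlgebra K where
  L n := degree K R E n
  d i j hij :=
    { toFun := fun x => ⟨(0, δ i j x.1.2), isPairDer_δ hij x.2⟩
      map_add' := fun x y => Subtype.ext (Prod.ext (by simp) (by simp))
      map_smul' := fun c x => Subtype.ext (Prod.ext (by simp) (by simp)) }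
  bracket i j k hk := LinearMap.mk₂ K
    (fun x y => ⟨(⁅x.1.1, y.1.1⁆, gradedComm hk x.1.2 y.1.2), isPairDer_gradedComm hk x.2 y.2⟩)
    (fun x x' y => Subtype.ext (Prod.ext (add_lie _ _ _) (gradedComm_add_left _ _ _ _)))
    (fun c x y => Subtype.ext (Prod.ext (smul_lie _ _ _) (gradedComm_smul_left _ _ _ _)))
    (fun x y y' => Subtype.ext (Prod.ext (lie_add _ _ _) (gradedComm_add_right _ _ _ _)))
    (fun c x y => Subtype.ext (Prod.ext (lie_smul _ _ _) (gradedComm_smul_right _ _ _ _)))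
  d_d i j k hij hjk x := Subtype.ext (Prod.ext rfl (δ_δ i j k x.1.2))
  skew i j k hij hji x y := by
    refine Subtype.ext (Prod.ext ?_ (gradedComm_skew hij hji x.1.2 y.1.2))
    change ⁅x.1.1, y.1.1⁆ = -((i * j).negOnePow • ⁅y.1.1, x.1.1⁆)
    by_cases hi : i = 0
    · subst hi
      simp
    · rw [x.2.eq_zero hi]; simp
  bracket_self_even i k hi he x :=
    Subtype.ext (Prod.ext (lie_self _) (gradedComm_self_even hi he x.1.2))
  bracket_self_odd i k l hi hk ho x :=
    Subtype.ext (Prod.ext (by simp) (gradedComm_self_odd hi hk ho x.1.2))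
  jacobi i j k ij jk ik ijk hij hjk hik h₁ h₂ h₃ x y z := by
    refine Subtype.ext (Prod.ext ?_ (gradedComm_jacobi hij hjk hik h₁ h₂ h₃ _ _ _))
    change ⁅x.1.1, ⁅y.1.1, z.1.1⁆⁆ = ⁅⁅x.1.1, y.1.1⁆, z.1.1⁆ +
      (i * j).negOnePow • ⁅y.1.1, ⁅x.1.1, z.1.1⁆⁆
    by_cases hi : i = 0
    · subst hi
      rw [leibniz_lie]; simp
    · rw [x.2.eq_zero hi]; simp
  leibniz i j k i' j' k' hk hi' hj' hk' h₁ h₂ x y := by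
    refine Subtype.ext (Prod.ext ?_ (gradedComm_leibniz hk hi' hj' hk' h₁ h₂ _ _))
    change (0 : Derivation K R R) = ⁅(0 : Derivation K R R), y.1.1⁆ +
      i.negOnePow • ⁅x.1.1, (0 : Derivation K R R)⁆
    simp

end PairDer

/-- Local Artin `K`-algebras with residue field `K`, as a property of commutative `K`-algebras. -/
def isArtAlg (K : Type u) [Field K] : ObjectProperty (CommAlgCat.{u} K) := fun A =>
  ∃ _ : IsLocalRing A, IsArtinianRing A ∧
    Function.Bijective (algebraMap K (IsLocalRing.ResidueField A))

/-- The category `Art_K` of local Artin `K`-algebras with residue field `K`. -/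
abbrev ArtAlg (K : Type u) [Field K] := (isArtAlg K).FullSubcategory

namespace ArtAlg

variable {K : Type u} [Field K]

instance (A : ArtAlg K) : IsLocalRing A.obj := A.property.choose

instance (A : ArtAlg K) : IsArtinianRing A.obj := A.property.choose_spec.1

lemma bijective (A : ArtAlg K) :
    Function.Bijective (algebraMap K (IsLocalRing.ResidueField A.obj)) :=
  A.property.choose_spec.2

/-- The maximal ideal of `A`. -/
abbrev 𝔪 (A : ArtAlg K) : Ideal A.obj := IsLocalRing.maximalIdeal A.obj

/-- The canonical projection of `A` onto its residue field `K`. -/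
noncomputable def residue (A : ArtAlg K) : A.obj →ₐ[K] K :=
  (AlgEquiv.ofBijective (Algebra.ofId K (IsLocalRing.ResidueField A.obj)) A.bijective).symm.toAlgHom.comp
    (IsScalarTower.toAlgHom K A.obj (IsLocalRing.ResidueField A.obj))

lemma isNilpotent_𝔪 (A : ArtAlg K) : IsNilpotent A.𝔪 := by
  have := IsArtinianRing.isNilpotent_jacobson_bot (R := A.obj)
  rwa [IsLocalRing.jacobson_eq_maximalIdeal _ bot_ne_top] at this

lemma mem_𝔪_iff_isNilpotent (A : ArtAlg K) (x : A.obj) : x ∈ A.𝔪 ↔ IsNilpotent x := by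
  constructor
  · intro hx
    obtain ⟨n, hn⟩ := A.isNilpotent_𝔪
    exact ⟨n, by simpa [hn] using Ideal.pow_mem_pow hx n⟩
  · intro hx
    exact (IsLocalRing.mem_maximalIdeal x).2 fun hu => hx.not_isUnit hu

lemma map_mem {A B : ArtAlg K} (f : A ⟶ B) {x : A.obj} (hx : x ∈ A.𝔪) :
    f.hom.hom x ∈ B.𝔪 := by
  rw [mem_𝔪_iff_isNilpotent] at hx ⊢
  exact hx.map f.hom.hom

/-- The map induced on maximal ideals by a morphism of local Artin algebras. -/
def map𝔪 {A B : ArtAlg K} (f : A ⟶ B) : A.𝔪 →ₗ[K] B.𝔪 where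
  toFun x := ⟨f.hom.hom x, map_mem f x.2⟩
  map_add' x y := Subtype.ext (map_add f.hom.hom x.1 y.1)
  map_smul' c x := Subtype.ext (map_smul f.hom.hom c x.1)

lemma residue_eq_zero_iff (A : ArtAlg K) (x : A.obj) : A.residue x = 0 ↔ x ∈ A.𝔪 := by
  simp only [residue, AlgHom.comp_apply]
  rw [← IsLocalRing.residue_eq_zero_iff]
  exact (AlgEquiv.ofBijective (Algebra.ofId K (IsLocalRing.ResidueField A.obj))
    A.bijective).symm.map_eq_zero_iff

lemma residue_comp {A B : ArtAlg K} (f : A ⟶ B) : B.residue.comp f.hom.hom = A.residue := by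
  ext x
  have h : x - algebraMap K A.obj (A.residue x) ∈ A.𝔪 := by
    rw [← residue_eq_zero_iff]; simp
  have h' := map_mem f h
  rw [← residue_eq_zero_iff] at h'
  simpa [sub_eq_zero] using h'

/-- Multiplication on the maximal ideal. -/
def mul𝔪 (A : ArtAlg K) : A.𝔪 →ₗ[K] A.𝔪 →ₗ[K] A.𝔪 :=
  LinearMap.mk₂ K (fun x y => ⟨x.1 * y.1, A.𝔪.mul_mem_left _ y.2⟩)
    (fun x x' y => Subtype.ext (add_mul x.1 x'.1 y.1))
    (fun c x y => Subtype.ext (smul_mul_assoc c x.1 y.1))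
    (fun x y y' => Subtype.ext (mul_add x.1 y.1 y'.1))
    (fun c x y => Subtype.ext (mul_smul_comm c x.1 y.1))

end ArtAlg

namespace DGLieAlgebra

variable {K : Type u} [Field K] (𝔤 : DGLieAlgebra K) (A : ArtAlg K)

/-- The degree `n` part of the DG-Lie algebra `𝔤 ⊗ 𝔪_A`. -/
abbrev tens (n : ℤ) : Type u := 𝔤.L n ⊗[K] A.𝔪

/-- The differential of `𝔤 ⊗ 𝔪_A`. -/
noncomputable def dT (i j : ℤ) (h : i + 1 = j) : 𝔤.tens A i →ₗ[K] 𝔤.tens A j :=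
  (𝔤.d i j h).rTensor A.𝔪

/-- The bracket of `𝔤 ⊗ 𝔪_A`: `[x ⊗ s, y ⊗ t] = [x, y] ⊗ st`. -/
noncomputable def bracketT (i j k : ℤ) (h : i + j = k) :
    𝔤.tens A i →ₗ[K] 𝔤.tens A j →ₗ[K] 𝔤.tens A k :=
  TensorProduct.map₂ (𝔤.bracket i j k h) A.mul𝔪

/-- The set of solutions in `𝔤¹ ⊗ 𝔪_A` of the Maurer-Cartan equation `dx + ½ [x, x] = 0`. -/
abbrev MC : Type u :=
  {x : 𝔤.tens A 1 // 𝔤.dT A 1 2 rfl x + (2 : K)⁻¹ • 𝔤.bracketT A 1 1 2 rfl x x = 0}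

/-- The operator `[a, -]` on `𝔤¹ ⊗ 𝔪_A`, for `a` of degree zero. -/
noncomputable def adT (a : 𝔤.tens A 0) : 𝔤.tens A 1 →ₗ[K] 𝔤.tens A 1 :=
  𝔤.bracketT A 0 1 1 rfl a

/-- The gauge action `e^a * x = x + ∑ₙ [a, -]ⁿ / (n + 1)! ([a, x] - da)`. The sum is finite since
`[a, -]` is nilpotent. -/
noncomputable def gauge (a : 𝔤.tens A 0) (x : 𝔤.tens A 1) : 𝔤.tens A 1 :=
  x + ∑ᶠ n : ℕ, ((n + 1).factorial : K)⁻¹ •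
    ((𝔤.adT A a) ^ n) (𝔤.adT A a x - 𝔤.dT A 0 1 rfl a)

/-- Gauge equivalence of Maurer-Cartan elements. -/
def GaugeRel (x y : 𝔤.MC A) : Prop := ∃ a : 𝔤.tens A 0, 𝔤.gauge A a x.1 = y.1

lemma exists_adT_pow_eq_zero (a : 𝔤.tens A 0) : ∃ N : ℕ, ∀ n ≥ N, (𝔤.adT A a) ^ n = 0 := by
  let P : ℕ → Submodule K (𝔤.tens A 1) := fun n =>
    Submodule.span K {z | ∃ (l : 𝔤.L 1) (t : A.𝔪), (t : A.obj) ∈ A.𝔪 ^ (n + 1) ∧ z = l ⊗ₜ t}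
  have hstep : ∀ n, ∀ z ∈ P n, 𝔤.adT A a z ∈ P (n + 1) := by
    intro n z hz
    induction hz using Submodule.span_induction with
    | mem z hz =>
      obtain ⟨l, t, ht, rfl⟩ := hz
      induction a using TensorProduct.induction_on with
      | zero => simp [adT]
      | add a b ha hb =>
        have : 𝔤.adT A (a + b) (l ⊗ₜ t) = 𝔤.adT A a (l ⊗ₜ t) + 𝔤.adT A b (l ⊗ₜ t) := by
          simp [adT]
        rw [this]
        exact add_mem ha hb
      | tmul x s =>
        refine Submodule.subset_span ⟨𝔤.bracket 0 1 1 rfl x l, A.mul𝔪 s t, ?_, ?_⟩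
        · rw [pow_succ']
          exact Ideal.mul_mem_mul s.2 ht
        · simp [adT, bracketT]
    | zero => simp
    | add z w _ _ hz hw => rw [map_add]; exact add_mem hz hw
    | smul c z _ hz => rw [map_smul]; exact Submodule.smul_mem _ _ hz
  have hpow : ∀ n z, ((𝔤.adT A a) ^ n) z ∈ P n := by
    intro n
    induction n with
    | zero =>
      intro z
      induction z using TensorProduct.induction_on with
      | zero => simp
      | add z w hz hw => rw [map_add]; exact add_mem hz hw
      | tmul l t => exact Submodule.subset_span ⟨l, t, by simp, rfl⟩
    | succ n ih =>
      intro z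
      rw [pow_succ', Module.End.mul_apply]
      exact hstep n _ (ih z)
  obtain ⟨N, hN⟩ := A.isNilpotent_𝔪
  have hbot : ∀ n ≥ N, P n = ⊥ := by
    intro n hn
    refine Submodule.span_eq_bot.2 ?_
    rintro _ ⟨l, t, ht, rfl⟩
    have : A.𝔪 ^ (n + 1) = ⊥ := by
      have := pow_eq_zero_of_le (by omega : N ≤ n + 1) hN
      simpa using this
    rw [this] at ht
    have : t = 0 := Subtype.ext (by simpa using ht)
    rw [this, TensorProduct.tmul_zero]
  refine ⟨N, fun n hn => LinearMap.ext fun z => ?_⟩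
  have := hpow n z
  rw [hbot n hn] at this
  simpa using this

variable {A} {B : ArtAlg K} (f : A ⟶ B)

/-- The map `𝔤 ⊗ 𝔪_A → 𝔤 ⊗ 𝔪_B` induced by `A → B`. -/
noncomputable def mapT (n : ℤ) : 𝔤.tens A n →ₗ[K] 𝔤.tens B n :=
  (ArtAlg.map𝔪 f).lTensor (𝔤.L n)

lemma mapT_dT (i j : ℤ) (h : i + 1 = j) (x : 𝔤.tens A i) :
    𝔤.mapT f j (𝔤.dT A i j h x) = 𝔤.dT B i j h (𝔤.mapT f i x) := by
  induction x using TensorProduct.induction_on with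
  | zero => simp
  | add x y hx hy => simp [hx, hy]
  | tmul l t => simp [mapT, dT]

lemma mapT_bracketT (i j k : ℤ) (h : i + j = k) (x : 𝔤.tens A i) (y : 𝔤.tens A j) :
    𝔤.mapT f k (𝔤.bracketT A i j k h x y) =
      𝔤.bracketT B i j k h (𝔤.mapT f i x) (𝔤.mapT f j y) := by
  induction x using TensorProduct.induction_on with
  | zero => simp
  | add x x' hx hx' => simp [hx, hx']
  | tmul l t =>
    induction y using TensorProduct.induction_on with
    | zero => simp
    | add y y' hy hy' => simp [hy, hy']
    | tmul l' t' =>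
      have h : ArtAlg.map𝔪 f (A.mul𝔪 t t') = B.mul𝔪 (ArtAlg.map𝔪 f t) (ArtAlg.map𝔪 f t') :=
        Subtype.ext (map_mul f.hom.hom t.1 t'.1)
      simp only [mapT, bracketT, TensorProduct.map₂_apply_tmul, LinearMap.lTensor_tmul, TensorProduct.map_tmul, h]

lemma mapT_adT_pow (a : 𝔤.tens A 0) (n : ℕ) (x : 𝔤.tens A 1) :
    𝔤.mapT f 1 (((𝔤.adT A a) ^ n) x) = ((𝔤.adT B (𝔤.mapT f 0 a)) ^ n) (𝔤.mapT f 1 x) := by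
  induction n with
  | zero => rfl
  | succ n ih =>
    rw [pow_succ', pow_succ', Module.End.mul_apply, Module.End.mul_apply, ← ih]
    exact 𝔤.mapT_bracketT f 0 1 1 rfl a _

lemma mapT_gauge (a : 𝔤.tens A 0) (x : 𝔤.tens A 1) :
    𝔤.mapT f 1 (𝔤.gauge A a x) = 𝔤.gauge B (𝔤.mapT f 0 a) (𝔤.mapT f 1 x) := by
  have hfin : (Function.support fun n : ℕ => ((n + 1).factorial : K)⁻¹ •
      ((𝔤.adT A a) ^ n) (𝔤.adT A a x - 𝔤.dT A 0 1 rfl a)).Finite := by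
    obtain ⟨N, hN⟩ := 𝔤.exists_adT_pow_eq_zero A a
    refine (Set.finite_lt_nat N).subset fun n hn => ?_
    by_contra h
    exact hn (by simp [hN n (not_lt.1 h)])
  rw [gauge, gauge, map_add]
  congr 1
  refine ((𝔤.mapT f 1).toAddMonoidHom.map_finsum hfin).trans (finsum_congr fun n => ?_)
  change 𝔤.mapT f 1 _ = _
  rw [map_smul, mapT_adT_pow, map_sub, mapT_dT]
  congr 3
  rw [adT, mapT_bracketT]
  rfl

/-- Functoriality of Maurer-Cartan elements. -/
noncomputable def mapMC (x : 𝔤.MC A) : 𝔤.MC B :=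
  ⟨𝔤.mapT f 1 x.1, by
    have := congrArg (𝔤.mapT f 2) x.2
    rwa [map_add, map_smul, mapT_dT, mapT_bracketT, map_zero] at this⟩

lemma mapT_id (n : ℤ) : 𝔤.mapT (𝟙 A) n = LinearMap.id :=
  TensorProduct.ext' fun _ _ => rfl

lemma mapT_comp {C : ArtAlg K} (g : B ⟶ C) (n : ℤ) :
    𝔤.mapT (f ≫ g) n = 𝔤.mapT g n ∘ₗ 𝔤.mapT f n :=
  TensorProduct.ext' fun _ _ => rfl

/-- The deformation functor `Def_𝔤 : Art_K → Set` of a DG-Lie algebra: Maurer-Cartan elements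
modulo gauge equivalence. -/
noncomputable def defFunctor : ArtAlg K ⥤ Type u where
  obj A := Quot (𝔤.GaugeRel A)
  map f := ↾(Quot.map (𝔤.mapMC f) (by
    rintro x y ⟨a, ha⟩
    exact ⟨𝔤.mapT f 0 a, (𝔤.mapT_gauge f a x.1).symm.trans (congrArg (𝔤.mapT f 1) ha)⟩))
  map_id A := by
    ext ⟨x⟩
    exact congrArg (Quot.mk _) (Subtype.ext (by simp [mapMC, mapT_id]))
  map_comp f g := by
    ext ⟨x⟩
    exact congrArg (Quot.mk _) (Subtype.ext (by simp [mapMC, mapT_comp]))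

end DGLieAlgebra

section Schemes
open AlgebraicGeometry

/-- A scheme together with a sheaf of modules on it. -/
structure SchemePair where
  X : Scheme.{u}
  F : X.Modules

namespace SchemePair

/-- A morphism of pairs `(X, F) → (Y, G)`: a morphism of schemes `f : X → Y` together with an
`𝒪_Y`-linear morphism of sheaves `G → f_* F`. -/
structure Hom (P Q : SchemePair.{u}) where
  base : P.X ⟶ Q.X
  co : Q.F ⟶ (Scheme.Modules.pushforward base).obj P.F

lemma Hom.ext' {P Q : SchemePair.{u}} {f g : Hom P Q} (h : f.base = g.base)
    (h' : f.co ≫ (Scheme.Modules.pushforwardCongr h).hom.app P.F = g.co) : f = g := by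
  obtain ⟨f, c⟩ := f
  obtain ⟨g, c'⟩ := g
  obtain rfl : f = g := h
  have : c = c' := by
    refine Eq.trans ?_ h'
    ext U : 1
    simp
    exact (Category.comp_id _).symm
  rw [this]

noncomputable instance : Category SchemePair.{u} where
  Hom := Hom
  id P := ⟨𝟙 P.X, (Scheme.Modules.pushforwardId P.X).inv.app P.F⟩
  comp {P Q R} f g := ⟨f.base ≫ g.base, g.co ≫ (Scheme.Modules.pushforward g.base).map f.co ≫
    (Scheme.Modules.pushforwardComp f.base g.base).hom.app P.F⟩
  id_comp {X Y} f := Hom.ext' (Category.id_comp _) (by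
    ext U : 1
    exact congrArg (fun t => f.co.app U ≫ t) (X.F.presheaf.map_id _))
  comp_id {X Y} f := Hom.ext' (Category.comp_id _) (by
    ext U : 1
    exact congrArg (fun t => f.co.app U ≫ t) (X.F.presheaf.map_id _))
  assoc {W X Y Z} f g h := Hom.ext' (Category.assoc _ _ _) (by
    ext U : 1
    exact congrArg (fun t => h.co.app U ≫ g.co.app (h.base ⁻¹ᵁ U) ≫
      f.co.app (g.base ⁻¹ᵁ h.base ⁻¹ᵁ U) ≫ t) (W.F.presheaf.map_id _))

variable {P Q R : SchemePair.{u}}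

@[simp] lemma id_base (P : SchemePair.{u}) : (𝟙 P : P ⟶ P).base = 𝟙 P.X := rfl

@[simp] lemma comp_base (f : P ⟶ Q) (g : Q ⟶ R) : (f ≫ g).base = f.base ≫ g.base := rfl

lemma comp_co (f : P ⟶ Q) (g : Q ⟶ R) : (f ≫ g).co =
    g.co ≫ (Scheme.Modules.pushforward g.base).map f.co ≫
      (Scheme.Modules.pushforwardComp f.base g.base).hom.app P.F := rfl

/-- `(X, F) → (Y, G)` is cartesian if the induced morphism `f^* G → F` is an isomorphism. -/
def IsCartesian (f : P ⟶ Q) : Prop :=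
  IsIso (((Scheme.Modules.pullbackPushforwardAdjunction f.base).homEquiv Q.F P.F).symm f.co)

lemma isCartesian_iff (f : P ⟶ Q) : IsCartesian f ↔
    ∀ (G : P.X.Modules) (c : Q.F ⟶ (Scheme.Modules.pushforward f.base).obj G),
      ∃! α : P.F ⟶ G, f.co ≫ (Scheme.Modules.pushforward f.base).map α = c := by
  rw [IsCartesian, isIso_iff_coyoneda_map_bijective]
  refine forall_congr' fun G => ?_
  set e := (Scheme.Modules.pullbackPushforwardAdjunction f.base).homEquiv Q.F G
  have h : ∀ α : P.F ⟶ G, f.co ≫ (Scheme.Modules.pushforward f.base).map α =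
      e (((Scheme.Modules.pullbackPushforwardAdjunction f.base).homEquiv Q.F P.F).symm f.co ≫ α) := by
    intro α
    rw [Adjunction.homEquiv_naturality_right, Equiv.apply_symm_apply]
  rw [Function.bijective_iff_existsUnique, ← e.symm.forall_congr_right]
  simp only [h, Equiv.eq_symm_apply]

lemma IsCartesian.lift {f : P ⟶ Q} (hf : IsCartesian f) (h : R ⟶ Q) (k : R.X ⟶ P.X)
    (hk : k ≫ f.base = h.base) : ∃ g : R ⟶ P, g.base = k ∧ g ≫ f = h := by
  obtain ⟨hb, hc⟩ := h
  obtain rfl : k ≫ f.base = hb := hk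
  obtain ⟨α, hα, -⟩ := (isCartesian_iff f).1 hf _
    (hc ≫ (Scheme.Modules.pushforwardComp k f.base).inv.app R.F)
  refine ⟨⟨k, α⟩, rfl, ?_⟩
  change Hom.mk _ _ = Hom.mk _ _
  congr 1

lemma IsCartesian.hom_ext {f : P ⟶ Q} (hf : IsCartesian f) {g g' : R ⟶ P}
    (h : g.base = g'.base) (h' : g ≫ f = g' ≫ f) : g = g' := by
  obtain ⟨k, α⟩ := g
  obtain ⟨k', α'⟩ := g'
  obtain rfl : k = k' := h
  have e : f.co ≫ (Scheme.Modules.pushforward f.base).map α ≫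
      (Scheme.Modules.pushforwardComp k f.base).hom.app R.F =
      f.co ≫ (Scheme.Modules.pushforward f.base).map α' ≫
      (Scheme.Modules.pushforwardComp k f.base).hom.app R.F := by
    have := h'
    change Hom.mk _ _ = Hom.mk _ _ at this
    simpa only [Hom.mk.injEq, heq_eq_eq, true_and] using this
  simp only [← Category.assoc, cancel_mono] at e
  have : α = α' := ((isCartesian_iff f).1 hf _ _).unique e rfl
  rw [this]

lemma IsCartesian.comp {f : P ⟶ Q} {g : Q ⟶ R} (hf : IsCartesian f) (hg : IsCartesian g) :
    IsCartesian (f ≫ g) := by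
  refine (isCartesian_iff _).2 fun G c => ?_
  let i := (Scheme.Modules.pushforwardComp f.base g.base).app G
  have key : ∀ α : P.F ⟶ G, (f ≫ g).co ≫ (Scheme.Modules.pushforward (f ≫ g).base).map α =
      (g.co ≫ (Scheme.Modules.pushforward g.base).map
        (f.co ≫ (Scheme.Modules.pushforward f.base).map α)) ≫ i.hom := by
    intro α
    ext U : 1
    simp [comp_co, i]
  obtain ⟨β, hβ, hβ'⟩ := (isCartesian_iff g).1 hg _ (c ≫ i.inv)
  obtain ⟨α, hα, hα'⟩ := (isCartesian_iff f).1 hf _ β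
  refine ⟨α, ?_, fun α' h => hα' _ (hβ' _ ?_)⟩
  · simp only [key]
    rw [hα, hβ]; simp
  · simp only [key] at h
    rw [← h]; simp

lemma IsCartesian.of_comp {f : P ⟶ Q} {g : Q ⟶ R} (hfg : IsCartesian (f ≫ g))
    (hg : IsCartesian g) : IsCartesian f := by
  refine (isCartesian_iff _).2 fun G c => ?_
  let i := (Scheme.Modules.pushforwardComp f.base g.base).app G
  have key : ∀ α : P.F ⟶ G, (f ≫ g).co ≫ (Scheme.Modules.pushforward (f ≫ g).base).map α =
      (g.co ≫ (Scheme.Modules.pushforward g.base).map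
        (f.co ≫ (Scheme.Modules.pushforward f.base).map α)) ≫ i.hom := by
    intro α
    ext U : 1
    simp [comp_co, i]
  obtain ⟨α, hα, hα'⟩ := (isCartesian_iff (f ≫ g)).1 hfg G
    ((g.co ≫ (Scheme.Modules.pushforward g.base).map c) ≫ i.hom)
  refine ⟨α, ?_, fun α' h => hα' _ ?_⟩
  · simp only [key, cancel_mono] at hα
    exact ((isCartesian_iff g).1 hg _ _).unique hα rfl
  · simp only [key]
    rw [h]

lemma isCartesian_id (P : SchemePair.{u}) : IsCartesian (𝟙 P) := by
  refine (isCartesian_iff _).2 fun G c =>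
    ⟨c ≫ (Scheme.Modules.pushforwardId P.X).hom.app G, ?_, fun α h => ?_⟩
  · ext U : 1
    change 𝟙 _ ≫ c.app U ≫ 𝟙 _ = c.app U
    rfl
  · rw [← h]
    ext U : 1
    change α.app U = (𝟙 _ ≫ α.app U) ≫ 𝟙 _
    rfl

/-- The pullback of a pair along a morphism of schemes. -/
noncomputable def pull (P : SchemePair.{u}) {Y : Scheme.{u}} (f : Y ⟶ P.X) : SchemePair.{u} :=
  ⟨Y, (Scheme.Modules.pullback f).obj P.F⟩

/-- The canonical morphism from the pullback. -/
noncomputable def pullHom (P : SchemePair.{u}) {Y : Scheme.{u}} (f : Y ⟶ P.X) : P.pull f ⟶ P :=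
  ⟨f, (Scheme.Modules.pullbackPushforwardAdjunction f).unit.app P.F⟩

lemma isCartesian_pullHom (P : SchemePair.{u}) {Y : Scheme.{u}} (f : Y ⟶ P.X) :
    IsCartesian (P.pullHom f) := by
  have : ((Scheme.Modules.pullbackPushforwardAdjunction f).homEquiv P.F _).symm
      ((Scheme.Modules.pullbackPushforwardAdjunction f).unit.app P.F) = 𝟙 _ := by
    rw [Equiv.symm_apply_eq, Adjunction.homEquiv_id]
  change IsIso (((Scheme.Modules.pullbackPushforwardAdjunction f).homEquiv P.F _).symm
      ((Scheme.Modules.pullbackPushforwardAdjunction f).unit.app P.F))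
  rw [this]
  infer_instance

end SchemePair

/-- A sheaf of modules is coherent (on a locally noetherian scheme) if every point has an open
affine neighbourhood `Spec S` over which it is the sheaf associated with a finitely generated
`S`-module. -/
def SheafIsCoherent {X : Scheme.{u}} (F : X.Modules) : Prop :=
  ∀ x : X, ∃ (S : CommRingCat.{u}) (j : Spec S ⟶ X) (N : ModuleCat.{u} S),
    IsOpenImmersion j ∧ x ∈ Set.range j ∧
      Nonempty ((Scheme.Modules.pullback j).obj F ≅ tilde N) ∧ Module.Finite S N

/-- A (quasi-coherent) sheaf of modules on `π : X → Spec A` is flat over `A` if every point has an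
open affine neighbourhood `Spec S` over which it is the sheaf associated with an `S`-module which
is flat over `A`. -/
def SheafIsFlat {X : Scheme.{u}} {A : CommRingCat.{u}} (π : X ⟶ Spec A) (F : X.Modules) : Prop :=
  ∀ x : X, ∃ (S : CommRingCat.{u}) (j : Spec S ⟶ X) (N : ModuleCat.{u} S),
    IsOpenImmersion j ∧ x ∈ Set.range j ∧
      Nonempty ((Scheme.Modules.pullback j).obj F ≅ tilde N) ∧
      Module.Flat A ((ModuleCat.restrictScalars (Spec.preimage (j ≫ π)).hom).obj N)

/-- Global sections of a pushforward between affine schemes. -/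
noncomputable def pushforwardΓIso {R S : CommRingCat.{u}} (φ : R ⟶ S) :
    Scheme.Modules.pushforward (Spec.map φ) ⋙ moduleSpecΓFunctor (R := R) ≅
      moduleSpecΓFunctor (R := S) ⋙ ModuleCat.restrictScalars φ.hom :=
  Functor.isoWhiskerRight (pushforwardCompModulesSpecToSheafIso φ)
    (TopCat.Sheaf.forget _ _ ⋙ (evaluation _ _).obj (.op ⊤))

/-- Pullback of quasi-coherent sheaves between affine schemes is extension of scalars. -/
noncomputable def pullbackTildeIso {R S : CommRingCat.{u}} (φ : R ⟶ S) (N : ModuleCat.{u} R) :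
    (Scheme.Modules.pullback (Spec.map φ)).obj (tilde N) ≅
      tilde ((ModuleCat.extendScalars φ.hom).obj N) :=
  ((conjugateIsoEquiv
    ((ModuleCat.extendRestrictScalarsAdj φ.hom).comp (tilde.adjunction (R := S)))
    ((tilde.adjunction (R := R)).comp
      (Scheme.Modules.pullbackPushforwardAdjunction (Spec.map φ)))).symm
      (pushforwardΓIso φ).symm).app N

lemma exists_chart_baseChange {X Y : Scheme.{u}} {A B : CommRingCat.{u}} {f : A ⟶ B}
    {g : Y ⟶ X} {π' : Y ⟶ Spec B} {π : X ⟶ Spec A} (h : IsPullback g π' π (Spec.map f))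
    (F : X.Modules) (y : Y) {S : CommRingCat.{u}} (j : Spec S ⟶ X) (N : ModuleCat.{u} S)
    (hj : IsOpenImmersion j) (hy : g y ∈ Set.range j)
    (e : (Scheme.Modules.pullback j).obj F ≅ tilde N) :
    ∃ (T : CommRingCat.{u}) (l : Spec T ⟶ Y) (φ : S ⟶ T), IsOpenImmersion l ∧ y ∈ Set.range l ∧
      Nonempty ((Scheme.Modules.pullback l).obj ((Scheme.Modules.pullback g).obj F) ≅
        tilde ((ModuleCat.extendScalars φ.hom).obj N)) ∧
      IsPushout (Spec.preimage (j ≫ π)) f φ (Spec.preimage (l ≫ π')) := by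
  let a : A ⟶ S := Spec.preimage (j ≫ π)
  have ha : Spec.map a = j ≫ π := Spec.map_preimage _
  have hp := IsPushout.of_hasPushout a f
  have hq := isPullback_SpecMap_of_isPushout _ _ _ _ hp
  let T := Limits.pushout a f
  let φ : S ⟶ T := Limits.pushout.inl a f
  let ψ : B ⟶ T := Limits.pushout.inr a f
  let l : Spec T ⟶ Y := h.lift (Spec.map φ ≫ j) (Spec.map ψ) (by
    rw [Category.assoc, ← ha]; exact hq.w)
  have hl₁ : l ≫ g = Spec.map φ ≫ j := h.lift_fst _ _ _
  have hl₂ : l ≫ π' = Spec.map ψ := h.lift_snd _ _ _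
  have hsq : IsPullback (Spec.map φ) l j g := by
    have : IsPullback (Spec.map φ) (l ≫ π') (j ≫ π) (Spec.map f) := by
      rw [hl₂, ← ha]; exact hq
    exact IsPullback.of_bot this hl₁.symm h
  refine ⟨T, l, φ, ?_, ?_, ⟨?_⟩, ?_⟩
  · exact MorphismProperty.of_isPullback hsq hj
  · obtain ⟨z, hz⟩ := hy
    obtain ⟨w, -, hw⟩ := Scheme.exists_preimage_of_isPullback hsq z y hz
    exact ⟨w, hw⟩
  · exact (Scheme.Modules.pullbackComp l g).app F ≪≫
      (Scheme.Modules.pullbackCongr hl₁).app F ≪≫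
      ((Scheme.Modules.pullbackComp (Spec.map φ) j).app F).symm ≪≫
      (Scheme.Modules.pullback (Spec.map φ)).mapIso e ≪≫ pullbackTildeIso φ N
  · have : Spec.preimage (l ≫ π') = ψ := by rw [hl₂, Spec.preimage_map]
    rw [this]
    exact hp

lemma SheafIsCoherent.baseChange {X Y : Scheme.{u}} {A B : CommRingCat.{u}} {f : A ⟶ B}
    {g : Y ⟶ X} {π' : Y ⟶ Spec B} {π : X ⟶ Spec A} (h : IsPullback g π' π (Spec.map f))
    {F : X.Modules} (hF : SheafIsCoherent F) :
    SheafIsCoherent ((Scheme.Modules.pullback g).obj F) := by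
  intro y
  obtain ⟨S, j, N, hj, hy, ⟨e⟩, hN⟩ := hF (g y)
  obtain ⟨T, l, φ, hl, hy', he, -⟩ := exists_chart_baseChange h F y j N hj hy e
  refine ⟨T, l, _, hl, hy', he, ?_⟩
  let := φ.hom.toAlgebra
  exact inferInstanceAs (Module.Finite T (TensorProduct S T N))

lemma SheafIsFlat.baseChange {X Y : Scheme.{u}} {A B : CommRingCat.{u}} {f : A ⟶ B}
    {g : Y ⟶ X} {π' : Y ⟶ Spec B} {π : X ⟶ Spec A} (h : IsPullback g π' π (Spec.map f))
    {F : X.Modules} (hF : SheafIsFlat π F) :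
    SheafIsFlat π' ((Scheme.Modules.pullback g).obj F) := by
  intro y
  obtain ⟨S, j, N, hj, hy, ⟨e⟩, hN⟩ := hF (g y)
  obtain ⟨T, l, φ, hl, hy', he, hp⟩ := exists_chart_baseChange h F y j N hj hy e
  refine ⟨T, l, _, hl, hy', he, ?_⟩
  generalize Spec.preimage (l ≫ π') = ψ at hp ⊢
  generalize Spec.preimage (j ≫ π) = a at hp hN ⊢
  algebraize [f.hom, φ.hom, a.hom, ψ.hom, φ.hom.comp a.hom]
  have hw : a ≫ φ = f ≫ ψ := hp.w
  have : IsScalarTower A B T := IsScalarTower.of_algebraMap_eq' (congrArg CommRingCat.Hom.hom hw)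
  let : Module A N := Module.compHom N a.hom
  have : IsScalarTower A S N := ⟨fun r s n => by
    rw [Algebra.smul_def, mul_smul]; rfl⟩
  have : Module.Flat A N := hN
  have : Algebra.IsPushout A B S T := by
    exact (CommRingCat.isPushout_iff_isPushout (R := A) (S := S) (R' := B) (S' := T)).1 hp.flip
  let e' := Algebra.IsPushout.cancelBaseChange A B S T N
  change @Module.Flat B (T ⊗[S] N) _ _ (Module.compHom _ ψ.hom)
  have hm : (Module.compHom (T ⊗[S] N) ψ.hom : Module B (T ⊗[S] N)) =
      TensorProduct.leftModule := by
    ext b x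
    change ψ.hom b • x = _
    exact algebraMap_smul T b x
  rw [hm]
  exact Module.Flat.of_linearEquiv e'

namespace ArtAlg

variable {K : Type u} [Field K]

/-- The scheme `Spec A`. -/
noncomputable abbrev spec (A : ArtAlg K) : Scheme.{u} := Spec (.of A.obj)

/-- The closed point `Spec K → Spec A`. -/
noncomputable abbrev closedPt (A : ArtAlg K) : Spec (.of K) ⟶ A.spec :=
  Spec.map (CommRingCat.ofHom A.residue.toRingHom)

/-- The morphism `Spec B → Spec A` given by `A → B`. -/
noncomputable abbrev specMap {A B : ArtAlg K} (f : A ⟶ B) : B.spec ⟶ A.spec :=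
  Spec.map (CommRingCat.ofHom f.hom.hom.toRingHom)

lemma closedPt_specMap {A B : ArtAlg K} (f : A ⟶ B) : B.closedPt ≫ specMap f = A.closedPt := by
  rw [← Spec.map_comp, ← CommRingCat.ofHom_comp]
  exact congrArg (fun g : A.obj →ₐ[K] K => Spec.map (CommRingCat.ofHom g.toRingHom))
    (residue_comp f)

lemma specMap_id (A : ArtAlg K) : specMap (𝟙 A) = 𝟙 A.spec := Spec.map_id _

lemma specMap_comp {A B C : ArtAlg K} (f : A ⟶ B) (g : B ⟶ C) :
    specMap (f ≫ g) = specMap g ≫ specMap f :=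
  Spec.map_comp (CommRingCat.ofHom f.hom.hom.toRingHom) (CommRingCat.ofHom g.hom.hom.toRingHom)

end ArtAlg

variable {K : Type u} [Field K] (P : SchemePair.{u}) (p : P.X ⟶ Spec (.of K))

/-- An infinitesimal deformation over `A` of the pair `P = (X, F)`, where `X` is a `K`-scheme with
structure morphism `p`: a pair `(X_A, F_A)` with a flat morphism `π : X_A → Spec A` and a morphism
`X → X_A` making `X` the fibre of `π` over `Spec K`, where `F_A` is coherent and flat over `A`,
together with a morphism `F_A → F` inducing an isomorphism from the pullback of `F_A` to `X` onto
`F`. The morphisms `X → X_A` and `F_A → F` are the two components of `ι`. -/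
structure PairDeformation (A : ArtAlg K) where
  total : SchemePair.{u}
  π : total.X ⟶ A.spec
  ι : P ⟶ total
  isPullback : IsPullback ι.base p π A.closedPt
  flat : Flat π
  coherent : SheafIsCoherent total.F
  flat_sheaf : SheafIsFlat π total.F
  cartesian : SchemePair.IsCartesian ι

namespace PairDeformation

variable {P p} {A B C : ArtAlg K}

/-- Isomorphism of deformations: an isomorphism `f : X_A → X'_A` of schemes over `A` and an
isomorphism `f^* F'_A → F_A`, compatible with the morphisms from `X` to `X_A` and `X'_A` and with
the morphisms from `F_A` and `F'_A` to `F`. -/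
def Isom (D D' : PairDeformation P p A) : Prop :=
  ∃ g : D.total ⟶ D'.total, IsIso g.base ∧ SchemePair.IsCartesian g ∧ g.base ≫ D'.π = D.π ∧ D.ι ≫ g = D'.ι

lemma Isom.refl (D : PairDeformation P p A) : D.Isom D :=
  ⟨𝟙 _, inferInstanceAs (IsIso (𝟙 D.total.X)), SchemePair.isCartesian_id _,
    Category.id_comp _, Category.comp_id _⟩

lemma Isom.symm {D D' : PairDeformation P p A} (h : D.Isom D') : D'.Isom D := by
  obtain ⟨g, hi, hc, hπ, hι⟩ := h
  obtain ⟨g', hb, hg⟩ := hc.lift (𝟙 D'.total) (inv g.base) (by simp)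
  refine ⟨g', by rw [hb]; infer_instance, ?_, by rw [hb, ← hπ]; simp, hc.hom_ext ?_ ?_⟩
  · exact SchemePair.IsCartesian.of_comp (hg ▸ SchemePair.isCartesian_id _) hc
  · simp [hb, ← hι]
  · rw [Category.assoc, hg, Category.comp_id, hι]

lemma Isom.trans {D D' D'' : PairDeformation P p A} (h : D.Isom D') (h' : D'.Isom D'') :
    D.Isom D'' := by
  obtain ⟨g, hi, hc, hπ, hι⟩ := h
  obtain ⟨g', hi', hc', hπ', hι'⟩ := h'
  refine ⟨g ≫ g', inferInstanceAs (IsIso (g.base ≫ g'.base)), hc.comp hc', ?_, ?_⟩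
  · rw [SchemePair.comp_base, Category.assoc, hπ', hπ]
  · rw [← Category.assoc, hι, hι']

/-- Isomorphism of deformations is an equivalence relation. -/
instance setoid (P : SchemePair.{u}) (p : P.X ⟶ Spec (.of K)) (A : ArtAlg K) :
    Setoid (PairDeformation P p A) where
  r := Isom
  iseqv := ⟨Isom.refl, Isom.symm, Isom.trans⟩

/-- `D'` is a base change of the deformation `D` along `A → B`. -/
def IsBaseChange (f : A ⟶ B) (D : PairDeformation P p A) (D' : PairDeformation P p B) : Prop :=
  ∃ g : D'.total ⟶ D.total, IsPullback g.base D'.π D.π (ArtAlg.specMap f) ∧ SchemePair.IsCartesian g ∧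
    D'.ι ≫ g = D.ι

lemma exists_isBaseChange (f : A ⟶ B) (D : PairDeformation P p A) :
    ∃ D', IsBaseChange f D D' := by
  obtain ⟨Y, g, π', h⟩ : ∃ (Y : Scheme.{u}) (g : Y ⟶ D.total.X) (π' : Y ⟶ B.spec),
    IsPullback g π' D.π (ArtAlg.specMap f) := ⟨_, _, _, IsPullback.of_hasPullback _ _⟩
  have hc := D.total.isCartesian_pullHom g
  have hw : D.ι.base ≫ D.π = (p ≫ B.closedPt) ≫ ArtAlg.specMap f := by
    rw [Category.assoc, ArtAlg.closedPt_specMap, D.isPullback.w]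
  obtain ⟨ι, hb, hι⟩ := hc.lift D.ι (h.lift D.ι.base (p ≫ B.closedPt) hw) (h.lift_fst _ _ _)
  have hp : IsPullback ι.base p π' B.closedPt := by
    refine IsPullback.of_right (h₁₂ := g) ?_ ?_ h
    · rw [hb, ArtAlg.closedPt_specMap, h.lift_fst]
      exact D.isPullback
    · rw [hb]
      exact h.lift_snd _ _ _
  have hflat : Flat π' := MorphismProperty.of_isPullback h D.flat
  exact ⟨⟨D.total.pull g, π', ι, hp, hflat, D.coherent.baseChange h, D.flat_sheaf.baseChange h,
    SchemePair.IsCartesian.of_comp (hι ▸ D.cartesian) hc⟩, D.total.pullHom g, h, hc, hι⟩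

lemma IsBaseChange.isom {f : A ⟶ B} {D D₁ : PairDeformation P p A} {D' D₁' : PairDeformation P p B}
    (h : IsBaseChange f D D') (h₁ : IsBaseChange f D₁ D₁') (H : D.Isom D₁) : D'.Isom D₁' := by
  obtain ⟨g, hi, hc, hπ, hι⟩ := H
  obtain ⟨a, ha, hac, haι⟩ := h
  obtain ⟨a₁, ha₁, hac₁, haι₁⟩ := h₁
  have hg : IsPullback g.base D.π D₁.π (𝟙 _) := IsPullback.of_horiz_isIso ⟨by simp [hπ]⟩
  have hag : IsPullback (a.base ≫ g.base) D'.π D₁.π (ArtAlg.specMap f) := by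
    simpa using ha.paste_horiz hg
  have e₁ := hag.isoIsPullback_hom_fst _ _ ha₁
  have e₂ := hag.isoIsPullback_hom_snd _ _ ha₁
  obtain ⟨b, hb, hbι⟩ := hac₁.lift (a ≫ g) (hag.isoIsPullback _ _ ha₁).hom e₁
  have hh : (D'.ι ≫ b) ≫ a₁ = D₁'.ι ≫ a₁ := by
    rw [Category.assoc, hbι, ← Category.assoc, haι, hι, haι₁]
  refine ⟨b, by rw [hb]; infer_instance, SchemePair.IsCartesian.of_comp (hbι ▸ hac.comp hc) hac₁,
    by rw [hb, e₂], hac₁.hom_ext (ha₁.hom_ext ?_ ?_) hh⟩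
  · exact congrArg SchemePair.Hom.base hh
  · rw [SchemePair.comp_base, Category.assoc, hb, e₂, D'.isPullback.w, D₁'.isPullback.w]

lemma isBaseChange_id (D : PairDeformation P p A) : IsBaseChange (𝟙 A) D D :=
  ⟨𝟙 _, by rw [ArtAlg.specMap_id]; exact IsPullback.id_horiz D.π,
    SchemePair.isCartesian_id _, Category.comp_id _⟩

lemma IsBaseChange.comp {f : A ⟶ B} {g : B ⟶ C} {D : PairDeformation P p A}
    {D' : PairDeformation P p B} {D'' : PairDeformation P p C} (h : IsBaseChange f D D')
    (h' : IsBaseChange g D' D'') : IsBaseChange (f ≫ g) D D'' := by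
  obtain ⟨a, ha, hac, haι⟩ := h
  obtain ⟨b, hb, hbc, hbι⟩ := h'
  refine ⟨b ≫ a, ?_, hbc.comp hac, by rw [← Category.assoc, hbι, haι]⟩
  rw [ArtAlg.specMap_comp]
  exact hb.paste_horiz ha

/-- The base change of a deformation along `A → B` (unique up to isomorphism). -/
noncomputable def baseChange (f : A ⟶ B) (D : PairDeformation P p A) : PairDeformation P p B :=
  (exists_isBaseChange f D).choose

lemma isBaseChange_baseChange (f : A ⟶ B) (D : PairDeformation P p A) :
    IsBaseChange f D (D.baseChange f) :=
  (exists_isBaseChange f D).choose_spec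

end PairDeformation

/-- The functor `Def_(X, F) : Art_K → Set` of isomorphism classes of infinitesimal deformations of
a pair `P = (X, F)`. -/
noncomputable def defPair : ArtAlg K ⥤ Type (u + 1) where
  obj A := Quotient (PairDeformation.setoid P p A)
  map f := ↾(Quotient.map (PairDeformation.baseChange f) fun D D' h =>
    (D.isBaseChange_baseChange f).isom (D'.isBaseChange_baseChange f) h)
  map_id A := by
    ext x
    induction x using Quotient.inductionOn with
    | h D =>
      exact Quotient.sound ((D.isBaseChange_baseChange (𝟙 A)).isom D.isBaseChange_id (.refl D))
  map_comp f g := by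
    ext x
    induction x using Quotient.inductionOn with
    | h D =>
      exact Quotient.sound ((D.isBaseChange_baseChange (f ≫ g)).isom
        ((D.isBaseChange_baseChange f).comp (PairDeformation.isBaseChange_baseChange g _))
        (.refl D))

end Schemes

/-! The differential `d` on `A ⊗ E` is perturbed, and the deformed module is read off as a cokernel.
In degree one `D` has no derivation component, so an element `x` of `D¹ ⊗ 𝔪` is the same as an `A ⊗
R`-linear map `d + x` of degree one reducing to `d` (`exists_twist`), and the Maurer-Cartan equation
says `(d + x)² = 0` (`mc_iff`). Modulo `𝔪` the twisted complex is `E`, which is exact in negative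
degrees, and its terms are flat over `A`. The local criterion of flatness for a nilpotent ideal
(`exact_lTensor_of_isNilpotent`, `flat_of_isNilpotent`) then shows that the twisted complex is exact
in negative degrees and that its cokernel `N` in degree zero is flat over `A`, with `N / 𝔪N = M`
(`flat_coker`, `cokerRed_eq_zero_iff`). So `x` gives the deformation `(Spec (A ⊗ R), Ñ)`.

An element of `D⁰ ⊗ 𝔪` exponentiates to an automorphism of the algebra `A ⊗ R` and a semilinear
automorphism of `A ⊗ E`, and the gauge action is conjugation by it (`twist_gauge`). Hence gauge
equivalent elements give isomorphic deformations (`cokerRel_gauge`).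

Injectivity: as the `E^p` are projective, an isomorphism of cokernels compatible with the reductions
to `M` lifts to an isomorphism of twisted complexes which is the identity modulo `𝔪`
(`exists_lift_cokerRel`). In characteristic zero such an isomorphism is removed by exponentials, one
power of `𝔪` at a time (`exists_autE`, `quot_eq_of_semilinear`).

Surjectivity: the total space of a deformation of `Spec R` is a nilpotent thickening of an affine
scheme, hence affine (`isAffine_of_nilpotent_thickening`), and its sheaf is quasi-coherent, hence
some `Ñ` (`exists_spec`). Formal smoothness of `R` trivializes the algebra to `A ⊗ R`
(`ArtAlg.exists_tensor_bijective`), and the resolution `E` of `M` lifts degree by degree to a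
resolution of `N`, whose differential is a twist of `d` (`exists_coker_equiv`).

Naturality in `A` holds because cokernels commute with base change (`isCartesian_cokerMap`). -/

/-! ### Morphisms of affine pairs as semilinear maps of modules. -/

section SpecPairs
open AlgebraicGeometry

namespace SchemePair
variable {S T U : CommRingCat.{u}}

/-- The affine pair `(Spec S, Ñ)`. -/
noncomputable abbrev spec (N : ModuleCat.{u} S) : SchemePair.{u} := ⟨Spec S, tilde N⟩

/-- A global section of `Ñ` given by an element of `N`. -/
noncomputable def sec (N : ModuleCat.{u} S) (n : N) : Γ(tilde N, ⊤) := tilde.toOpen N ⊤ n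

lemma sec_bijective (N : ModuleCat.{u} S) : Function.Bijective (sec N) := by
  have : IsIso (tilde.toOpen N ⊤) := inferInstance
  exact (ConcreteCategory.isIso_iff_bijective _).1 this

/-- Morphisms out of `Ñ` are determined by their effect on global sections. -/
lemma tilde_hom_ext {N : ModuleCat.{u} S} {G : (Spec S).Modules} {f g : tilde N ⟶ G}
    (h : ∀ n : N, f.app ⊤ (sec N n) = g.app ⊤ (sec N n)) : f = g := by
  apply ((tilde.adjunction (R := S)).homEquiv N G).injective
  ext n
  exact h n

/-- The adjunction between `Ñ` and global sections. -/
noncomputable def tildeHomEquiv (N : ModuleCat.{u} S) (G : (Spec S).Modules) :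
    (tilde N ⟶ G) ≃ (N ⟶ moduleSpecΓFunctor.obj G) :=
  (tilde.adjunction (R := S)).homEquiv N G

/-- The global sections of `Ñ`. -/
noncomputable def topIso (N : ModuleCat.{u} S) : N ≅ moduleSpecΓFunctor.obj (tilde N) :=
  tilde.isoTop N

/-- Semilinear maps from `N` to the global sections of `G` are the same as morphisms from `Ñ` to
the pushforward of `G`. -/
noncomputable def specHomEquiv (φ : S ⟶ T) (N : ModuleCat.{u} S) (G : (Spec T).Modules) :
    (tilde N ⟶ (Scheme.Modules.pushforward (Spec.map φ)).obj G) ≃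
      (N ⟶ (ModuleCat.restrictScalars φ.hom).obj (moduleSpecΓFunctor.obj G)) :=
  ((tilde.adjunction (R := S)).homEquiv N _).trans
    ((Iso.refl N).homCongr ((pushforwardΓIso φ).app G))

/-- The morphism of affine pairs given by a semilinear map. -/
noncomputable def specHom (φ : S ⟶ T) {N : ModuleCat.{u} S} {N' : ModuleCat.{u} T}
    (c : N ⟶ (ModuleCat.restrictScalars φ.hom).obj N') : spec N' ⟶ spec N where
  base := Spec.map φ
  co := (specHomEquiv φ N (tilde N')).symm
    (c ≫ (ModuleCat.restrictScalars φ.hom).map (topIso N').hom)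

@[simp] lemma specHom_base (φ : S ⟶ T) {N : ModuleCat.{u} S} {N' : ModuleCat.{u} T}
    (c : N ⟶ (ModuleCat.restrictScalars φ.hom).obj N') : (specHom φ c).base = Spec.map φ := rfl

lemma specHom_co (φ : S ⟶ T) {N : ModuleCat.{u} S} {N' : ModuleCat.{u} T}
    (c : N ⟶ (ModuleCat.restrictScalars φ.hom).obj N') (n : N) :
    (specHom φ c).co.app ⊤ (sec N n) = sec N' (c n) := by
  have h := (specHomEquiv φ N (tilde N')).apply_symm_apply
    (c ≫ (ModuleCat.restrictScalars φ.hom).map (topIso N').hom)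
  exact congrArg (fun t => t.hom n) h

/-- Morphisms to an affine pair are determined by their effect on spaces and global sections. -/
lemma spec_hom_ext {P : SchemePair.{u}} {N : ModuleCat.{u} S} {f g : P ⟶ spec N}
    (hb : f.base = g.base)
    (h : ∀ n : N, (f.co.app ⊤ (sec N n) : Γ(P.F, ⊤)) = g.co.app ⊤ (sec N n)) : f = g := by
  obtain ⟨f, c⟩ := f
  obtain ⟨g, c'⟩ := g
  obtain rfl : f = g := hb
  have : c = c' := tilde_hom_ext h
  rw [this]

/-- The composite ring map is a separate variable `χ`, because in applications `c''` lives over a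
map that is only provably equal to `φ ≫ ψ`. -/
lemma specHom_comp (φ : S ⟶ T) (ψ : T ⟶ U) (χ : S ⟶ U) (hχ : φ ≫ ψ = χ) {N : ModuleCat.{u} S}
    {N' : ModuleCat.{u} T} {N'' : ModuleCat.{u} U}
    (c : N ⟶ (ModuleCat.restrictScalars φ.hom).obj N')
    (c' : N' ⟶ (ModuleCat.restrictScalars ψ.hom).obj N'')
    (c'' : N ⟶ (ModuleCat.restrictScalars χ.hom).obj N'')
    (h : ∀ n : N, c'' n = c' (c n : N')) :
    specHom ψ c' ≫ specHom φ c = specHom χ c'' := by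
  subst hχ
  refine spec_hom_ext (by simp) fun n => ?_
  have e : (specHom ψ c' ≫ specHom φ c).co.app ⊤ (sec N n) =
      (specHom ψ c').co.app ⊤ ((specHom φ c).co.app ⊤ (sec N n)) := rfl
  rw [e, specHom_co, specHom_co]
  exact (specHom_co ψ c' (c n)).trans (congrArg _ (h n).symm)

/-- Fullness: the base is `Spec` of a ring map, and the sheaf component corresponds under the tilde
adjunction to a module map, since `topIso` identifies the global sections of `Ñ'` with `N'`. -/
lemma exists_specHom {N : ModuleCat.{u} S} {N' : ModuleCat.{u} T} (f : spec N' ⟶ spec N) :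
    ∃ (φ : S ⟶ T) (c : N ⟶ (ModuleCat.restrictScalars φ.hom).obj N'), f = specHom φ c := by
  obtain ⟨b, co⟩ := f
  obtain ⟨φ, rfl⟩ : ∃ φ, b = Spec.map φ := ⟨_, (Spec.map_preimage b).symm⟩
  refine ⟨φ, specHomEquiv φ N (tilde N') co ≫
    (ModuleCat.restrictScalars φ.hom).map (topIso N').inv, ?_⟩
  change Hom.mk _ _ = Hom.mk _ _
  congr 1
  refine (Equiv.eq_symm_apply _).2 ?_
  rw [Category.assoc, ← Functor.map_comp, Iso.inv_hom_id]
  simp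

lemma specHom_injective {φ ψ : S ⟶ T} {N : ModuleCat.{u} S} {N' : ModuleCat.{u} T}
    {c : N ⟶ (ModuleCat.restrictScalars φ.hom).obj N'}
    {c' : N ⟶ (ModuleCat.restrictScalars ψ.hom).obj N'} (h : specHom φ c = specHom ψ c') :
    φ = ψ ∧ ∀ n : N, (c n : N') = c' n := by
  obtain rfl : φ = ψ := Spec.map_injective (congrArg Hom.base h)
  refine ⟨rfl, fun n => (sec_bijective N').1 ?_⟩
  refine (specHom_co φ c n).symm.trans (.trans ?_ (specHom_co φ c' n))
  rw [h]

/-- A morphism of affine pairs is cartesian iff the semilinear map defining it is universal. -/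
lemma isCartesian_specHom_iff (φ : S ⟶ T) {N : ModuleCat.{u} S} {N' : ModuleCat.{u} T}
    (c : N ⟶ (ModuleCat.restrictScalars φ.hom).obj N') : IsCartesian (specHom φ c) ↔
      ∀ (Q : ModuleCat.{u} T) (c' : N ⟶ (ModuleCat.restrictScalars φ.hom).obj Q),
        ∃! α : N' ⟶ Q, c ≫ (ModuleCat.restrictScalars φ.hom).map α = c' := by
  -- The adjunction turns the universal property among sheaves `G` into one among the modules of
  -- global sections of `G`.
  have key : ∀ (G : (Spec T).Modules) (α : tilde N' ⟶ G)
      (d : tilde N ⟶ (Scheme.Modules.pushforward (Spec.map φ)).obj G),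
      (specHom φ c).co ≫ (Scheme.Modules.pushforward (Spec.map φ)).map α = d ↔
        c ≫ (ModuleCat.restrictScalars φ.hom).map
          (tildeHomEquiv N' G α) = specHomEquiv φ N G d := by
    intro G α d
    rw [← (specHomEquiv φ N G).apply_eq_iff_eq]
    have : specHomEquiv φ N G ((specHom φ c).co ≫
        (Scheme.Modules.pushforward (Spec.map φ)).map α) =
        c ≫ (ModuleCat.restrictScalars φ.hom).map
          (tildeHomEquiv N' G α) := by
      ext n
      exact congrArg (α.app ⊤) (specHom_co φ c n)
    rw [this]
  have iff : IsCartesian (specHom φ c) ↔ ∀ (G : (Spec T).Modules)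
      (d : tilde N ⟶ (Scheme.Modules.pushforward (Spec.map φ)).obj G), ∃! α : tilde N' ⟶ G,
        (specHom φ c).co ≫ (Scheme.Modules.pushforward (Spec.map φ)).map α = d :=
    isCartesian_iff _
  rw [iff]
  constructor
  · intro H Q c'
    -- Every module `Q` is the module of global sections of its own tilde, so testing against
    -- sheaves tests against all modules. In the converse direction `G` need not be quasi-coherent.
    let G := tilde Q
    let i : Q ≅ moduleSpecΓFunctor.obj G := topIso Q
    obtain ⟨α, hα, hu⟩ := H G ((specHomEquiv φ N G).symm
      (c' ≫ (ModuleCat.restrictScalars φ.hom).map i.hom))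
    refine ⟨tildeHomEquiv N' G α ≫ i.inv, ?_, fun β hβ => ?_⟩
    · have := (key G α _).1 hα
      rw [Equiv.apply_symm_apply] at this
      beta_reduce
      rw [Functor.map_comp, ← Category.assoc, this, Category.assoc, ← Functor.map_comp,
        Iso.hom_inv_id]
      simp
    · have := hu ((tildeHomEquiv N' G).symm (β ≫ i.hom)) (by
        refine (key G _ _).2 ?_
        rw [Equiv.apply_symm_apply, Equiv.apply_symm_apply, Functor.map_comp, ← hβ,
          Category.assoc])
      rw [← this, Equiv.apply_symm_apply, Category.assoc, Iso.hom_inv_id, Category.comp_id]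
  · intro H G d
    obtain ⟨β, hβ, hu⟩ := H _ (specHomEquiv φ N G d)
    refine ⟨(tildeHomEquiv N' G).symm β, ?_, fun α hα => ?_⟩
    · refine (key G _ _).2 ?_
      rw [Equiv.apply_symm_apply]
      exact hβ
    · rw [Equiv.eq_symm_apply]
      exact hu _ ((key G α _).1 hα)

end SchemePair
end SpecPairs

/-! ### Nilpotent thickenings of affine schemes are affine. -/

section Thickening

/-- Kernels commute with localization: `x` is a fraction whose numerator dies in `C₀`, hence in `P₀`
after multiplication by a power of `s`. All exponents from some `N₀` on are allowed, so that two
charts can share one exponent. -/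
lemma exists_ker_lift_of_away {P C P₀ C₀ : Type*} [CommRing P] [CommRing C] [CommRing P₀]
    [CommRing C₀] (a : P →+* C) (a₀ : P₀ →+* C₀) (πP : P →+* P₀) (πC : C →+* C₀)
    (comm : ∀ p, πC (a p) = a₀ (πP p)) (s : P)
    (h : @IsLocalization.Away P _ s C _ a.toAlgebra)
    (h₀ : @IsLocalization.Away P₀ _ (πP s) C₀ _ a₀.toAlgebra) {x : C} (hx : πC x = 0) :
    ∃ N₀, ∀ N ≥ N₀, ∃ p, πP p = 0 ∧ a p = a s ^ N * x := by
  let := a.toAlgebra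
  let := a₀.toAlgebra
  obtain ⟨n, p, hp⟩ := IsLocalization.Away.surj s x
  have hp : x * a s ^ n = a p := hp
  have : a₀ (πP p) = 0 := by rw [← comm, ← hp, map_mul, hx, zero_mul]
  obtain ⟨⟨_, m, rfl⟩, hm⟩ := (IsLocalization.map_eq_zero_iff (.powers (πP s)) C₀ (πP p)).1 this
  have hm : πP s ^ m * πP p = 0 := hm
  refine ⟨n + m, fun N hN => ⟨s ^ (N - n) * p, ?_, ?_⟩⟩
  · rw [show N - n = (N - n - m) + m by omega, pow_add, mul_assoc, map_mul, map_mul, map_pow,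
      map_pow, hm, mul_zero]
  · rw [map_mul, map_pow, ← hp, show N = (N - n) + n by omega, pow_add]
    rw [show N - n + n - n = N - n by omega]
    ring

/-- The first Čech cohomology of a nilpotent ideal on a covering by two principal opens
vanishes. -/
lemma exists_ker_add_ker {P Q C P₀ Q₀ C₀ : Type*} [CommRing P] [CommRing Q] [CommRing C]
    [CommRing P₀] [CommRing Q₀] [CommRing C₀] (a : P →+* C) (a₀ : P₀ →+* C₀) (b : Q →+* C)
    (b₀ : Q₀ →+* C₀) (πP : P →+* P₀) (πQ : Q →+* Q₀) (πC : C →+* C₀)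
    (commP : ∀ p, πC (a p) = a₀ (πP p)) (commQ : ∀ p, πC (b p) = b₀ (πQ p)) (s : P) (t : Q)
    (hs : @IsLocalization.Away P _ s C _ a.toAlgebra)
    (hs₀ : @IsLocalization.Away P₀ _ (πP s) C₀ _ a₀.toAlgebra)
    (ht : @IsLocalization.Away Q _ t C _ b.toAlgebra)
    (ht₀ : @IsLocalization.Away Q₀ _ (πQ t) C₀ _ b₀.toAlgebra)
    (unit : ∀ N : ℕ, ∃ (β : P) (α : Q), πC (a (β * s ^ N) + b (α * t ^ N)) = 1)
    {n : ℕ} (hn : (RingHom.ker πC) ^ n = ⊥) {x : C} (hx : πC x = 0) :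
    ∃ p q, πP p = 0 ∧ πQ q = 0 ∧ x = a p + b q := by
  -- Successive approximation: the error after the correction is `x` times `1 - (β s^N + α t^N)`, a
  -- factor which lies in the kernel, so one power of the kernel is gained.
  have key : ∀ k : ℕ, ∀ x : C, πC x = 0 → x ∈ RingHom.ker πC ^ k →
      ∃ p q, πP p = 0 ∧ πQ q = 0 ∧ x - (a p + b q) ∈ RingHom.ker πC ^ (k + 1) := by
    intro k x hx hxk
    obtain ⟨N₁, h₁⟩ := exists_ker_lift_of_away a a₀ πP πC commP s hs hs₀ hx
    obtain ⟨N₂, h₂⟩ := exists_ker_lift_of_away b b₀ πQ πC commQ t ht ht₀ hx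
    obtain ⟨p, hp, hp'⟩ := h₁ (max N₁ N₂) (le_max_left _ _)
    obtain ⟨q, hq, hq'⟩ := h₂ (max N₁ N₂) (le_max_right _ _)
    obtain ⟨β, α, h⟩ := unit (max N₁ N₂)
    refine ⟨β * p, α * q, by simp [hp], by simp [hq], ?_⟩
    rw [map_mul, map_mul, hp', hq', pow_succ']
    have : x - (a β * (a s ^ max N₁ N₂ * x) + b α * (b t ^ max N₁ N₂ * x)) =
        (1 - (a (β * s ^ max N₁ N₂) + b (α * t ^ max N₁ N₂))) * x := by
      simp only [map_mul, map_pow]; ring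
    rw [this]
    exact Ideal.mul_mem_mul (by rw [RingHom.mem_ker, map_sub, h, map_one, sub_self]) hxk
  have key' : ∀ k : ℕ, ∃ p q, πP p = 0 ∧ πQ q = 0 ∧ x - (a p + b q) ∈ RingHom.ker πC ^ k := by
    intro k
    induction k with
    | zero => exact ⟨0, 0, map_zero _, map_zero _, by simp⟩
    | succ k ih =>
      obtain ⟨p, q, hp, hq, h⟩ := ih
      obtain ⟨p', q', hp', hq', h'⟩ := key k _ (by
        rw [map_sub, map_add, commP, commQ, hp, hq, hx]; simp) h
      refine ⟨p + p', q + q', by simp [hp, hp'], by simp [hq, hq'], ?_⟩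
      convert h' using 1
      simp only [map_add]; ring
  obtain ⟨p, q, hp, hq, h⟩ := key' n
  rw [hn, Ideal.mem_bot, sub_eq_zero] at h
  exact ⟨p, q, hp, hq, h⟩

open AlgebraicGeometry TopologicalSpace

variable {X Y : Scheme.{u}} (i : X ⟶ Y)

lemma isUnit_res_of_le_basicOpen {U V : X.Opens} (f : Γ(X, U)) (hV : V ≤ U)
    (h : V ≤ X.basicOpen f) : IsUnit (X.presheaf.map (homOfLE hV).op f) := by
  have hu := RingedSpace.isUnit_res_basicOpen X.toLocallyRingedSpace.toRingedSpace f
  have e : X.presheaf.map (homOfLE hV).op f =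
      X.presheaf.map (homOfLE h).op (X.presheaf.map (homOfLE (X.basicOpen_le f)).op f) :=
    congr($(X.presheaf.map_comp (homOfLE (X.basicOpen_le f)).op (homOfLE h).op).hom f)
  rw [e]
  exact hu.map (X.presheaf.map (homOfLE h).op).hom

lemma preimage_le_preimage_iff [Surjective i] {U V : Y.Opens} : i ⁻¹ᵁ U ≤ i ⁻¹ᵁ V ↔ U ≤ V := by
  refine ⟨fun h y hy => ?_, fun h => i.preimage_mono h⟩
  obtain ⟨x, rfl⟩ := i.surjective y
  exact h hy

lemma preimage_injective_of_surjective [Surjective i] {U V : Y.Opens} (h : i ⁻¹ᵁ U = i ⁻¹ᵁ V) : U = V :=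
  le_antisymm ((preimage_le_preimage_iff i).1 h.le) ((preimage_le_preimage_iff i).1 h.ge)

lemma exists_preimage_eq [IsClosedImmersion i] (U : X.Opens) : ∃ V : Y.Opens, i ⁻¹ᵁ V = U := by
  obtain ⟨V, hV, h⟩ := i.isClosedEmbedding.isInducing.isOpen_iff.1 U.2
  exact ⟨⟨V, hV⟩, Opens.ext h⟩

/-- A principal open of an affine open of `Y`. -/
lemma exists_affine_preimage_basicOpen [IsClosedImmersion i] {U : Y.Opens} (hU : IsAffineOpen U) (f : Γ(X, i ⁻¹ᵁ U)) :
    ∃ s : Γ(Y, U), i.app U s = f ∧ IsAffineOpen (Y.basicOpen s) ∧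
      i ⁻¹ᵁ (Y.basicOpen s) = X.basicOpen f := by
  obtain ⟨s, hs⟩ := i.app_surjective U hU f
  exact ⟨s, hs, hU.basicOpen s, by rw [Scheme.preimage_basicOpen, hs]⟩

/-- Sections lift over the affine opens `U` and `V`. The two lifts differ on the overlap by a
section of the nilpotent kernel, which is a Čech coboundary by `exists_ker_add_ker`, so the lifts
can be corrected and glued. -/
lemma exists_lift_of_two_affine [IsClosedImmersion i] [Surjective i] {n : ℕ}
    (hn : ∀ U : Y.Opens, IsAffineOpen U → RingHom.ker (i.app U).hom ^ n = ⊥)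
    {W U V : Y.Opens} (hU : IsAffineOpen U) (hV : IsAffineOpen V)
    {f g : Γ(X, i ⁻¹ᵁ W)} (hfg : f + g = 1)
    (hUf : i ⁻¹ᵁ U = X.basicOpen f) (hVg : i ⁻¹ᵁ V = X.basicOpen g) (r : Γ(X, i ⁻¹ᵁ W)) :
    ∃ r' : Γ(Y, W), i.app W r' = r := by
  have hUW : U ≤ W := (preimage_le_preimage_iff i).1 (hUf.trans_le (X.basicOpen_le f))
  have hVW : V ≤ W := (preimage_le_preimage_iff i).1 (hVg.trans_le (X.basicOpen_le g))
  have hcov : W ≤ U ⊔ V := by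
    refine (preimage_le_preimage_iff i).1 ?_
    have : X.basicOpen (f + g) ≤ X.basicOpen f ⊔ X.basicOpen g := X.basicOpen_add_le ..
    rw [hfg, Scheme.basicOpen_one, ← hUf, ← hVg] at this
    exact this
  let resU : Γ(X, i ⁻¹ᵁ W) →+* Γ(X, i ⁻¹ᵁ U) :=
    (X.presheaf.map (homOfLE (i.preimage_mono hUW)).op).hom
  let resV : Γ(X, i ⁻¹ᵁ W) →+* Γ(X, i ⁻¹ᵁ V) :=
    (X.presheaf.map (homOfLE (i.preimage_mono hVW)).op).hom
  let a₀ : Γ(X, i ⁻¹ᵁ U) →+* Γ(X, i ⁻¹ᵁ (U ⊓ V)) :=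
    (X.presheaf.map (homOfLE (i.preimage_mono inf_le_left)).op).hom
  let b₀ : Γ(X, i ⁻¹ᵁ V) →+* Γ(X, i ⁻¹ᵁ (U ⊓ V)) :=
    (X.presheaf.map (homOfLE (i.preimage_mono inf_le_right)).op).hom
  let a : Γ(Y, U) →+* Γ(Y, U ⊓ V) := (Y.presheaf.map (homOfLE inf_le_left).op).hom
  let b : Γ(Y, V) →+* Γ(Y, U ⊓ V) := (Y.presheaf.map (homOfLE inf_le_right).op).hom
  have comm₀ : ∀ z, a₀ (resU z) = b₀ (resV z) := fun z => by
    change ((X.presheaf.map _) ≫ X.presheaf.map _).hom z =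
      ((X.presheaf.map _) ≫ X.presheaf.map _).hom z
    rw [← Functor.map_comp, ← Functor.map_comp]
    rfl
  have commP : ∀ p, (i.app (U ⊓ V)).hom (a p) = a₀ ((i.app U).hom p) := fun p =>
    congr($(i.naturality (homOfLE (inf_le_left : U ⊓ V ≤ U)).op).hom p)
  have commQ : ∀ p, (i.app (U ⊓ V)).hom (b p) = b₀ ((i.app V).hom p) := fun p =>
    congr($(i.naturality (homOfLE (inf_le_right : U ⊓ V ≤ V)).op).hom p)
  obtain ⟨s, hs, hs', hs''⟩ := exists_affine_preimage_basicOpen i hU (resU g)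
  obtain ⟨t, ht, ht', ht''⟩ := exists_affine_preimage_basicOpen i hV (resV f)
  have e₁ : X.basicOpen (resU g) = i ⁻¹ᵁ (U ⊓ V) := by
    rw [Scheme.Hom.preimage_inf, hVg]; exact X.basicOpen_res _ _
  have e₂ : X.basicOpen (resV f) = i ⁻¹ᵁ (U ⊓ V) := by
    rw [Scheme.Hom.preimage_inf, hUf, inf_comm]; exact X.basicOpen_res _ _
  have es : U ⊓ V = Y.basicOpen s := preimage_injective_of_surjective i (by rw [hs'', e₁])
  have et : U ⊓ V = Y.basicOpen t := preimage_injective_of_surjective i (by rw [ht'', e₂])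
  have hUX : IsAffineOpen (i ⁻¹ᵁ U) := hU.preimage i
  have hVX : IsAffineOpen (i ⁻¹ᵁ V) := hV.preimage i
  obtain ⟨p, hp⟩ := i.app_surjective U hU (resU r)
  obtain ⟨q, hq⟩ := i.app_surjective V hV (resV r)
  obtain ⟨p', q', hp', hq', h⟩ := exists_ker_add_ker a a₀ b b₀ (i.app U).hom (i.app V).hom
    (i.app (U ⊓ V)).hom commP commQ s t
    (hU.isLocalization_of_eq_basicOpen s _ es)
    (hUX.isLocalization_of_eq_basicOpen _ _ (by rw [hs]; exact e₁.symm))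
    (hV.isLocalization_of_eq_basicOpen t _ et)
    (hVX.isLocalization_of_eq_basicOpen _ _ (by rw [ht]; exact e₂.symm))
    -- The overlap is the locus of `g` in `U` and of `f` in `V`. As `f + g = 1`, the powers `g^N`
    -- and `f^N` are comaximal over `W`; the coefficients of such a relation are lifted to `U` and
    -- `V` separately.
    (fun N => by
      obtain ⟨β₀, α₀, hβα⟩ : IsCoprime (g ^ N) (f ^ N) :=
        IsCoprime.pow ⟨1, 1, by rw [one_mul, one_mul, add_comm, hfg]⟩
      obtain ⟨β, hβ⟩ := i.app_surjective U hU (resU β₀)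
      obtain ⟨α, hα⟩ := i.app_surjective V hV (resV α₀)
      refine ⟨β, α, ?_⟩
      rw [map_add, commP, commQ, map_mul (i.app U).hom, map_mul (i.app V).hom, map_pow, map_pow]
      erw [hβ, hα, hs, ht]
      rw [← map_pow,
        ← map_pow, ← map_mul, ← map_mul, comm₀, ← map_add, ← map_add, hβα, map_one, map_one])
    (hn (U ⊓ V) (es ▸ hs')) (x := a p - b q) (by
      rw [map_sub, commP, commQ, hp, hq, comm₀, sub_self])
  have hglue : a (p - p') = b (q + q') := by
    rw [map_sub, map_add]
    linear_combination h
  obtain ⟨r₁, hr₁, hr₂⟩ : ∃ r₁ : Γ(Y, U ⊔ V), Y.presheaf.map (homOfLE le_sup_left).op r₁ = p - p' ∧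
      Y.presheaf.map (homOfLE le_sup_right).op r₁ = q + q' :=
    ⟨(Y.sheaf.objSupIsoProdEqLocus U V).inv ⟨⟨p - p', q + q'⟩, hglue⟩,
      Y.sheaf.objSupIsoProdEqLocus_inv_fst U V _, Y.sheaf.objSupIsoProdEqLocus_inv_snd U V _⟩
  refine ⟨Y.presheaf.map (homOfLE hcov).op r₁, ?_⟩
  refine X.sheaf.eq_of_locally_eq₂ (homOfLE (i.preimage_mono hUW)) (homOfLE (i.preimage_mono hVW))
    (by rw [← Scheme.Hom.preimage_sup]; exact i.preimage_mono hcov) _ _ ?_ ?_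
  · have : resU (i.app W (Y.presheaf.map (homOfLE hcov).op r₁)) = i.app U
        (Y.presheaf.map (homOfLE hUW).op (Y.presheaf.map (homOfLE hcov).op r₁)) :=
      congr($(i.naturality (homOfLE hUW).op).hom _).symm
    refine this.trans ?_
    have e : Y.presheaf.map (homOfLE hUW).op (Y.presheaf.map (homOfLE hcov).op r₁) =
        Y.presheaf.map (homOfLE le_sup_left).op r₁ :=
      congr($(Y.presheaf.map_comp (homOfLE hcov).op (homOfLE hUW).op).hom r₁).symm
    rw [e, hr₁, map_sub, hp]
    exact (congrArg (resU r - ·) hp').trans (sub_zero _)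
  · have : resV (i.app W (Y.presheaf.map (homOfLE hcov).op r₁)) = i.app V
        (Y.presheaf.map (homOfLE hVW).op (Y.presheaf.map (homOfLE hcov).op r₁)) :=
      congr($(i.naturality (homOfLE hVW).op).hom _).symm
    refine this.trans ?_
    have e : Y.presheaf.map (homOfLE hVW).op (Y.presheaf.map (homOfLE hcov).op r₁) =
        Y.presheaf.map (homOfLE le_sup_right).op r₁ :=
      congr($(Y.presheaf.map_comp (homOfLE hcov).op (homOfLE hVW).op).hom r₁).symm
    rw [e, hr₂, map_add, hq]
    exact (congrArg (resV r + ·) hq').trans (add_zero _)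

/-- Lifts of `f` and `g` to `W` have principal opens `V`-free descriptions `U` and `V`, both affine.
Their sum is nowhere zero, hence a unit, so they generate the unit ideal and the affineness
criterion applies. -/
lemma isAffineOpen_of_two_affine [IsClosedImmersion i] [Surjective i] {n : ℕ}
    (hn : ∀ U : Y.Opens, IsAffineOpen U → RingHom.ker (i.app U).hom ^ n = ⊥)
    {W U V : Y.Opens} (hU : IsAffineOpen U) (hV : IsAffineOpen V)
    {f g : Γ(X, i ⁻¹ᵁ W)} (hfg : f + g = 1)
    (hUf : i ⁻¹ᵁ U = X.basicOpen f) (hVg : i ⁻¹ᵁ V = X.basicOpen g) : IsAffineOpen W := by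
  obtain ⟨f', hf⟩ := exists_lift_of_two_affine i hn hU hV hfg hUf hVg f
  obtain ⟨g', hg⟩ := exists_lift_of_two_affine i hn hU hV hfg hUf hVg g
  have h₁ : Y.basicOpen f' = U :=
    preimage_injective_of_surjective i (by rw [Scheme.preimage_basicOpen, hf, hUf])
  have h₂ : Y.basicOpen g' = V :=
    preimage_injective_of_surjective i (by rw [Scheme.preimage_basicOpen, hg, hVg])
  have h₃ : Y.basicOpen (f' + g') = W := preimage_injective_of_surjective i (by
    rw [Scheme.preimage_basicOpen, map_add, hf, hg, hfg, Scheme.basicOpen_one])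
  have hu : IsUnit (f' + g') := by
    have := isUnit_res_of_le_basicOpen (f' + g') le_rfl h₃.ge
    have e : Y.presheaf.map (homOfLE (le_refl W)).op (f' + g') = f' + g' :=
      congr($(Y.presheaf.map_id (.op W)).hom _)
    rwa [e] at this
  refine isAffineOpen_of_isAffineOpen_basicOpen W {f', g'} ?_ ?_
  · refine Ideal.eq_top_of_isUnit_mem _ (Ideal.add_mem _ (Ideal.subset_span ?_)
      (Ideal.subset_span ?_)) hu <;> simp
  · rintro x (rfl | rfl)
    · rwa [h₁]
    · rwa [h₂]

/-- A nilpotent thickening of an affine scheme is affine. -/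
theorem isAffine_of_nilpotent_thickening [IsClosedImmersion i] [Surjective i] [IsAffine X] {n : ℕ}
    (hn : ∀ U : Y.Opens, IsAffineOpen U → RingHom.ker (i.app U).hom ^ n = ⊥) : IsAffine Y := by
  -- The functions whose principal open comes from an affine open of `Y` form an ideal. Their
  -- principal opens cover `X`, so the ideal contains `1`, and `P 1` is the affineness of `Y`.
  let P : Γ(X, ⊤) → Prop := fun f => ∃ U : Y.Opens, IsAffineOpen U ∧ i ⁻¹ᵁ U = X.basicOpen f
  have mul : ∀ f h, P f → P (h * f) := by
    rintro f h ⟨U, hU, e⟩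
    obtain ⟨s, -, hs, hs'⟩ := exists_affine_preimage_basicOpen i hU
      (X.presheaf.map (homOfLE le_top).op h)
    exact ⟨_, hs, by rw [hs', Scheme.basicOpen_mul, e.symm, inf_comm]; exact X.basicOpen_res _ _⟩
  have add : ∀ f g, P f → P g → P (f + g) := by
    intro f g hf hg
    obtain ⟨W, hW⟩ := exists_preimage_eq i (X.basicOpen (f + g))
    have hle : i ⁻¹ᵁ W ≤ ⊤ := le_top
    let res : Γ(X, ⊤) →+* Γ(X, i ⁻¹ᵁ W) := (X.presheaf.map (homOfLE hle).op).hom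
    have hu : IsUnit (res (f + g)) := isUnit_res_of_le_basicOpen _ _ hW.le
    -- Over `W` the sum is invertible, so `v f` and `v g` add up to `1`. Their principal opens are
    -- those of `(f + g) f` and `(f + g) g`, which come from affine opens by `mul`.
    obtain ⟨v, hv⟩ := hu.exists_left_inv
    have hv' : X.basicOpen v = i ⁻¹ᵁ W := X.basicOpen_of_isUnit (.of_mul_eq_one _ hv)
    have hb : ∀ z, X.basicOpen (v * res z) = X.basicOpen ((f + g) * z) := fun z => by
      rw [Scheme.basicOpen_mul, hv', Scheme.basicOpen_mul, ← hW]
      have : X.basicOpen (res z) = _ := X.basicOpen_res _ _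
      rw [this, ← inf_assoc, inf_idem]
    obtain ⟨U, hU, eU⟩ := mul f (f + g) hf
    obtain ⟨V, hV, eV⟩ := mul g (f + g) hg
    refine ⟨W, isAffineOpen_of_two_affine i hn hU hV (f := v * res f) (g := v * res g)
      (by rw [← mul_add, ← map_add, hv]) (by rw [hb, eU]) (by rw [hb, eV]), hW⟩
  have zero : P 0 := ⟨⊥, isAffineOpen_bot Y, by simp⟩
  let J : Ideal Γ(X, ⊤) :=
    { carrier := {f | P f}
      add_mem' := fun {f g} => add f g
      zero_mem' := zero
      smul_mem' := fun h f => mul f h }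
  have hJ : J = ⊤ := by
    rw [← Ideal.span_eq J, ← (isAffineOpen_top X).iSup_basicOpen_eq_self_iff]
    refine top_le_iff.1 fun x _ => ?_
    obtain ⟨U, hU, hxU, -⟩ := exists_isAffineOpen_mem_and_subset (x := i x) (U := ⊤) trivial
    obtain ⟨f, hf, hxf⟩ := (isAffineOpen_top X).exists_basicOpen_le (V := i ⁻¹ᵁ U) ⟨x, hxU⟩ trivial
    obtain ⟨s, -, hs, hs'⟩ := exists_affine_preimage_basicOpen i hU
      (X.presheaf.map (homOfLE le_top).op f)
    refine Opens.mem_iSup.2 ⟨⟨f, _, hs, ?_⟩, hxf⟩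
    rw [hs']
    exact (X.basicOpen_res _ _).trans (inf_eq_right.2 hf)
  obtain ⟨U, hU, e⟩ : P 1 := (Ideal.eq_top_iff_one J).1 hJ
  have : U = ⊤ := preimage_injective_of_surjective i (by rw [e, Scheme.basicOpen_one]; rfl)
  subst this
  have : IsAffine (⊤ : Y.Opens).toScheme := hU
  exact .of_isIso Y.topIso.inv

end Thickening

/-! ### Quasi-coherence from affine charts. -/

section Quasicoherent
open AlgebraicGeometry Limits

namespace AlgebraicGeometry.Scheme.Modules

/-- Transport of a presentation along an isomorphism. -/
noncomputable def presentationOfIso {X : Scheme.{u}} {M N : X.Modules} (e : M ≅ N)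
    (p : M.Presentation) : N.Presentation :=
  have : IsIso (C := SheafOfModules X.ringCatSheaf) e.hom := by exact e.isIso_hom
  SheafOfModules.Presentation.ofIsIso.{u, u, u} e.hom p

/-- A presentation of the restriction of `M` to an open subset gives a presentation of `M` over
this open subset, in the sense of sheaves on sites. -/
noncomputable def presentationOver {X : Scheme.{u}} {M : X.Modules} (U : X.Opens)
    (pres : (M.restrict U.ι).Presentation) : (SheafOfModules.over M U).Presentation :=
  let e := overEquiv U
  let η : e.functor.obj (SheafOfModules.unit _) ≅ SheafOfModules.unit _ :=
    (overFunctorEquiv U).app (SheafOfModules.unit _) ≪≫ restrictUnitIso U.ι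
  let iso : e.inverse.obj (M.restrict U.ι) ≅ SheafOfModules.over M U :=
    e.inverse.mapIso ((overFunctorEquiv U).app M).symm ≪≫ (e.unitIso.app (SheafOfModules.over M U)).symm
  let F : SheafOfModules (U : Scheme.{u}).ringCatSheaf ⥤ SheafOfModules (X.ringCatSheaf.over U) :=
    e.inverse
  have : PreservesColimitsOfSize.{u, u} F := by
    exact e.symm.toAdjunction.leftAdjoint_preservesColimits
  SheafOfModules.Presentation.ofIsIso.{u, u, u} iso.hom <|
    SheafOfModules.Presentation.map pres F (e.unitIso.app _ ≪≫ e.inverse.mapIso η)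

/-- On each chart `Ñ` is presented by all elements of `N` and all their relations. The presentation
is carried from the chart to its open image, and these images, indexed by the points of `X`, form
the covering required for quasi-coherence. -/
lemma isQuasicoherent_of_forall_exists {X : Scheme.{u}} (F : X.Modules)
    (h : ∀ x : X, ∃ (S : CommRingCat.{u}) (j : Spec S ⟶ X) (N : ModuleCat.{u} S),
      IsOpenImmersion j ∧ x ∈ Set.range j ∧ Nonempty ((Scheme.Modules.pullback j).obj F ≅ tilde N)) :
    F.IsQuasicoherent := by
  choose S j N hj hx e using h
  have pres (x : X) : Nonempty ((F.restrict (j x).opensRange.ι).Presentation) := by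
    have := hj x
    let p := presentationTilde.{u} (N x) .univ (by simp) _ (Submodule.span_eq _)
    let e₁ : F.restrict (j x) ≅ tilde (N x) :=
      (restrictFunctorIsoPullback (j x)).app F ≪≫ (e x).some
    let p₁ : (F.restrict (j x)).Presentation := presentationOfIso e₁.symm p
    let i := (j x).isoOpensRange
    let e₂ : restrictFunctor (j x) ⋙ restrictFunctor i.inv ≅
        restrictFunctor (j x).opensRange.ι :=
      (restrictFunctorComp _ _).symm ≪≫ restrictFunctorCongr (by simp [i])
    exact ⟨presentationOfIso (e₂.app F) (presentationRestrict i.inv p₁)⟩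
  exact SheafOfModules.QuasicoherentData.isQuasicoherent.{u}
    { I := X
      X := fun x => (j x).opensRange
      coversTop := by
        rw [Opens.coversTop_iff]
        refine TopologicalSpace.IsOpenCover.mk (eq_top_iff.2 fun x _ => ?_)
        exact TopologicalSpace.Opens.mem_iSup.2 ⟨x, hx x⟩
      presentation := fun x => presentationOver _ (pres x).some }
end AlgebraicGeometry.Scheme.Modules
end Quasicoherent

/-! ### Flatness is local on the source. -/

section
-- Flat algebras that together reach every maximal ideal detect injectivity. If `k ≠ 0` is killed by
-- `g`, its annihilator lies in some maximal `P`; by flatness `S ⊗ B/ann(k)` embeds in `S ⊗ U`, so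
-- `1 ⊗ 1` vanishes in it, contradicting its nonzero image in `S / Q`.
lemma injective_of_forall_exists_flat {B : Type u} [CommRing B] {U V : Type u} [AddCommGroup U] [AddCommGroup V]
    [Module B U] [Module B V] (g : U →ₗ[B] V)
    (h : ∀ P : Ideal B, P.IsMaximal → ∃ (S : Type u) (_ : CommRing S) (_ : Algebra B S)
      (_ : Module.Flat B S) (Q : Ideal S), Q.IsPrime ∧ Q.comap (algebraMap B S) = P ∧
        Function.Injective (g.lTensor S)) : Function.Injective g := by
  refine (injective_iff_map_eq_zero g).2 fun k hk => ?_
  by_contra hk0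
  let f : B →ₗ[B] U := LinearMap.toSpanSingleton B U k
  have ha : LinearMap.ker f ≠ ⊤ := fun h' => hk0 (by
    have : (1 : B) ∈ LinearMap.ker f := h' ▸ Submodule.mem_top
    simpa [f] using this)
  obtain ⟨P, hP, hle⟩ := Ideal.exists_le_maximal _ ha
  obtain ⟨S, _, _, _, Q, hQ, hQP, hg⟩ := h P hP
  let f' : (B ⧸ LinearMap.ker f) →ₗ[B] U := (LinearMap.ker f).liftQ f le_rfl
  have hf' : Function.Injective (f'.lTensor S) :=
    Module.Flat.lTensor_preserves_injective_linearMap _ (by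
      rw [← LinearMap.ker_eq_bot, Submodule.ker_liftQ_eq_bot _ _ _ le_rfl])
  have h0 : (1 : S) ⊗ₜ[B] (Submodule.Quotient.mk (p := LinearMap.ker f) 1) = 0 := by
    apply hf'
    apply hg
    have : f' 1 = k :=
      (Submodule.liftQ_apply _ _ _).trans (by simp [f])
    simp [this, hk]
  -- This is well defined because the annihilator lies in `P`, the contraction of `Q`.
  let χ : (B ⧸ LinearMap.ker f) →ₗ[B] S ⧸ Q :=
    (LinearMap.ker f).liftQ ((Ideal.Quotient.mkₐ B Q).toLinearMap ∘ₗ Algebra.linearMap B S) (by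
      intro b hb
      have : b ∈ Q.comap (algebraMap B S) := hQP ▸ hle hb
      exact Ideal.Quotient.eq_zero_iff_mem.2 this)
  let m : S ⊗[B] (B ⧸ LinearMap.ker f) →ₗ[B] S ⧸ Q :=
    TensorProduct.lift ((LinearMap.mul B (S ⧸ Q)).compl₁₂ (Ideal.Quotient.mkₐ B Q).toLinearMap χ)
  have h1 := congrArg m h0
  rw [map_zero] at h1
  have : m ((1 : S) ⊗ₜ[B] (Submodule.Quotient.mk (p := LinearMap.ker f) 1)) = 1 := by
    have : χ 1 = 1 :=
      (Submodule.liftQ_apply _ _ _).trans (by simp)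
    simp [m, this]
  rw [this] at h1
  have := Ideal.Quotient.nontrivial_iff.2 hQ.ne_top
  exact one_ne_zero h1

/-- Flatness over `A` is injectivity of `N ⊗ I → N ⊗ A`, a map of `B`-modules. Tensored with `S`
over `B` it becomes the corresponding map for the flat module `S ⊗ N`, so the preceding detection
lemma applies. -/
lemma flat_of_forall_exists_flat {A B N : Type u} [CommRing A] [CommRing B] [Algebra A B]
    [AddCommGroup N] [Module A N] [Module B N] [IsScalarTower A B N]
    (h : ∀ P : Ideal B, P.IsMaximal → ∃ (S : Type u) (_ : CommRing S) (_ : Algebra A S)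
      (_ : Algebra B S) (_ : IsScalarTower A B S)
      (_ : Module.Flat B S) (Q : Ideal S), Q.IsPrime ∧ Q.comap (algebraMap B S) = P ∧
        Module.Flat A (S ⊗[B] N)) : Module.Flat A N := by
  refine Module.Flat.iff_lTensor_injective'.2 fun I => ?_
  let g : N ⊗[A] I →ₗ[B] N ⊗[A] A := TensorProduct.AlgebraTensorModule.lTensor B N I.subtype
  refine injective_of_forall_exists_flat g fun P hP => ?_
  obtain ⟨S, _, _, _, _, _, Q, hQ, hQP, hf⟩ := h P hP
  refine ⟨S, _, _, inferInstance, Q, hQ, hQP, ?_⟩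
  have h' := Module.Flat.lTensor_preserves_injective_linearMap (M := S ⊗[B] N) I.subtype I.injective_subtype
  let a₁ := TensorProduct.AlgebraTensorModule.assoc A B B S N I
  let a₂ := TensorProduct.AlgebraTensorModule.assoc A B B S N A
  have e : ∀ z, g.lTensor S (a₁ z) = a₂ (I.subtype.lTensor (S ⊗[B] N) z) := by
    intro z
    induction z using TensorProduct.induction_on with
    | zero => simp
    | add x y hx hy => simp only [map_add, hx, hy]
    | tmul x i =>
      induction x using TensorProduct.induction_on with
      | zero => simp
      | add x y hx hy => simp only [TensorProduct.add_tmul, map_add, hx, hy]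
      | tmul s n => simp [a₁, a₂, g]
  intro z z' hz
  obtain ⟨y, rfl⟩ := a₁.surjective z
  obtain ⟨y', rfl⟩ := a₁.surjective z'
  rw [e, e] at hz
  rw [h' (a₂.injective hz)]
end

/-! ### Deformations of affine pairs are affine. -/

section AffineDeformations
open AlgebraicGeometry

lemma SheafIsFlat.of_iso {X : Scheme.{u}} {A : CommRingCat.{u}} {π : X ⟶ Spec A} {F G : X.Modules}
    (e : F ≅ G) (h : SheafIsFlat π F) : SheafIsFlat π G := by
  intro x
  obtain ⟨S, j, N, hj, hx, ⟨i⟩, hN⟩ := h x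
  exact ⟨S, j, N, hj, hx, ⟨(Scheme.Modules.pullback j).mapIso e.symm ≪≫ i⟩, hN⟩

/-- Flatness of `Ñ` over `A` is flatness of `N` over `A`. -/
lemma flat_of_sheafIsFlat {A B : CommRingCat.{u}} (a : A ⟶ B) (N : ModuleCat.{u} B)
    (h : SheafIsFlat (Spec.map a) (tilde N)) :
    Module.Flat A ((ModuleCat.restrictScalars a.hom).obj N) := by
  algebraize [a.hom]
  let : Module A N := Module.compHom N a.hom
  have : IsScalarTower A B N := ⟨fun r s n => by
    rw [Algebra.smul_def, mul_smul]; rfl⟩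
  change Module.Flat A N
  refine flat_of_forall_exists_flat (B := B) fun P hP => ?_
  obtain ⟨S, j, N', hj, ⟨q, hq⟩, ⟨i⟩, hN'⟩ := h ⟨P, hP.isPrime⟩
  obtain ⟨σ, rfl⟩ : ∃ σ, j = Spec.map σ := ⟨_, (Spec.map_preimage j).symm⟩
  rw [← Spec.map_comp, Spec.preimage_map] at hN'
  have hσ : σ.hom.Flat := Flat.SpecMap_iff.1 inferInstance
  -- Tilde is fully faithful, so the isomorphism of sheaves on the chart identifies `N'` with `S ⊗
  -- N`.
  let t : N' ≅ (ModuleCat.extendScalars σ.hom).obj N :=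
    (tilde.functor S).preimageIso (i.symm ≪≫ pullbackTildeIso σ N)
  algebraize [σ.hom, σ.hom.comp a.hom]
  have : IsScalarTower A B S := IsScalarTower.of_algebraMap_eq' rfl
  refine ⟨S, inferInstance, inferInstance, inferInstance, inferInstance, inferInstance, q.asIdeal,
    q.isPrime, congrArg PrimeSpectrum.asIdeal hq, ?_⟩
  let : Module A N' := Module.compHom N' (σ.hom.comp a.hom)
  have : IsScalarTower A S N' := ⟨fun r s n => by
    rw [Algebra.smul_def, mul_smul]; rfl⟩
  have : Module.Flat A N' := hN'
  let t' : N' ≃ₗ[S] S ⊗[B] N := t.toLinearEquiv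
  exact Module.Flat.of_linearEquiv (t'.restrictScalars A).symm

/-- Up to the identification of `Q` with the global sections of its spectrum, pulling back sections
over `U` along `Spec Q → U` is `q`. -/
lemma eq_zero_of_app_fromSpec_eq_zero {X : Scheme.{u}} {U : X.Opens} (hU : IsAffineOpen U)
    {Q : CommRingCat.{u}} (q : Γ(X, U) ⟶ Q) (f : Γ(X, U))
    (h : (Spec.map q ≫ hU.fromSpec).app U f = 0) : q f = 0 := by
  have hle : (⊤ : (Spec Q).Opens) ≤ (Spec.map q ≫ hU.fromSpec) ⁻¹ᵁ U := by
    rw [Scheme.Hom.comp_preimage, hU.fromSpec_preimage_self]; rfl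
  have h1 : (Spec.map q ≫ hU.fromSpec).appLE U ⊤ hle = q ≫ (Scheme.ΓSpecIso Q).inv := by
    refine (Scheme.Hom.comp_appLE _ _ _ _ hle).trans ?_
    rw [hU.fromSpec_app_self, Category.assoc]
    refine (congrArg ((Scheme.ΓSpecIso Γ(X, U)).inv ≫ ·)
      (Scheme.Hom.map_appLE (Spec.map q) (U' := ⊤) hle _)).trans ?_
    refine .trans ?_ (Scheme.ΓSpecIso_inv_naturality q).symm
    have : (Spec.map q).appLE ⊤ ⊤ le_rfl = (Spec.map q).appTop :=
      (congrArg (_ ≫ ·) ((Spec Q).presheaf.map_id _)).trans (Category.comp_id _)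
    exact congrArg (_ ≫ ·) this
  have h2 : (Spec.map q ≫ hU.fromSpec).appLE U ⊤ hle f = 0 := by
    rw [Scheme.Hom.appLE, CommRingCat.comp_apply, h, map_zero]
  rw [h1] at h2
  refine ((ConcreteCategory.isIso_iff_bijective (Scheme.ΓSpecIso Q).inv).1 inferInstance).1 ?_
  rw [map_zero]
  exact h2

variable {K : Type u} [Field K] (A : ArtAlg K)

lemma ArtAlg.residue_surjective : Function.Surjective A.residue :=
  fun k => ⟨algebraMap K A.obj k, by simp⟩

instance : IsClosedImmersion A.closedPt :=
  IsClosedImmersion.spec_of_surjective _ A.residue_surjective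

/-- Every prime of `A` contains `𝔪`, whose elements are nilpotent, so the closed point is the only
point. -/
instance : Surjective A.closedPt := by
  refine ⟨fun x => ?_⟩
  have := range_comap_of_surjective _ A.residue.toRingHom A.residue_surjective
  have hx : x ∈ Set.range (PrimeSpectrum.comap A.residue.toRingHom) := by
    rw [this]
    intro y hy
    have : y ∈ A.𝔪 := (A.residue_eq_zero_iff y).1 hy
    exact nilpotent_iff_mem_prime.1 ((A.mem_𝔪_iff_isNilpotent y).1 this) _ x.isPrime
  exact hx

namespace PairDeformation

variable {A} {P : SchemePair.{u}} {p : P.X ⟶ Spec (.of K)} (D : PairDeformation P p A)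

instance : IsClosedImmersion D.ι.base :=
  MorphismProperty.of_isPullback D.isPullback.flip inferInstance

instance : Surjective D.ι.base :=
  MorphismProperty.of_isPullback D.isPullback.flip inferInstance

/-- Modulo the maximal ideal of `A`, a point of the total space lies in the special fibre. -/
lemma exists_lift_of_map_eq_zero {Q : CommRingCat.{u}} (s : Spec Q ⟶ D.total.X)
    (a : CommRingCat.of A.obj ⟶ Q) (ha : s ≫ D.π = Spec.map a) (h : ∀ y ∈ A.𝔪, a.hom y = 0) :
    ∃ l : Spec Q ⟶ P.X, l ≫ D.ι.base = s := by
  let k : CommRingCat.of K ⟶ Q := CommRingCat.ofHom (a.hom.comp (algebraMap K A.obj))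
  have hk : CommRingCat.ofHom A.residue.toRingHom ≫ k = a := by
    ext y
    have : y - algebraMap K A.obj (A.residue y) ∈ A.𝔪 := by
      rw [← ArtAlg.residue_eq_zero_iff]; simp
    have := h _ this
    rw [map_sub, sub_eq_zero] at this
    exact this.symm
  refine ⟨D.isPullback.lift s (Spec.map k) ?_, D.isPullback.lift_fst _ _ _⟩
  rw [ha, ← Spec.map_comp, hk]

/-- The closed subscheme of `U` cut out by `𝔪` factors through the special fibre, by the pull-back
square. A function vanishing on the fibre therefore vanishes there, that is, lies in the ideal
generated by `𝔪`. -/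
lemma ker_app_le (U : D.total.X.Opens) (hU : IsAffineOpen U) :
    ∃ a : A.obj →+* Γ(D.total.X, U), RingHom.ker (D.ι.base.app U).hom ≤ A.𝔪.map a := by
  obtain ⟨a, ha⟩ : ∃ a, hU.fromSpec ≫ D.π = Spec.map a := ⟨_, (Spec.map_preimage _).symm⟩
  refine ⟨a.hom, fun f hf => ?_⟩
  let q := CommRingCat.ofHom (Ideal.Quotient.mk (A.𝔪.map a.hom))
  obtain ⟨l, hl⟩ := D.exists_lift_of_map_eq_zero (Spec.map q ≫ hU.fromSpec) (a ≫ q)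
    (by rw [Category.assoc, ha, ← Spec.map_comp])
    (fun y hy => Ideal.Quotient.eq_zero_iff_mem.2 (Ideal.mem_map_of_mem _ hy))
  refine Ideal.Quotient.eq_zero_iff_mem.1 ?_
  have h0 : (Spec.map q ≫ hU.fromSpec).app U f = 0 := by
    have : (l ≫ D.ι.base).app U f = l.app _ (D.ι.base.app U f) := rfl
    rw [← hl, this, (RingHom.mem_ker).1 hf]
    exact map_zero _
  exact eq_zero_of_app_fromSpec_eq_zero hU q f h0

/-- The exponent `n` with `𝔪^n = 0` serves for all affine opens at once. -/
lemma isAffine_total [IsAffine P.X] : IsAffine D.total.X := by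
  obtain ⟨n, hn⟩ := A.isNilpotent_𝔪
  refine isAffine_of_nilpotent_thickening D.ι.base (n := n) fun U hU => ?_
  obtain ⟨a, ha⟩ := D.ker_app_le U hU
  refine eq_bot_iff.2 ((Ideal.pow_right_mono ha n).trans ?_)
  rw [← Ideal.map_pow, hn]
  simp

/-- A deformation of an affine pair is given by a flat deformation of the module. -/
lemma exists_spec {R : CommRingCat.{u}} {M : ModuleCat.{u} R} {p : Spec R ⟶ Spec (.of K)}
    (D : PairDeformation (SchemePair.spec M) p A) :
    ∃ (B : CommRingCat.{u}) (a : CommRingCat.of A.obj ⟶ B) (ρ : B ⟶ R) (N : ModuleCat.{u} B)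
      (c : N ⟶ (ModuleCat.restrictScalars ρ.hom).obj M) (g : SchemePair.spec N ⟶ D.total),
      IsIso g.base ∧ SchemePair.IsCartesian g ∧ g.base ≫ D.π = Spec.map a ∧
      SchemePair.specHom ρ c ≫ g = D.ι ∧ Function.Surjective ρ.hom ∧
      RingHom.ker ρ.hom = A.𝔪.map a.hom ∧ a.hom.Flat ∧
      Module.Flat A.obj ((ModuleCat.restrictScalars a.hom).obj N) := by
  have : IsAffine (SchemePair.spec M).X := inferInstanceAs (IsAffine (Spec R))
  have := D.isAffine_total
  let B : CommRingCat.{u} := Γ(D.total.X, ⊤)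
  let e : Spec B ≅ D.total.X := D.total.X.isoSpec.symm
  obtain ⟨a, ha⟩ : ∃ a : CommRingCat.of A.obj ⟶ B, e.hom ≫ D.π = Spec.map a :=
    ⟨_, (Spec.map_preimage _).symm⟩
  -- The isomorphism with `Spec B` is regarded as a base change along the identity of `A`, so that
  -- flatness of the sheaf is transported by `SheafIsFlat.baseChange`.
  have hpb : IsPullback e.hom (e.hom ≫ D.π) D.π (Spec.map (𝟙 (CommRingCat.of A.obj))) :=
    IsPullback.of_horiz_isIso ⟨by simp⟩
  have hfl := D.flat_sheaf.baseChange hpb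
  have : ((Scheme.Modules.pullback e.hom).obj D.total.F).IsQuasicoherent := by
    refine Scheme.Modules.isQuasicoherent_of_forall_exists _ fun x => ?_
    obtain ⟨S, j, N, h₁, h₂, h₃, -⟩ := hfl x
    exact ⟨S, j, N, h₁, h₂, h₃⟩
  have := (isQuasicoherent_iff_isIso_fromTildeΓ _).1 this
  obtain ⟨N, ⟨t⟩⟩ := isIso_fromTildeΓ_iff.1 this
  let t : (Scheme.Modules.pullback e.hom).obj D.total.F ≅ tilde N := t.symm
  let g : SchemePair.spec N ⟶ D.total := ⟨e.hom,
    (Scheme.Modules.pullbackPushforwardAdjunction e.hom).homEquiv D.total.F (tilde N) t.hom⟩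
  have hg : SchemePair.IsCartesian g := by
    change IsIso (((Scheme.Modules.pullbackPushforwardAdjunction e.hom).homEquiv _ _).symm
      ((Scheme.Modules.pullbackPushforwardAdjunction e.hom).homEquiv _ _ t.hom))
    rw [Equiv.symm_apply_apply]
    infer_instance
  obtain ⟨ι, hι, hιg⟩ := hg.lift D.ι (D.ι.base ≫ e.inv) (by
    change (D.ι.base ≫ e.inv) ≫ e.hom = _; simp)
  obtain ⟨ρ, c, rfl⟩ := SchemePair.exists_specHom ι
  have hρ : Spec.map ρ = D.ι.base ≫ e.inv := hι
  have hρcl : IsClosedImmersion (Spec.map ρ) := by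
    rw [hρ]
    infer_instance
  have hpres : p ≫ A.closedPt = Spec.map (a ≫ ρ) := by
    rw [Spec.map_comp, hρ, ← ha]
    simp [← D.isPullback.w]
  have hker : A.𝔪.map a.hom ≤ RingHom.ker ρ.hom := by
    refine Ideal.map_le_iff_le_comap.2 fun y hy => ?_
    obtain ⟨p', rfl⟩ : ∃ p', p = Spec.map p' := ⟨_, (Spec.map_preimage p).symm⟩
    rw [← Spec.map_comp] at hpres
    have : CommRingCat.ofHom A.residue.toRingHom ≫ p' = a ≫ ρ := Spec.map_injective hpres
    have : ρ (a y) = p' (A.residue y) := congrArg (fun h => h.hom y) this.symm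
    refine RingHom.mem_ker.2 (this.trans ?_)
    rw [(A.residue_eq_zero_iff y).2 hy, map_zero]
  let q := CommRingCat.ofHom (Ideal.Quotient.mk (A.𝔪.map a.hom))
  -- `Spec (B / 𝔪B)` maps to the special fibre. The resulting `l : R → B / 𝔪B` bounds the kernel of
  -- `ρ` by `𝔪B`; together with the induced map `B / 𝔪B → R` it also gives surjectivity of `ρ`.
  obtain ⟨l, hl⟩ : ∃ l, ρ ≫ l = q := by
    obtain ⟨l, hl⟩ := D.exists_lift_of_map_eq_zero (Spec.map q ≫ e.hom) (a ≫ q)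
      (by rw [Category.assoc, ha, ← Spec.map_comp])
      (fun y hy => Ideal.Quotient.eq_zero_iff_mem.2 (Ideal.mem_map_of_mem _ hy))
    obtain ⟨l, rfl⟩ : ∃ l', l = Spec.map l' := ⟨_, (Spec.map_preimage l).symm⟩
    refine ⟨l, ?_⟩
    apply Spec.map_injective
    rw [Spec.map_comp, hρ, ← Category.assoc]
    exact (Iso.comp_inv_eq _).2 hl
  refine ⟨B, a, ρ, N, c, g, inferInstanceAs (IsIso e.hom), hg, ha, hιg, ?_, ?_, ?_, ?_⟩
  · let ρ' : CommRingCat.of (B ⧸ A.𝔪.map a.hom) ⟶ R :=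
      CommRingCat.ofHom (Ideal.Quotient.lift _ ρ.hom fun y hy => hker hy)
    have hq : q ≫ ρ' = ρ := by ext y; rfl
    have hl' : l ≫ ρ' = 𝟙 R := by
      apply Spec.map_injective
      rw [← cancel_mono (Spec.map ρ), ← Spec.map_comp, ← Spec.map_comp, ← Category.assoc, hl, hq]
      simp
    intro r
    obtain ⟨b, hb⟩ := Ideal.Quotient.mk_surjective (l r)
    refine ⟨b, ?_⟩
    have h1 : ρ' (l r) = r := congrArg (fun h => h.hom r) hl'
    rw [← h1, ← hb]
    rfl
  · refine le_antisymm (fun f hf => ?_) hker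
    have h2 : q f = l (ρ f) := by rw [← hl]; rfl
    refine Ideal.Quotient.eq_zero_iff_mem.1 (h2.trans ?_)
    have : ρ f = 0 := hf
    rw [this, map_zero]
  · have := D.flat
    exact Flat.SpecMap_iff.1 (ha ▸ inferInstance)
  · refine flat_of_sheafIsFlat a N ?_
    rw [← ha]
    exact hfl.of_iso t

end PairDeformation

end AffineDeformations

/-! ### Exactness and flatness modulo a nilpotent maximal ideal. -/

section Nilpotent

variable {A : Type u} [CommRing A] {I : Ideal A}

/-- Nakayama's lemma for a nilpotent ideal. -/
lemma Submodule.eq_top_of_isNilpotent (hI : IsNilpotent I) {P : Type*} [AddCommGroup P] [Module A P]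
    (N : Submodule A P) (h : ∀ p, ∃ n ∈ N, p - n ∈ I • (⊤ : Submodule A P)) : N = ⊤ := by
  obtain ⟨n, hn⟩ := hI
  have h' : (⊤ : Submodule A P) ≤ N ⊔ I • ⊤ := fun p _ => by
    obtain ⟨n, hn, hp⟩ := h p
    exact Submodule.mem_sup.2 ⟨n, hn, _, hp, by abel⟩
  have key : ∀ k, (⊤ : Submodule A P) ≤ N ⊔ I ^ k • ⊤ := by
    intro k
    induction k with
    | zero => simp
    | succ k ih =>
      refine h'.trans (sup_le le_sup_left ?_)
      refine (Submodule.smul_mono le_rfl ih).trans ?_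
      rw [Submodule.smul_sup, ← Submodule.mul_smul, ← pow_succ']
      exact sup_le_sup_right Submodule.smul_le_right _
  have := key n
  rw [hn] at this
  simpa using this

lemma Submodule.mem_smul_top_iff_exists_tmul {P : Type*} [AddCommGroup P] [Module A P] (J : Ideal A)
    (p : P) : p ∈ J • (⊤ : Submodule A P) ↔
      ∃ t : J ⊗[A] P, TensorProduct.lid A P (J.subtype.rTensor P t) = p := by
  constructor
  · intro hp
    refine Submodule.smul_induction_on hp (fun r hr n _ => ⟨⟨r, hr⟩ ⊗ₜ n, by simp⟩) ?_
    · intro x y hx hy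
      obtain ⟨s, rfl⟩ := hx
      obtain ⟨t, rfl⟩ := hy
      exact ⟨s + t, by simp⟩
  · rintro ⟨t, rfl⟩
    induction t using TensorProduct.induction_on with
    | zero => simp
    | add x y hx hy => simp only [map_add]; exact add_mem hx hy
    | tmul r n => simpa using Submodule.smul_mem_smul r.2 Submodule.mem_top

lemma one_tmul_eq_zero_iff {P : Type u} [AddCommGroup P] [Module A P] (p : P) :
    (1 : A ⧸ I) ⊗ₜ[A] p = 0 ↔ p ∈ I • (⊤ : Submodule A P) := by
  have : TensorProduct.quotTensorEquivQuotSMul P I ((1 : A ⧸ I) ⊗ₜ[A] p) = Submodule.Quotient.mk p := by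
    have := TensorProduct.quotTensorEquivQuotSMul_mk_tmul (M := P) I 1 p
    rwa [one_smul] at this
  rw [← (TensorProduct.quotTensorEquivQuotSMul P I).map_eq_zero_iff, this,
    Submodule.Quotient.mk_eq_zero]

lemma exists_one_tmul {P : Type u} [AddCommGroup P] [Module A P] (x : (A ⧸ I) ⊗[A] P) :
    ∃ p, x = 1 ⊗ₜ p := by
  induction x using TensorProduct.induction_on with
  | zero => exact ⟨0, by simp⟩
  | add x y hx hy =>
    obtain ⟨p, rfl⟩ := hx
    obtain ⟨q, rfl⟩ := hy
    exact ⟨p + q, by rw [TensorProduct.tmul_add]⟩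
  | tmul a p =>
    obtain ⟨a, rfl⟩ := Ideal.Quotient.mk_surjective a
    refine ⟨a • p, ?_⟩
    rw [← TensorProduct.smul_tmul, Algebra.smul_def, mul_one]
    rfl

variable {P Q T : Type u} [AddCommGroup P] [Module A P] [AddCommGroup Q] [Module A Q]
  [AddCommGroup T] [Module A T] {f : P →ₗ[A] Q} {g : Q →ₗ[A] T}

/-- The hypothesis `h` is exactness modulo `I` stated on elements, the form in which it is checked
for `A ⊗ E`, whose reduction is `E`. -/
lemma exact_lTensor_quotient (hgf : g ∘ₗ f = 0)
    (h : ∀ q, g q ∈ I • (⊤ : Submodule A T) → ∃ p, q - f p ∈ I • (⊤ : Submodule A Q)) :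
    Function.Exact (f.lTensor (A ⧸ I)) (g.lTensor (A ⧸ I)) := by
  intro x
  constructor
  · intro hx
    obtain ⟨q, rfl⟩ := exists_one_tmul x
    rw [LinearMap.lTensor_tmul, one_tmul_eq_zero_iff] at hx
    obtain ⟨p, hp⟩ := h q hx
    refine ⟨1 ⊗ₜ p, ?_⟩
    rw [LinearMap.lTensor_tmul, eq_comm, ← sub_eq_zero, ← TensorProduct.tmul_sub,
      one_tmul_eq_zero_iff]
    exact hp
  · rintro ⟨y, rfl⟩
    rw [← LinearMap.comp_apply, ← LinearMap.lTensor_comp, hgf]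
    simp

/-- A complex `P → Q → T` with `T` flat, which is exact modulo a nilpotent maximal ideal, is
universally exact. -/
theorem exact_lTensor_of_isNilpotent [I.IsMaximal] (hI : IsNilpotent I) [Module.Flat A T]
    (hgf : g ∘ₗ f = 0)
    (h : ∀ q, g q ∈ I • (⊤ : Submodule A T) → ∃ p, q - f p ∈ I • (⊤ : Submodule A Q))
    (V : Type u) [AddCommGroup V] [Module A V] :
    Function.Exact (f.lTensor V) (g.lTensor V) := by
  have comp : ∀ (V : Type u) [AddCommGroup V] [Module A V] (y : V ⊗[A] P),
      g.lTensor V (f.lTensor V y) = 0 := fun V _ _ y => by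
    rw [← LinearMap.comp_apply, ← LinearMap.lTensor_comp, hgf]
    simp
  -- A module killed by `I` is a vector space over the field `A / I`, so tensoring with it factors
  -- through reduction modulo `I` followed by an exact functor.
  have base : ∀ (V : Type u) [AddCommGroup V] [Module A V],
      (∀ a ∈ I, ∀ v : V, a • v = 0) → Function.Exact (f.lTensor V) (g.lTensor V) := by
    intro V _ _ hV
    let _ : Field (A ⧸ I) := Ideal.Quotient.field I
    have hV' : Module.IsTorsionBySet A V I := fun v a => hV a a.2 v
    let _ : Module (A ⧸ I) V := hV'.module
    have : IsScalarTower A (A ⧸ I) V := hV'.isScalarTower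
    have e := exact_lTensor_quotient hgf h
    have e' := Module.Flat.lTensor_exact (R := A ⧸ I) V
      (show Function.Exact (f.baseChange (A ⧸ I)) (g.baseChange (A ⧸ I)) from e)
    have nat : ∀ {P Q : Type u} [AddCommGroup P] [Module A P] [AddCommGroup Q] [Module A Q]
        (f : P →ₗ[A] Q) (z : V ⊗[A ⧸ I] ((A ⧸ I) ⊗[A] P)),
        TensorProduct.AlgebraTensorModule.cancelBaseChange A (A ⧸ I) (A ⧸ I) V Q
          ((f.baseChange (A ⧸ I)).lTensor V z) = f.lTensor V
          (TensorProduct.AlgebraTensorModule.cancelBaseChange A (A ⧸ I) (A ⧸ I) V P z) := by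
      intro P Q _ _ _ _ f z
      induction z using TensorProduct.induction_on with
      | zero => simp
      | add x y hx hy => simp only [map_add, hx, hy]
      | tmul v x =>
        induction x using TensorProduct.induction_on with
        | zero => simp
        | add x y hx hy => simp only [TensorProduct.tmul_add, map_add, hx, hy]
        | tmul a p => simp
    intro x
    refine ⟨fun hx => ?_, fun ⟨y, hy⟩ => hy ▸ comp V y⟩
    obtain ⟨z, rfl⟩ :=
      (TensorProduct.AlgebraTensorModule.cancelBaseChange A (A ⧸ I) (A ⧸ I) V Q).surjective x
    rw [← nat, LinearEquiv.map_eq_zero_iff] at hx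
    obtain ⟨w, rfl⟩ := (e' z).1 hx
    exact ⟨_, (nat f w).symm⟩
  -- Dévissage along `IV ⊆ V`: the submodule is killed by one power of `I` less, the quotient by `I`
  -- itself.
  have step : ∀ k (V : Type u) [AddCommGroup V] [Module A V],
      I ^ k • (⊤ : Submodule A V) = ⊥ → Function.Exact (f.lTensor V) (g.lTensor V) := by
    intro k
    induction k with
    | zero =>
      intro V _ _ hV x
      have : Subsingleton V := by
        rw [pow_zero, Ideal.one_eq_top, Submodule.top_smul] at hV
        exact (Submodule.subsingleton_iff A).1 (subsingleton_of_bot_eq_top hV.symm)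
      exact ⟨fun _ => ⟨0, Subsingleton.elim _ _⟩, fun ⟨y, hy⟩ => hy ▸ comp V y⟩
    | succ k ih =>
      intro V _ _ hV x
      refine ⟨fun hx => ?_, fun ⟨y, hy⟩ => hy ▸ comp V y⟩
      let W : Submodule A V := I • ⊤
      have hW : Function.Exact (f.lTensor W) (g.lTensor W) := by
        refine ih W ?_
        have : (I ^ k • (⊤ : Submodule A W)).map W.subtype = ⊥ := by
          rw [Submodule.map_smul'', Submodule.map_top, Submodule.range_subtype,
            ← Submodule.mul_smul, ← pow_succ, hV]
        exact Submodule.map_injective_of_injective W.injective_subtype (this.trans (Submodule.map_bot _).symm)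
      have hq : Function.Exact (f.lTensor (V ⧸ W)) (g.lTensor (V ⧸ W)) := by
        refine base _ fun a ha v => ?_
        obtain ⟨v, rfl⟩ := Submodule.Quotient.mk_surjective _ v
        rw [← Submodule.Quotient.mk_smul, Submodule.Quotient.mk_eq_zero]
        exact Submodule.smul_mem_smul ha Submodule.mem_top
      have nat : ∀ {V V' P Q : Type u} [AddCommGroup V] [Module A V] [AddCommGroup V']
          [Module A V'] [AddCommGroup P] [Module A P] [AddCommGroup Q] [Module A Q]
          (f : P →ₗ[A] Q) (u : V →ₗ[A] V') (z : V ⊗[A] P),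
          f.lTensor V' (u.rTensor P z) = u.rTensor Q (f.lTensor V z) := fun f u z => by
        rw [← LinearMap.comp_apply, ← LinearMap.comp_apply, LinearMap.lTensor_comp_rTensor,
          LinearMap.rTensor_comp_lTensor]
      have ex : Function.Exact (W.subtype.rTensor Q) (W.mkQ.rTensor Q) :=
        rTensor_exact Q (LinearMap.exact_subtype_mkQ W) W.mkQ_surjective
      obtain ⟨y', hy'⟩ := (hq (W.mkQ.rTensor Q x)).1 (by rw [nat, hx, map_zero])
      obtain ⟨y, rfl⟩ := LinearMap.rTensor_surjective P W.mkQ_surjective y'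
      obtain ⟨w, hw⟩ := (ex (x - f.lTensor V y)).1 (by rw [map_sub, ← nat, hy', sub_self])
      -- Only here is flatness of `T` used in the chase: `W ⊗ T → V ⊗ T` is injective.
      have hgw : g.lTensor W w = 0 := by
        have inj : Function.Injective (W.subtype.rTensor T) :=
          Module.Flat.rTensor_preserves_injective_linearMap _ W.injective_subtype
        apply inj
        rw [← nat, hw, map_sub, hx, comp, map_zero, sub_zero]
      obtain ⟨w', rfl⟩ := (hW w).1 hgw
      refine ⟨y + W.subtype.rTensor P w', ?_⟩
      rw [map_add, nat, hw]
      abel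
  obtain ⟨n, hn⟩ := hI
  exact step n V (by rw [hn]; simp)

/-- Lifting of solutions: if `Q → T → T'` is a complex exact modulo `I` with `T'` flat, then an
element killed by `T → T'` which modulo `I` comes from `q₀` comes from an element congruent to `q₀`. -/
lemma exists_lift_of_isNilpotent [I.IsMaximal] (hI : IsNilpotent I) {T' : Type u} [AddCommGroup T']
    [Module A T'] [Module.Flat A T'] {g' : T →ₗ[A] T'} (hgf : g' ∘ₗ g = 0)
    (h : ∀ t, g' t ∈ I • (⊤ : Submodule A T') → ∃ q, t - g q ∈ I • (⊤ : Submodule A T))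
    (t : T) (ht : g' t = 0) (q₀ : Q) (hq : t - g q₀ ∈ I • (⊤ : Submodule A T)) :
    ∃ q, g q = t ∧ q - q₀ ∈ I • (⊤ : Submodule A Q) := by
  -- With `V = I`, the defect `t - g q₀`, an element of `I T`, is represented in `I ⊗ T`. By
  -- flatness of `T'` it is a cycle there, hence comes from `I ⊗ Q`, and this corrects `q₀` without
  -- changing it modulo `I`.
  have ex := exact_lTensor_of_isNilpotent hI hgf h I
  have nat : ∀ {P Q : Type u} [AddCommGroup P] [Module A P] [AddCommGroup Q] [Module A Q]
      (f : P →ₗ[A] Q) (z : I ⊗[A] P), f (TensorProduct.lid A P (I.subtype.rTensor P z)) =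
        TensorProduct.lid A Q (I.subtype.rTensor Q (f.lTensor I z)) := by
    intro P Q _ _ _ _ f z
    induction z using TensorProduct.induction_on with
    | zero => simp
    | add x y hx hy => simp only [map_add, hx, hy]
    | tmul r p => simp
  obtain ⟨τ, hτ⟩ := (Submodule.mem_smul_top_iff_exists_tmul _ _).1 hq
  have hτ0 : g'.lTensor I τ = 0 := by
    have inj : Function.Injective (I.subtype.rTensor T') :=
      Module.Flat.rTensor_preserves_injective_linearMap _ I.injective_subtype
    apply inj
    apply (TensorProduct.lid A T').injective
    rw [← nat, hτ, map_sub, ht, ← LinearMap.comp_apply, hgf]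
    simp
  obtain ⟨σ, rfl⟩ := (ex τ).1 hτ0
  rw [← nat] at hτ
  refine ⟨q₀ + TensorProduct.lid A Q (I.subtype.rTensor Q σ), by rw [map_add, hτ]; abel, ?_⟩
  rw [add_sub_cancel_left]
  exact (Submodule.mem_smul_top_iff_exists_tmul _ _).2 ⟨σ, rfl⟩

/-- A linear map to a flat module which is bijective modulo `I` is bijective. -/
lemma bijective_of_isNilpotent [I.IsMaximal] (hI : IsNilpotent I) [Module.Flat A T]
    (h₁ : ∀ q, g q ∈ I • (⊤ : Submodule A T) → q ∈ I • (⊤ : Submodule A Q))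
    (h₂ : ∀ t, ∃ q, t - g q ∈ I • (⊤ : Submodule A T)) : Function.Bijective g := by
  constructor
  -- Injectivity is exactness of `0 → Q → T` at `Q`, taken with coefficients in `A`.
  · have ex := exact_lTensor_of_isNilpotent hI (f := (0 : PUnit.{u + 1} →ₗ[A] Q)) (g := g) (by simp)
      (fun q hq => ⟨0, by simpa using h₁ q hq⟩) A
    refine (injective_iff_map_eq_zero g).2 fun q hq => ?_
    obtain ⟨y, hy⟩ := (ex (1 ⊗ₜ q)).1 (by simp [hq])
    simp only [LinearMap.lTensor_zero, LinearMap.zero_apply] at hy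
    have := congrArg (TensorProduct.lid A Q) hy.symm
    simpa using this
  · rw [← LinearMap.range_eq_top]
    refine Submodule.eq_top_of_isNilpotent hI _ fun t => ?_
    obtain ⟨q, hq⟩ := h₂ t
    exact ⟨g q, ⟨q, rfl⟩, hq⟩

/-- The cokernel of a map to a flat module which is the end of a complex exact modulo `I` is flat. -/
lemma flat_of_isNilpotent [I.IsMaximal] (hI : IsNilpotent I) [Module.Flat A T] (hgf : g ∘ₗ f = 0)
    (h : ∀ q, g q ∈ I • (⊤ : Submodule A T) → ∃ p, q - f p ∈ I • (⊤ : Submodule A Q))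
    {N : Type u} [AddCommGroup N] [Module A N] (π : T →ₗ[A] N) (hπ : Function.Surjective π)
    (hex : Function.Exact g π) : Module.Flat A N := by
  refine Module.Flat.iff_rTensor_injective'.2 fun J => ?_
  refine (injective_iff_map_eq_zero _).2 fun z hz => ?_
  have nat : ∀ {V V' P Q : Type u} [AddCommGroup V] [Module A V] [AddCommGroup V']
      [Module A V'] [AddCommGroup P] [Module A P] [AddCommGroup Q] [Module A Q]
      (f : P →ₗ[A] Q) (u : V →ₗ[A] V') (z : V ⊗[A] P),
      f.lTensor V' (u.rTensor P z) = u.rTensor Q (f.lTensor V z) := fun f u z => by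
    rw [← LinearMap.comp_apply, ← LinearMap.comp_apply, LinearMap.lTensor_comp_rTensor,
      LinearMap.rTensor_comp_lTensor]
  obtain ⟨y, rfl⟩ := LinearMap.lTensor_surjective J hπ z
  have exA : Function.Exact (g.lTensor A) (π.lTensor A) := lTensor_exact A hex hπ
  have exJ : Function.Exact (g.lTensor J) (π.lTensor J) := lTensor_exact J hex hπ
  rw [← nat] at hz
  obtain ⟨b, hb⟩ := (exA _).1 hz
  -- Universal exactness with coefficients `A / J` is the vanishing of the first Tor of `N` against
  -- `A / J`, which is the injectivity sought; the rest is the chase.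
  have ex := exact_lTensor_of_isNilpotent hI hgf h (A ⧸ J)
  have exact' : ∀ (P : Type u) [AddCommGroup P] [Module A P],
      Function.Exact (J.subtype.rTensor P) (J.mkQ.rTensor P) := fun P _ _ =>
    rTensor_exact P (LinearMap.exact_subtype_mkQ J) J.mkQ_surjective
  obtain ⟨c', hc'⟩ := (ex (J.mkQ.rTensor Q b)).1 (by
    rw [nat, hb]; exact (exact' T).apply_apply_eq_zero y)
  obtain ⟨c, rfl⟩ := LinearMap.rTensor_surjective P J.mkQ_surjective c'
  rw [nat] at hc'
  obtain ⟨b', hb'⟩ := (exact' Q (b - f.lTensor A c)).1 (by rw [map_sub, hc', sub_self])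
  refine (exJ y).2 ⟨b', ?_⟩
  have inj : Function.Injective (J.subtype.rTensor T) :=
    Module.Flat.rTensor_preserves_injective_linearMap _ J.injective_subtype
  apply inj
  rw [← nat, hb', map_sub, hb, ← LinearMap.comp_apply (g.lTensor A), ← LinearMap.lTensor_comp, hgf]
  simp

end Nilpotent

/-! ### Exponentials of nilpotent operators. -/

section Exponential
variable (K : Type*) [Field K] [CharZero K]

/-- The exponential of a nilpotent element of a `K`-algebra. -/
noncomputable def nexp {S : Type*} [Ring S] [Algebra K S] (a : S) : S :=
  letI : Module ℚ S := Module.compHom S (algebraMap ℚ K)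
  IsNilpotent.exp a

variable {S : Type*} [Ring S] [Algebra K S]

lemma nexp_eq_sum {a : S} {N : ℕ} (h : a ^ N = 0) :
    nexp K a = ∑ i ∈ Finset.range N, (i.factorial : K)⁻¹ • a ^ i := by
  let _ : Module ℚ S := Module.compHom S (algebraMap ℚ K)
  refine (IsNilpotent.exp_eq_sum h).trans (Finset.sum_congr rfl fun i _ => ?_)
  change (algebraMap ℚ K (i.factorial : ℚ)⁻¹) • a ^ i = _
  simp

lemma nexp_add_of_commute {a b : S} (h : Commute a b) (ha : IsNilpotent a) (hb : IsNilpotent b) :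
    nexp K (a + b) = nexp K a * nexp K b :=
  letI : Module ℚ S := Module.compHom S (algebraMap ℚ K)
  IsNilpotent.exp_add_of_commute h ha hb

lemma nexp_neg_mul_nexp {a : S} (ha : IsNilpotent a) : nexp K (-a) * nexp K a = 1 :=
  letI : Module ℚ S := Module.compHom S (algebraMap ℚ K)
  IsNilpotent.exp_neg_mul_exp_self ha

variable {A V W : Type*} [CommRing A] [Algebra K A] [AddCommGroup V] [Module K V] [Module A V]
  [IsScalarTower K A V] [AddCommGroup W] [Module K W] [Module A W] [IsScalarTower K A W]

/-- The commutator `F ↦ b F - F a`. -/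
def commutatorMap (a : Module.End A V) (b : Module.End A W) : Module.End K (V →ₗ[A] W) where
  toFun F := b ∘ₗ F - F ∘ₗ a
  map_add' F G := by rw [LinearMap.comp_add, LinearMap.add_comp]; abel
  map_smul' k F := by
    ext v
    simp [smul_sub]

lemma commutatorMap_apply (a : Module.End A V) (b : Module.End A W) (F : V →ₗ[A] W) :
    commutatorMap K a b F = b ∘ₗ F - F ∘ₗ a := rfl

/-- Conjugation by exponentials is the exponential of the commutator. -/
lemma nexp_commutatorMap {a : Module.End A V} {b : Module.End A W} (ha : IsNilpotent a)
    (hb : IsNilpotent b) : IsNilpotent (commutatorMap K a b) ∧ ∀ F : V →ₗ[A] W,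
      nexp K (commutatorMap K a b) F = nexp K b ∘ₗ F ∘ₗ nexp K (-a) := by
  -- The commutator is the sum of left composition with `b` and right composition with `-a`. These
  -- commute, so the exponential of the sum is the product of the exponentials.
  let L := commutatorMap K (0 : Module.End A V) b
  let M := commutatorMap K a (0 : Module.End A W)
  have hL : ∀ (n : ℕ) (F : V →ₗ[A] W), (L ^ n) F = (b ^ n : Module.End A W) ∘ₗ F := by
    intro n F
    induction n with
    | zero => rfl
    | succ n ih =>
      rw [pow_succ', Module.End.mul_apply, ih, pow_succ']
      simp only [L, commutatorMap_apply, LinearMap.comp_zero, sub_zero]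
      rfl
  have hM : ∀ (n : ℕ) (F : V →ₗ[A] W), (M ^ n) F = F ∘ₗ ((-a) ^ n : Module.End A V) := by
    intro n F
    induction n with
    | zero => rfl
    | succ n ih =>
      rw [pow_succ', Module.End.mul_apply, ih, pow_succ]
      simp only [M, commutatorMap_apply, LinearMap.zero_comp, zero_sub]
      ext v
      simp
  have hLM : commutatorMap K a b = L + M := by
    ext F v
    simp [L, M, commutatorMap_apply, sub_eq_add_neg]
  have hc : Commute L M := by
    ext F v
    simp [L, M, commutatorMap_apply]
  obtain ⟨n, hn⟩ := hb
  obtain ⟨m, hm⟩ := ha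
  have hm' : (-a) ^ m = 0 := by rw [neg_pow, hm, mul_zero]
  have hLn : L ^ n = 0 := by
    ext F v
    rw [hL, hn]; rfl
  have hMm : M ^ m = 0 := by
    ext F v
    rw [hM, hm']; simp
  refine ⟨hLM ▸ hc.isNilpotent_add ⟨n, hLn⟩ ⟨m, hMm⟩, fun F => ?_⟩
  rw [hLM, nexp_add_of_commute K hc ⟨n, hLn⟩ ⟨m, hMm⟩, nexp_eq_sum K hLn, nexp_eq_sum K hMm,
    nexp_eq_sum K hn, nexp_eq_sum K hm']
  ext v
  simp only [Module.End.mul_apply, LinearMap.sum_apply, LinearMap.smul_apply, hL, hM, map_sum,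
    LinearMap.comp_apply, LinearMap.map_smul_of_tower]

end Exponential

/-! ### Coordinates on `A ⊗ V`. -/

section Contraction

variable {K : Type u} [Field K] {A : Type u} [CommRing A] [Algebra K A]
  {V W L : Type u} [AddCommGroup V] [Module K V] [AddCommGroup W] [Module K W]
  [AddCommGroup L] [Module K L]

/-- Contraction of the first factor of `A ⊗ V` with a linear form. -/
noncomputable def contr (V : Type u) [AddCommGroup V] [Module K V] (c : A →ₗ[K] K) :
    A ⊗[K] V →ₗ[K] V :=
  TensorProduct.lid K V ∘ₗ c.rTensor V

@[simp] lemma contr_tmul (c : A →ₗ[K] K) (a : A) (v : V) : contr V c (a ⊗ₜ v) = c a • v := by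
  simp [contr]

lemma contr_eq_zero_of_mem {c : A →ₗ[K] K} {J : Ideal A} (hc : ∀ y ∈ J, c y = 0) {z : A ⊗[K] V}
    (hz : z ∈ J • (⊤ : Submodule A (A ⊗[K] V))) : contr V c z = 0 := by
  refine Submodule.smul_induction_on hz (fun y hy z _ => ?_) fun x y hx hy => ?_
  · clear * - hc hy
    induction z using TensorProduct.induction_on with
    | zero => simp
    | add x y hx hy => rw [smul_add, map_add, hx, hy, add_zero]
    | tmul a v =>
      rw [TensorProduct.smul_tmul', contr_tmul, smul_eq_mul, hc _ (J.mul_mem_right _ hy), zero_smul]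
  · rw [map_add, hx, hy, add_zero]

lemma tmul_mem_smul_top {J : Ideal A} {a : A} (ha : a ∈ J) (v : V) :
    a ⊗ₜ[K] v ∈ J • (⊤ : Submodule A (A ⊗[K] V)) := by
  have : a ⊗ₜ[K] v = a • ((1 : A) ⊗ₜ[K] v) := by simp [TensorProduct.smul_tmul']
  rw [this]
  exact Submodule.smul_mem_smul ha Submodule.mem_top

/-- Coordinates of an ideal modulo a smaller one. -/
lemma exists_coordinates [Module.Finite K A] (J J' : Ideal A) :
    ∃ (n : ℕ) (w : Fin n → A) (c : Fin n → (A →ₗ[K] K)), (∀ i, w i ∈ J) ∧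
      (∀ i, ∀ y ∈ J', c i y = 0) ∧ ∀ (V : Type u) [AddCommGroup V] [Module K V] (z : A ⊗[K] V),
        z ∈ J • (⊤ : Submodule A (A ⊗[K] V)) →
          z - ∑ i, w i ⊗ₜ contr V (c i) z ∈ J' • (⊤ : Submodule A (A ⊗[K] V)) := by
  -- The image `U` of `J` in `A / J'` is finite-dimensional: `w` lifts a basis of `U` to `J`, and
  -- `c` consists of the coordinate forms, extended to `A / J'` by a retraction onto `U`.
  let q : A →ₗ[K] A ⧸ J' := (Ideal.Quotient.mkₐ K J').toLinearMap
  let U : Submodule K (A ⧸ J') := (J.restrictScalars K).map q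
  let b := Module.finBasis K U
  obtain ⟨r, hr⟩ := U.subtype.exists_leftInverse_of_injective (by simp)
  have hw : ∀ i, ∃ w ∈ J, q w = b i := fun i => (b i).2
  choose w hwJ hw using hw
  let c : Fin _ → (A →ₗ[K] K) := fun i => b.coord i ∘ₗ r ∘ₗ q
  have key : ∀ y ∈ J, y - ∑ i, c i y • w i ∈ J' := by
    intro y hy
    refine Ideal.Quotient.eq_zero_iff_mem.1 ?_
    change q _ = 0
    have h1 : r (q y) = ⟨q y, y, hy, rfl⟩ := congrArg (fun f => f ⟨q y, y, hy, rfl⟩) hr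
    rw [map_sub, map_sum, sub_eq_zero]
    have := congrArg Subtype.val (b.sum_repr (r (q y)))
    rw [h1] at this
    refine this.symm.trans ?_
    rw [Submodule.coe_sum]
    refine Finset.sum_congr rfl fun i _ => ?_
    rw [map_smul, hw, Submodule.coe_smul]
    simp [c, h1]
  refine ⟨_, w, c, hwJ, fun i y hy => ?_, fun V _ _ z hz => ?_⟩
  · have : q y = 0 := Ideal.Quotient.eq_zero_iff_mem.2 hy
    simp [c, this]
  · refine Submodule.smul_induction_on hz (fun y hy z _ => ?_) fun x y hx hy => ?_
    · clear hz
      rename_i hz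
      clear hz
      induction z using TensorProduct.induction_on with
      | zero => simp
      | add x y hx hy =>
        refine Eq.mp (congrArg (· ∈ _) ?_) (add_mem hx hy)
        simp only [smul_add, map_add, TensorProduct.tmul_add, Finset.sum_add_distrib]
        abel
      | tmul a v =>
        have := tmul_mem_smul_top (K := K) (key (y * a) (J.mul_mem_right _ hy)) v
        convert this using 1
        simp [TensorProduct.smul_tmul', TensorProduct.sub_tmul, TensorProduct.sum_tmul,
          TensorProduct.tmul_smul]
    · refine Eq.mp (congrArg (· ∈ _) ?_) (add_mem hx hy)
      simp only [map_add, TensorProduct.tmul_add, Finset.sum_add_distrib]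
      abel

end Contraction

/-! ### Finiteness of Artin algebras and reduction modulo the maximal ideal. -/

namespace ArtAlg
variable {K : Type u} [Field K] (A : ArtAlg K)

/-- The powers of `𝔪` filter `A`, starting from `𝔪^n = 0` and ascending to `A`. Each graded piece is
finitely generated over `A` and killed by `𝔪`, so finite-dimensional over the residue field `K`. -/
instance finite : Module.Finite K A.obj := by
  obtain ⟨n, hn⟩ := A.isNilpotent_𝔪
  have key : ∀ k ≤ n, ((A.𝔪 ^ (n - k)).restrictScalars K).FG := by
    intro k
    induction k with
    | zero =>
      intro _
      rw [Nat.sub_zero, hn]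
      exact Submodule.fg_bot
    | succ k ih =>
      intro hk
      obtain ⟨s, hs⟩ := (IsNoetherian.noetherian (A.𝔪 ^ (n - (k + 1))) : (A.𝔪 ^ (n - (k + 1))).FG)
      have step : ∀ y ∈ Submodule.span A.obj (s : Set A.obj),
          y ∈ Submodule.span K (s : Set A.obj) ⊔ (A.𝔪 ^ (n - k)).restrictScalars K := by
        intro y hy
        induction hy using Submodule.span_induction with
        | mem y hy => exact Submodule.mem_sup_left (Submodule.subset_span hy)
        | zero => exact zero_mem _
        | add x y _ _ hx hy => exact add_mem hx hy
        | smul a y hy ih =>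
          -- Splitting `a` into a scalar and an element of `𝔪` replaces the span over `A` by the
          -- span over `K`, modulo the next power of `𝔪`.
          have h : a - algebraMap K A.obj (A.residue a) ∈ A.𝔪 := by
            rw [← residue_eq_zero_iff]; simp
          have e : a • y = A.residue a • y + (a - algebraMap K A.obj (A.residue a)) * y := by
            rw [Algebra.smul_def (A.residue a), smul_eq_mul]; ring
          rw [e]
          refine add_mem (Submodule.smul_mem _ _ ih) (Submodule.mem_sup_right ?_)
          have e : n - k = (n - (k + 1)) + 1 := by omega
          change _ ∈ A.𝔪 ^ (n - k)
          rw [e, pow_succ']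
          exact Ideal.mul_mem_mul h (hs ▸ hy)
      have e : (A.𝔪 ^ (n - (k + 1))).restrictScalars K =
          Submodule.span K s ⊔ (A.𝔪 ^ (n - k)).restrictScalars K := by
        refine le_antisymm (fun y hy => ?_) (sup_le (Submodule.span_le.2 fun y hy => ?_) ?_)
        · exact step y (by rw [hs]; exact hy)
        · change y ∈ A.𝔪 ^ (n - (k + 1))
          rw [← hs]
          exact Submodule.subset_span hy
        · intro y hy
          exact Ideal.pow_le_pow_right (by omega) hy
      rw [e]
      exact (Submodule.fg_span s.finite_toSet).sup (ih (by omega))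
  have := key n le_rfl
  simp only [Nat.sub_self, pow_zero, Ideal.one_eq_top, Submodule.restrictScalars_top] at this
  exact ⟨this⟩

variable {A}
/-- Reduction `A ⊗ V → V` modulo the maximal ideal. -/
noncomputable abbrev red (A : ArtAlg K) (V : Type u) [AddCommGroup V] [Module K V] :
    A.obj ⊗[K] V →ₗ[K] V := contr V A.residue.toLinearMap

variable {V W : Type u} [AddCommGroup V] [Module K V] [AddCommGroup W] [Module K W]

lemma red_smul (a : A.obj) (z : A.obj ⊗[K] V) : A.red V (a • z) = A.residue a • A.red V z := by
  induction z using TensorProduct.induction_on with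
  | zero => simp
  | add x y hx hy => rw [smul_add, map_add, hx, hy, map_add, smul_add]
  | tmul b v => simp [TensorProduct.smul_tmul', mul_smul]

lemma sub_red_mem (z : A.obj ⊗[K] V) :
    z - 1 ⊗ₜ A.red V z ∈ A.𝔪 • (⊤ : Submodule A.obj (A.obj ⊗[K] V)) := by
  induction z using TensorProduct.induction_on with
  | zero => simp
  | add x y hx hy =>
    convert add_mem hx hy using 1
    rw [map_add, TensorProduct.tmul_add]; abel
  | tmul a v =>
    have h : a - algebraMap K A.obj (A.residue a) ∈ A.𝔪 := by
      rw [← residue_eq_zero_iff]; simp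
    convert tmul_mem_smul_top (K := K) h v using 1
    simp [TensorProduct.sub_tmul, Algebra.algebraMap_eq_smul_one, TensorProduct.smul_tmul]

lemma red_eq_zero_iff (z : A.obj ⊗[K] V) :
    A.red V z = 0 ↔ z ∈ A.𝔪 • (⊤ : Submodule A.obj (A.obj ⊗[K] V)) := by
  constructor
  · intro h
    simpa [h] using sub_red_mem z
  · exact contr_eq_zero_of_mem fun y hy => (A.residue_eq_zero_iff y).2 hy

end ArtAlg

/-! ### Operators on `A ⊗ V` given by elements of `L ⊗ 𝔪`. -/

namespace ArtAlg
variable {K : Type u} [Field K] (A : ArtAlg K) {L V W : Type u} [AddCommGroup L] [Module K L]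
  [AddCommGroup V] [Module K V] [AddCommGroup W] [Module K W]

/-- The `A`-linear map `A ⊗ V → A ⊗ W` given by an element of `L ⊗ 𝔪`, for `L` acting by linear
maps `V → W`. -/
noncomputable def ev (φ : L →ₗ[K] V →ₗ[K] W) :
    L ⊗[K] A.𝔪 →ₗ[K] (A.obj ⊗[K] V →ₗ[A.obj] A.obj ⊗[K] W) :=
  TensorProduct.lift (LinearMap.mk₂ K (fun l s => (s : A.obj) • (φ l).baseChange A.obj)
    (fun l l' s => by rw [map_add, LinearMap.baseChange_add, smul_add])
    (fun k l s => by rw [map_smul, LinearMap.baseChange_smul, smul_comm])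
    (fun l s s' => add_smul _ _ _)
    (fun k l s => smul_assoc _ _ _))

variable {A}

lemma ev_tmul (φ : L →ₗ[K] V →ₗ[K] W) (l : L) (s : A.𝔪) :
    A.ev φ (l ⊗ₜ s) = (s : A.obj) • (φ l).baseChange A.obj := rfl

@[simp] lemma ev_tmul_tmul (φ : L →ₗ[K] V →ₗ[K] W) (l : L) (s : A.𝔪) (a : A.obj) (v : V) :
    A.ev φ (l ⊗ₜ s) (a ⊗ₜ v) = ((s : A.obj) * a) ⊗ₜ φ l v := by
  simp [ev_tmul, TensorProduct.smul_tmul']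

/-- Contraction of the second factor of `L ⊗ 𝔪` with a linear form on `A`. -/
noncomputable def contr𝔪 (L : Type u) [AddCommGroup L] [Module K L] (c : A.obj →ₗ[K] K) :
    L ⊗[K] A.𝔪 →ₗ[K] L :=
  TensorProduct.rid K L ∘ₗ (c ∘ₗ A.𝔪.subtype.restrictScalars K).lTensor L

lemma contr𝔪_tmul (c : A.obj →ₗ[K] K) (l : L) (s : A.𝔪) :
    contr𝔪 L c (l ⊗ₜ s) = c s • l := by
  simp [contr𝔪]

/-- Contraction with linear forms on `A` recovers the action of the `L`-coefficients of `x` from its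
operator; this is how equalities in `L ⊗ 𝔪` are reduced to equalities of operators. -/
lemma contr_ev (φ : L →ₗ[K] V →ₗ[K] W) (c : A.obj →ₗ[K] K) (x : L ⊗[K] A.𝔪) (v : V) :
    contr W c (A.ev φ x (1 ⊗ₜ v)) = φ (contr𝔪 L c x) v := by
  induction x using TensorProduct.induction_on with
  | zero => simp
  | add x y hx hy => simp only [map_add, LinearMap.add_apply, hx, hy]
  | tmul l s => simp [contr𝔪_tmul]

/-- The coordinate forms of a basis of `𝔪` extend to linear forms on `A`, so contractions see all
coefficients of `x`. -/
lemma eq_zero_of_contr𝔪 (x : L ⊗[K] A.𝔪) (h : ∀ c : A.obj →ₗ[K] K, contr𝔪 L c x = 0) : x = 0 := by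
  let b := Module.Free.chooseBasis K A.𝔪
  obtain ⟨r, hr⟩ := (A.𝔪.subtype.restrictScalars K).exists_leftInverse_of_injective
    (LinearMap.ker_eq_bot.2 Subtype.val_injective)
  apply (TensorProduct.equivFinsuppOfBasisRight b).injective
  rw [map_zero]
  ext i
  rw [TensorProduct.equivFinsuppOfBasisRight_apply, Finsupp.coe_zero, Pi.zero_apply]
  rw [← h (b.coord i ∘ₗ r)]
  have : (b.coord i ∘ₗ r) ∘ₗ A.𝔪.subtype.restrictScalars K = b.coord i := by
    rw [LinearMap.comp_assoc, hr, LinearMap.comp_id]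
  rw [contr𝔪, this]
  rfl

/-- An element of `L ⊗ 𝔪` is determined by the maps it induces, for jointly faithful actions. -/
lemma eq_of_ev_eq {x y : L ⊗[K] A.𝔪}
    (h : ∀ c : A.obj →ₗ[K] K, contr𝔪 L c x = contr𝔪 L c y) : x = y := by
  rw [← sub_eq_zero]
  exact eq_zero_of_contr𝔪 _ fun c => by rw [map_sub, h, sub_self]

/-- The coefficients of `x` lie in `𝔪`, so its operator raises the filtration by one step.
Nilpotence and all estimates on exponentials rest on this. -/
lemma ev_mem (φ : L →ₗ[K] V →ₗ[K] W) (x : L ⊗[K] A.𝔪) {J : Ideal A.obj} {z : A.obj ⊗[K] V}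
    (hz : z ∈ J • (⊤ : Submodule A.obj (A.obj ⊗[K] V))) :
    A.ev φ x z ∈ (A.𝔪 * J) • (⊤ : Submodule A.obj (A.obj ⊗[K] W)) := by
  induction x using TensorProduct.induction_on with
  | zero => simp
  | add x y hx hy => rw [map_add]; exact add_mem hx hy
  | tmul l s =>
    rw [ev_tmul, LinearMap.smul_apply, Submodule.mul_smul]
    refine Submodule.smul_mem_smul s.2 ?_
    refine Submodule.smul_induction_on hz (fun a ha z _ => ?_) fun x y hx hy => ?_
    · rw [map_smul]; exact Submodule.smul_mem_smul ha Submodule.mem_top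
    · rw [map_add]; exact add_mem hx hy

lemma ev_mem_𝔪 (φ : L →ₗ[K] V →ₗ[K] W) (x : L ⊗[K] A.𝔪) (z : A.obj ⊗[K] V) :
    A.ev φ x z ∈ A.𝔪 • (⊤ : Submodule A.obj (A.obj ⊗[K] W)) := by
  have := ev_mem φ x (J := ⊤) (z := z) (by simp)
  simpa using this

lemma isNilpotent_of_mem {V : Type u} [AddCommGroup V] [Module A.obj V] (f : Module.End A.obj V)
    (hf : ∀ (J : Ideal A.obj), ∀ z ∈ J • (⊤ : Submodule A.obj V), f z ∈ (A.𝔪 * J) • (⊤ : Submodule A.obj V)) :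
    IsNilpotent f := by
  obtain ⟨n, hn⟩ := A.isNilpotent_𝔪
  have key : ∀ k z, (f ^ k) z ∈ (A.𝔪 ^ k) • (⊤ : Submodule A.obj V) := by
    intro k z
    induction k with
    | zero => simp
    | succ k ih =>
      rw [pow_succ' f, Module.End.mul_apply, pow_succ' A.𝔪]
      exact hf _ _ ih
  refine ⟨n, LinearMap.ext fun z => ?_⟩
  have := key n z
  rw [hn] at this
  simpa using this

lemma isNilpotent_ev (φ : L →ₗ[K] V →ₗ[K] V) (x : L ⊗[K] A.𝔪) :
    IsNilpotent (A.ev φ x : Module.End A.obj (A.obj ⊗[K] V)) :=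
  isNilpotent_of_mem _ fun _ _ => ev_mem φ x

/-- From the quadratic term on, the exponential series applies `f` at least twice: once to land in
`J V`, and once more to gain a factor `𝔪`. The target `J'` is free so that the case `J = J' = 𝔪`
also gives that the exponential is the identity modulo `𝔪`. -/
lemma nexp_sub_mem [CharZero K] {V : Type u} [AddCommGroup V] [Module K V] [Module A.obj V]
    [IsScalarTower K A.obj V] (f : Module.End A.obj V)
    (hf : ∀ (J : Ideal A.obj), ∀ z ∈ J • (⊤ : Submodule A.obj V), f z ∈ (A.𝔪 * J) • (⊤ : Submodule A.obj V))
    (J J' : Ideal A.obj) (hJ : A.𝔪 * J ≤ J') (h : ∀ z, f z ∈ J • (⊤ : Submodule A.obj V)) (z : V) :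
    nexp K f z - z - f z ∈ J' • (⊤ : Submodule A.obj V) := by
  obtain ⟨n, hn⟩ := isNilpotent_of_mem f hf
  have hn' : f ^ (n + 2) = 0 := by
    rw [pow_add, hn, zero_mul]
  rw [nexp_eq_sum K hn', Finset.sum_range_succ', Finset.sum_range_succ']
  have e : ∀ a b c : V, (a + b + c) - c - b = a := fun a b c => by abel
  have h1 : ∀ (k : ℕ) z, (f ^ (k + 1)) z ∈ J • (⊤ : Submodule A.obj V) := by
    intro k z
    rw [pow_succ', Module.End.mul_apply]
    exact h _
  simp only [LinearMap.add_apply, zero_add, pow_zero, pow_one, Nat.factorial_zero, Nat.factorial_one,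
    Nat.cast_one, inv_one, one_smul, Module.End.one_apply]
  rw [e, LinearMap.sum_apply]
  refine Submodule.sum_mem _ fun k _ => ?_
  rw [LinearMap.smul_apply]
  refine Submodule.smul_of_tower_mem _ _ (Submodule.smul_mono_left hJ ?_)
  rw [pow_succ', Module.End.mul_apply]
  exact hf _ _ (h1 k z)

end ArtAlg

/-! ### The `A ⊗ R`-module structure on `A ⊗ V`. -/

section TensorAction

variable (K A : Type u) [CommRing K] [CommRing A] [Algebra K A] {R : Type u} [CommRing R] [Algebra K R]
  (V : Type u) [AddCommGroup V] [Module K V] [Module R V] [IsScalarTower K R V]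

/-- The action of `A ⊗ R` on `A ⊗ V`, for an `R`-module `V`. -/
noncomputable def tensorAct : A ⊗[K] R →ₐ[A] Module.End A (A ⊗[K] V) :=
  Algebra.TensorProduct.lift (Algebra.ofId A _)
    ((Module.End.baseChangeHom K A V).comp (Algebra.lsmul K K V))
    (fun a _ => Algebra.commutes a _)

lemma tensorAct_tmul (a a' : A) (r : R) (v : V) :
    tensorAct K A V (a ⊗ₜ r) (a' ⊗ₜ v) = (a * a') ⊗ₜ (r • v) := by
  refine (congrArg (fun f : Module.End A (A ⊗[K] V) => f (a' ⊗ₜ v))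
    (Algebra.TensorProduct.lift_tmul _ _ _ a r)).trans ?_
  change a • ((Module.End.baseChangeHom K A V (Algebra.lsmul K K V r)) (a' ⊗ₜ v)) = _
  change a • (a' ⊗ₜ (r • v)) = _
  rw [TensorProduct.smul_tmul', smul_eq_mul]

end TensorAction

/-! ### Components of elements of the DG-Lie algebra. -/

namespace PairDer
open CochainComplex CochainComplex.HomComplex HomDGLie

variable {K : Type u} [Field K] {R : Type u} [CommRing R] [Algebra K R]
  {E : CochainComplex (ModuleCat.{u} R) ℤ}

noncomputable instance moduleX (p : ℤ) : Module K (E.X p) :=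
  Module.compHom (E.X p) (algebraMap K R)

instance (p : ℤ) : IsScalarTower K R (E.X p) :=
  ⟨fun k r v => by rw [Algebra.smul_def, mul_smul]; rfl⟩

variable (A : ArtAlg K)

noncomputable instance moduleTensorX (p : ℤ) : Module (A.obj ⊗[K] R) (A.obj ⊗[K] E.X p) :=
  Module.compHom _ (tensorAct K A.obj (E.X p)).toRingHom

variable {A}

lemma tmul_smul_tmul (p : ℤ) (a a' : A.obj) (r : R) (v : E.X p) :
    (a ⊗ₜ[K] r) • (a' ⊗ₜ[K] v) = (a * a') ⊗ₜ[K] (r • v) :=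
  tensorAct_tmul K A.obj (E.X p) a a' r v

instance (p : ℤ) : IsScalarTower A.obj (A.obj ⊗[K] R) (A.obj ⊗[K] E.X p) :=
  ⟨fun a b z => by
    change tensorAct K A.obj (E.X p) (a • b) z = a • tensorAct K A.obj (E.X p) b z
    rw [map_smul]; rfl⟩

/-- The components of an element of `D^n` as linear maps. -/
noncomputable def compL (n p q : ℤ) (h : p + n = q) :
    (dgla K R E).L n →ₗ[K] E.X p →ₗ[K] E.X q where
  toFun l := ((l : degree K R E n).1.2.v p q h).hom
  map_add' _ _ := rfl
  map_smul' _ _ := rfl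

/-- The derivation underlying an element of `D^n`. -/
noncomputable def derL (n : ℤ) : (dgla K R E).L n →ₗ[K] R →ₗ[K] R where
  toFun l := ((l : degree K R E n).1.1 : R →ₗ[K] R)
  map_add' _ _ := rfl
  map_smul' _ _ := rfl

/-- The differential of the complex as a `K`-linear map. -/
noncomputable def dL (K : Type u) [Field K] [Algebra K R] (E : CochainComplex (ModuleCat.{u} R) ℤ)
    (p q : ℤ) : E.X p →ₗ[K] E.X q :=
  (E.d p q).hom.restrictScalars K

lemma dL_dL (p q r : ℤ) (v : E.X p) : dL K E q r (dL K E p q v) = 0 := by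
  have := congrArg (fun f => f.hom v) (E.d_comp_d p q r)
  exact this

lemma L_ext {n : ℤ} {l l' : (dgla K R E).L n} (h₁ : ∀ r, derL n l r = derL n l' r)
    (h₂ : ∀ p q h v, compL n p q h l v = compL n p q h l' v) : l = l' :=
  Subtype.ext (Prod.ext (Derivation.ext h₁) (cochain_ext h₂))

lemma derL_mul (n : ℤ) (l : (dgla K R E).L n) (r s : R) :
    derL n l (r * s) = r * derL n l s + s * derL n l r :=
  (l : degree K R E n).1.1.leibniz r s

lemma derL_eq_zero {n : ℤ} (hn : n ≠ 0) (l : (dgla K R E).L n) : derL n l = 0 := by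
  have : (l : degree K R E n).1.1 = 0 := (l : degree K R E n).2.eq_zero hn
  change ((l : degree K R E n).1.1 : R →ₗ[K] R) = 0
  rw [this]; rfl

lemma compL_smul {n : ℤ} (hn : n ≠ 0) (p q : ℤ) (h : p + n = q) (l : (dgla K R E).L n) (r : R)
    (v : E.X p) : compL n p q h l (r • v) = r • compL n p q h l v :=
  sub_eq_zero.1 ((l : degree K R E n).2.linear hn p q h r v)

lemma compL_smul_zero (p : ℤ) (h : p + 0 = p) (l : (dgla K R E).L 0) (r : R) (v : E.X p) :
    compL 0 p p h l (r • v) = r • compL 0 p p h l v + derL 0 l r • v :=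
  sub_eq_iff_eq_add'.1 ((l : degree K R E 0).2.leibniz p h r v)

/-- Between odd elements the graded commutator is an anticommutator, whence the plus sign here and
in `compL_bracket_one`; against degree zero it is the ordinary commutator. -/
lemma compL_d_one (p q r : ℤ) (hpq : p + 1 = q) (hqr : q + 1 = r) (l : (dgla K R E).L 1) (v : E.X p) :
    compL 2 p r (by omega) ((dgla K R E).d 1 2 rfl l) v =
      dL K E q r (compL 1 p q hpq l v) + compL 1 q r hqr l (dL K E p q v) := by
  have : (δ 1 2 (l : degree K R E 1).1.2).v p r (by omega) =
      (l : degree K R E 1).1.2.v p q hpq ≫ (underlying K R E).d q r +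
        (underlying K R E).d p q ≫ (l : degree K R E 1).1.2.v q r hqr := by
    rw [δ_v 1 2 rfl _ p r (by omega) q q (by omega) (by omega),
      Int.negOnePow_even 2 ⟨1, rfl⟩, one_smul]
  exact congrArg (fun f => f.hom v) this

lemma compL_d_zero (p q : ℤ) (hpq : p + 1 = q) (l : (dgla K R E).L 0) (v : E.X p) :
    compL 1 p q hpq ((dgla K R E).d 0 1 rfl l) v =
      dL K E p q (compL 0 p p (by omega) l v) - compL 0 q q (by omega) l (dL K E p q v) := by
  have : (δ 0 1 (l : degree K R E 0).1.2).v p q hpq =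
      (l : degree K R E 0).1.2.v p p (by omega) ≫ (underlying K R E).d p q -
        (underlying K R E).d p q ≫ (l : degree K R E 0).1.2.v q q (by omega) :=
    δ_zero_cochain_v _ _ _ _
  exact congrArg (fun f => f.hom v) this

lemma compL_bracket_one (p q r : ℤ) (hpq : p + 1 = q) (hqr : q + 1 = r) (l l' : (dgla K R E).L 1)
    (v : E.X p) :
    compL 2 p r (by omega) ((dgla K R E).bracket 1 1 2 rfl l l') v =
      compL 1 q r hqr l (compL 1 p q hpq l' v) + compL 1 q r hqr l' (compL 1 p q hpq l v) := by
  have : (gradedComm (rfl : (1 : ℤ) + 1 = 2) (l : degree K R E 1).1.2 (l' : degree K R E 1).1.2).v p r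
      (by omega) =
      (l' : degree K R E 1).1.2.v p q hpq ≫ (l : degree K R E 1).1.2.v q r hqr +
        (l : degree K R E 1).1.2.v p q hpq ≫ (l' : degree K R E 1).1.2.v q r hqr := by
    have h1 := Cochain.comp_v (l' : degree K R E 1).1.2 (l : degree K R E 1).1.2
      (rfl : (1 : ℤ) + 1 = 2) p q r hpq hqr
    have h2 := Cochain.comp_v (l : degree K R E 1).1.2 (l' : degree K R E 1).1.2
      (rfl : (1 : ℤ) + 1 = 2) p q r hpq hqr
    rw [← h1, ← h2]
    simp [gradedComm]
  exact congrArg (fun f => f.hom v) this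

lemma compL_bracket_zero (p q : ℤ) (hpq : p + 1 = q) (l : (dgla K R E).L 0) (l' : (dgla K R E).L 1)
    (v : E.X p) :
    compL 1 p q hpq ((dgla K R E).bracket 0 1 1 rfl l l') v =
      compL 0 q q (by omega) l (compL 1 p q hpq l' v) -
        compL 1 p q hpq l' (compL 0 p p (by omega) l v) := by
  have : (gradedComm (rfl : (0 : ℤ) + 1 = 1) (l : degree K R E 0).1.2 (l' : degree K R E 1).1.2).v p q
      hpq =
      (l' : degree K R E 1).1.2.v p q hpq ≫ (l : degree K R E 0).1.2.v q q (by omega) -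
        (l : degree K R E 0).1.2.v p p (by omega) ≫ (l' : degree K R E 1).1.2.v p q hpq := by
    have h1 := Cochain.comp_v (l' : degree K R E 1).1.2 (l : degree K R E 0).1.2
      (by omega : (1 : ℤ) + 0 = 1) p q q hpq (by omega)
    have h2 := Cochain.comp_v (l : degree K R E 0).1.2 (l' : degree K R E 1).1.2
      (rfl : (0 : ℤ) + 1 = 1) p p q (by omega) hpq
    rw [← h1, ← h2]
    simp [gradedComm]
  exact congrArg (fun f => f.hom v) this

/-- An element of `D^1` given by `R`-linear maps. -/
lemma exists_L_one (u : ∀ p q : ℤ, p + 1 = q → (E.X p →ₗ[K] E.X q))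
    (hu : ∀ p q h (r : R) v, u p q h (r • v) = r • u p q h v) :
    ∃ l : (dgla K R E).L 1, ∀ p q h, compL 1 p q h l = u p q h := by
  let c : Cochain (underlying K R E) (underlying K R E) 1 :=
    Cochain.mk fun p q h => ModuleCat.ofHom (u p q h)
  have hc : ∀ p q h v, component c h v = u p q h v := fun p q h v => by
    simp [component, c]; rfl
  refine ⟨(⟨(0, c), ⟨fun _ => rfl, fun _ p q h r v => ?_, fun p hp => by omega⟩⟩ : degree K R E 1),
    fun p q h => ?_⟩
  · rw [hc, hc, hu, sub_self]
  · ext v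
    exact hc p q h v

/-- An element of `D^0` given by a derivation and compatible maps. -/
lemma exists_L_zero (h : R →ₗ[K] R) (hh : ∀ r s, h (r * s) = r * h s + s * h r)
    (u : ∀ p : ℤ, E.X p →ₗ[K] E.X p)
    (hu : ∀ p (r : R) v, u p (r • v) = r • u p v + h r • v) :
    ∃ l : (dgla K R E).L 0, derL 0 l = h ∧ ∀ p hp, compL 0 p p hp l = u p := by
  let c : Cochain (underlying K R E) (underlying K R E) 0 :=
    Cochain.ofHoms fun p => ModuleCat.ofHom (u p)
  have hc : ∀ p hp v, component c hp v = u p v := fun p hp v => by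
    simp [component, c]; rfl
  refine ⟨(⟨(Derivation.mk' h hh, c), ⟨fun hn => absurd rfl hn, fun hn => absurd rfl hn,
    fun p hp r v => ?_⟩⟩ : degree K R E 0), rfl, fun p hp => ?_⟩
  · rw [hc, hc, hu, add_sub_cancel_left]; rfl
  · ext v
    exact hc p hp v

end PairDer

/-! ### Exponentials of derivations are semilinear. -/

section ExponentialSemilinear
variable (K : Type*) [Field K] [CharZero K]
  {A V U : Type*} [CommRing A] [Algebra K A] [AddCommGroup V] [Module K V] [Module A V]
  [IsScalarTower K A V] [AddCommGroup U] [Module K U] [Module A U] [IsScalarTower K A U]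

/-- The exponential of a derivation of a module is semilinear over the exponential of the underlying
derivation. -/
lemma nexp_comp_of_commutator {a : Module.End A V} {h : Module.End A U} (ha : IsNilpotent a)
    (hh : IsNilpotent h) (m : U →ₗ[A] Module.End A V)
    (hm : ∀ b, a ∘ₗ m b - m b ∘ₗ a = m (h b)) (b : U) :
    nexp K a ∘ₗ m b = m (nexp K h b) ∘ₗ nexp K a := by
  obtain ⟨hT, hconj⟩ := nexp_commutatorMap K ha ha
  have hpow : ∀ i : ℕ, ((commutatorMap K a a) ^ i) (m b) = m ((h ^ i) b) := by
    intro i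
    induction i with
    | zero => rfl
    | succ i ih =>
      rw [pow_succ', Module.End.mul_apply, ih, commutatorMap_apply, hm, pow_succ' h,
        Module.End.mul_apply]
  have key : nexp K (commutatorMap K a a) (m b) = m (nexp K h b) := by
    obtain ⟨N, hN⟩ := hT
    obtain ⟨N', hN'⟩ := hh
    have h1 : (commutatorMap K a a) ^ (N + N') = 0 := by rw [pow_add, hN, zero_mul]
    have h2 : h ^ (N + N') = 0 := by rw [pow_add, hN', mul_zero]
    rw [nexp_eq_sum K h1, nexp_eq_sum K h2]
    simp only [LinearMap.sum_apply, LinearMap.smul_apply, hpow, map_sum,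
      LinearMap.map_smul_of_tower]
  rw [← key, hconj]
  have := nexp_neg_mul_nexp K ha
  ext v
  have h3 := congrArg (fun f => nexp K a (m b (f v))) this
  exact h3.symm

end ExponentialSemilinear

namespace ArtAlg
variable {K : Type u} [Field K] {A : ArtAlg K} {V W : Type u} [AddCommGroup V] [Module K V]
  [AddCommGroup W] [Module K W]

lemma red_baseChange (f : V →ₗ[K] W) (z : A.obj ⊗[K] V) :
    A.red W (f.baseChange A.obj z) = f (A.red V z) := by
  induction z using TensorProduct.induction_on with
  | zero => simp
  | add x y hx hy => simp only [map_add, hx, hy]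
  | tmul a v => simp

lemma red_eq_of_sub_mem {z w : A.obj ⊗[K] V}
    (h : z - w ∈ A.𝔪 • (⊤ : Submodule A.obj (A.obj ⊗[K] V))) : A.red V z = A.red V w := by
  rw [← sub_eq_zero, ← map_sub, red_eq_zero_iff]
  exact h

lemma ext_tmul {T : Type*} [AddCommGroup T] [Module A.obj T]
    {f g : A.obj ⊗[K] V →ₗ[A.obj] T} (h : ∀ v, f (1 ⊗ₜ v) = g (1 ⊗ₜ v)) : f = g := by
  apply LinearMap.ext
  intro z
  induction z using TensorProduct.induction_on with
  | zero => simp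
  | add x y hx hy => simp only [map_add, hx, hy]
  | tmul a v =>
    have : a ⊗ₜ[K] v = a • ((1 : A.obj) ⊗ₜ[K] v) := by simp [TensorProduct.smul_tmul']
    rw [this, map_smul, map_smul, h]

end ArtAlg

/-! ### Maurer-Cartan elements as twisted differentials. -/

namespace PairDer

variable {K : Type u} [Field K] {R : Type u} [CommRing R] [Algebra K R]
  {E : CochainComplex (ModuleCat.{u} R) ℤ} {A : ArtAlg K}

/-- The differential of `A ⊗ E` twisted by `x`. -/
noncomputable def twist (x : (dgla K R E).tens A 1) (p q : ℤ) (h : p + 1 = q) :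
    A.obj ⊗[K] E.X p →ₗ[A.obj] A.obj ⊗[K] E.X q :=
  (dL K E p q).baseChange A.obj + A.ev (compL 1 p q h) x

lemma red_twist (x : (dgla K R E).tens A 1) (p q : ℤ) (h : p + 1 = q) (z : A.obj ⊗[K] E.X p) :
    A.red _ (twist x p q h z) = dL K E p q (A.red _ z) := by
  rw [twist, LinearMap.add_apply, map_add, ArtAlg.red_baseChange, (ArtAlg.red_eq_zero_iff _).2
    (ArtAlg.ev_mem_𝔪 _ _ _), add_zero]

lemma ev_one_smul (x : (dgla K R E).tens A 1) (p q : ℤ) (h : p + 1 = q) (b : A.obj ⊗[K] R)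
    (z : A.obj ⊗[K] E.X p) :
    A.ev (compL 1 p q h) x (b • z) = b • A.ev (compL 1 p q h) x z := by
  induction z using TensorProduct.induction_on with
  | zero => simp
  | add z w hz hw => simp only [smul_add, map_add, hz, hw]
  | tmul a' v =>
    induction b using TensorProduct.induction_on with
    | zero => simp
    | add b c hb hc => simp only [add_smul, map_add, hb, hc]
    | tmul a r =>
      induction x using TensorProduct.induction_on with
      | zero => simp
      | add x y hx hy => simp only [map_add, LinearMap.add_apply, hx, hy, smul_add]
      | tmul l s =>
        rw [tmul_smul_tmul, ArtAlg.ev_tmul_tmul, ArtAlg.ev_tmul_tmul, tmul_smul_tmul,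
          compL_smul (by decide)]
        congr 1
        ring

lemma baseChange_dL_smul (p q : ℤ) (b : A.obj ⊗[K] R) (z : A.obj ⊗[K] E.X p) :
    (dL K E p q).baseChange A.obj (b • z) = b • (dL K E p q).baseChange A.obj z := by
  induction z using TensorProduct.induction_on with
  | zero => simp
  | add z w hz hw => simp only [smul_add, map_add, hz, hw]
  | tmul a' v =>
    induction b using TensorProduct.induction_on with
    | zero => simp
    | add b c hb hc => simp only [add_smul, map_add, hb, hc]
    | tmul a r =>
      rw [tmul_smul_tmul, LinearMap.baseChange_tmul, LinearMap.baseChange_tmul, tmul_smul_tmul]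
      congr 1
      exact (E.d p q).hom.map_smul r v

lemma twist_smul (x : (dgla K R E).tens A 1) (p q : ℤ) (h : p + 1 = q) (b : A.obj ⊗[K] R)
    (z : A.obj ⊗[K] E.X p) : twist x p q h (b • z) = b • twist x p q h z := by
  simp only [twist, LinearMap.add_apply, ev_one_smul, baseChange_dL_smul, smul_add]

/-- The derivation component vanishes outside degree zero, so the maps between the modules `E^p`
determine the element. -/
lemma ev_ext_two {x y : (dgla K R E).tens A 2}
    (h : ∀ p r hr, A.ev (compL 2 p r hr) x = A.ev (compL 2 p r hr) y) : x = y := by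
  refine ArtAlg.eq_of_ev_eq fun c => L_ext (fun r => ?_) fun p r hr v => ?_
  · rw [derL_eq_zero (by decide), derL_eq_zero (by decide)]
  · rw [← ArtAlg.contr_ev, ← ArtAlg.contr_ev, h]

lemma ev_ext_one {x y : (dgla K R E).tens A 1}
    (h : ∀ p r hr, A.ev (compL 1 p r hr) x = A.ev (compL 1 p r hr) y) : x = y := by
  refine ArtAlg.eq_of_ev_eq fun c => L_ext (fun r => ?_) fun p r hr v => ?_
  · rw [derL_eq_zero (by decide), derL_eq_zero (by decide)]
  · rw [← ArtAlg.contr_ev, ← ArtAlg.contr_ev, h]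

lemma twist_injective {x y : (dgla K R E).tens A 1} (h : ∀ p q hpq, twist x p q hpq = twist y p q hpq) :
    x = y :=
  ev_ext_one fun p q hpq => LinearMap.ext fun z =>
    add_left_cancel (LinearMap.congr_fun (h p q hpq) z)

lemma ev_dT_one (x : (dgla K R E).tens A 1) (p q r : ℤ) (hpq : p + 1 = q) (hqr : q + 1 = r) :
    A.ev (compL 2 p r (by omega)) ((dgla K R E).dT A 1 2 rfl x) =
      (dL K E q r).baseChange A.obj ∘ₗ A.ev (compL 1 p q hpq) x +
        A.ev (compL 1 q r hqr) x ∘ₗ (dL K E p q).baseChange A.obj := by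
  refine ArtAlg.ext_tmul fun v => ?_
  induction x using TensorProduct.induction_on with
  | zero => simp
  | add x y hx hy =>
    simp only [map_add, LinearMap.add_apply, LinearMap.comp_apply] at hx hy ⊢
    rw [hx, hy]; abel
  | tmul l s =>
    have : (dgla K R E).dT A 1 2 rfl (l ⊗ₜ s) = ((dgla K R E).d 1 2 rfl l) ⊗ₜ s := rfl
    rw [this]
    simp [compL_d_one p q r hpq hqr, TensorProduct.tmul_add]

lemma ev_dT_zero (x : (dgla K R E).tens A 0) (p q : ℤ) (hpq : p + 1 = q) :
    A.ev (compL 1 p q hpq) ((dgla K R E).dT A 0 1 rfl x) =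
      (dL K E p q).baseChange A.obj ∘ₗ A.ev (compL 0 p p (by omega)) x -
        A.ev (compL 0 q q (by omega)) x ∘ₗ (dL K E p q).baseChange A.obj := by
  refine ArtAlg.ext_tmul fun v => ?_
  induction x using TensorProduct.induction_on with
  | zero => simp
  | add x y hx hy =>
    simp only [map_add, LinearMap.add_apply, LinearMap.sub_apply, LinearMap.comp_apply] at hx hy ⊢
    rw [hx, hy]; abel
  | tmul l s =>
    have : (dgla K R E).dT A 0 1 rfl (l ⊗ₜ s) = ((dgla K R E).d 0 1 rfl l) ⊗ₜ s := rfl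
    rw [this]
    simp [compL_d_zero p q hpq, TensorProduct.tmul_sub]

lemma ev_bracketT_one (x y : (dgla K R E).tens A 1) (p q r : ℤ) (hpq : p + 1 = q) (hqr : q + 1 = r) :
    A.ev (compL 2 p r (by omega)) ((dgla K R E).bracketT A 1 1 2 rfl x y) =
      A.ev (compL 1 q r hqr) x ∘ₗ A.ev (compL 1 p q hpq) y +
        A.ev (compL 1 q r hqr) y ∘ₗ A.ev (compL 1 p q hpq) x := by
  refine ArtAlg.ext_tmul fun v => ?_
  induction x using TensorProduct.induction_on with
  | zero => simp
  | add x x' hx hy =>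
    simp only [map_add, LinearMap.add_apply, LinearMap.comp_apply] at hx hy ⊢
    rw [hx, hy]; abel
  | tmul l s =>
    induction y using TensorProduct.induction_on with
    | zero => simp
    | add y y' hx hy =>
      simp only [map_add, LinearMap.add_apply, LinearMap.comp_apply] at hx hy ⊢
      rw [hx, hy]; abel
    | tmul l' s' =>
      have : (dgla K R E).bracketT A 1 1 2 rfl (l ⊗ₜ s) (l' ⊗ₜ s') =
        ((dgla K R E).bracket 1 1 2 rfl l l') ⊗ₜ A.mul𝔪 s s' := rfl
      have h' : ((A.mul𝔪 s s' : A.𝔪) : A.obj) = s * s' := rfl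
      rw [this]
      simp [compL_bracket_one p q r hpq hqr, TensorProduct.tmul_add, h', mul_comm]

lemma ev_bracketT_zero (x : (dgla K R E).tens A 0) (y : (dgla K R E).tens A 1) (p q : ℤ)
    (hpq : p + 1 = q) :
    A.ev (compL 1 p q hpq) ((dgla K R E).bracketT A 0 1 1 rfl x y) =
      A.ev (compL 0 q q (by omega)) x ∘ₗ A.ev (compL 1 p q hpq) y -
        A.ev (compL 1 p q hpq) y ∘ₗ A.ev (compL 0 p p (by omega)) x := by
  refine ArtAlg.ext_tmul fun v => ?_
  induction x using TensorProduct.induction_on with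
  | zero => simp
  | add x x' hx hy =>
    simp only [map_add, LinearMap.add_apply, LinearMap.sub_apply, LinearMap.comp_apply] at hx hy ⊢
    rw [hx, hy]; abel
  | tmul l s =>
    induction y using TensorProduct.induction_on with
    | zero => simp
    | add y y' hx hy =>
      simp only [map_add, LinearMap.add_apply, LinearMap.sub_apply, LinearMap.comp_apply] at hx hy ⊢
      rw [hx, hy]; abel
    | tmul l' s' =>
      have : (dgla K R E).bracketT A 0 1 1 rfl (l ⊗ₜ s) (l' ⊗ₜ s') =
        ((dgla K R E).bracket 0 1 1 rfl l l') ⊗ₜ A.mul𝔪 s s' := rfl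
      have h' : ((A.mul𝔪 s s' : A.𝔪) : A.obj) = s * s' := rfl
      rw [this]
      simp [compL_bracket_zero p q hpq, TensorProduct.tmul_sub, h', mul_comm]

/-- The Maurer-Cartan equation says that the twisted differential squares to zero. -/
lemma mc_iff [CharZero K] (x : (dgla K R E).tens A 1) :
    (dgla K R E).dT A 1 2 rfl x + (2 : K)⁻¹ • (dgla K R E).bracketT A 1 1 2 rfl x x = 0 ↔
      ∀ p q r hpq hqr, twist x q r hqr ∘ₗ twist x p q hpq = 0 := by
  have key : ∀ p q r hpq hqr, A.ev (compL 2 p r (by omega))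
      ((dgla K R E).dT A 1 2 rfl x + (2 : K)⁻¹ • (dgla K R E).bracketT A 1 1 2 rfl x x) =
        twist x q r hqr ∘ₗ twist x p q hpq := by
    intro p q r hpq hqr
    -- The bracket of `x` with itself is twice the square of its operator, which the factor one half
    -- cancels; `d ∘ d = 0` accounts for the remaining term of `(d + x)²`.
    rw [map_add, map_smul, ev_dT_one x p q r hpq hqr, ev_bracketT_one x x p q r hpq hqr, ← two_smul K,
      smul_smul, inv_mul_cancel₀ two_ne_zero, one_smul]
    have : (dL K E q r).baseChange A.obj ∘ₗ (dL K E p q).baseChange A.obj = 0 :=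
      ArtAlg.ext_tmul fun v => by simp [dL_dL]
    simp only [twist, LinearMap.add_comp, LinearMap.comp_add, this]
    abel
  constructor
  · intro h p q r hpq hqr
    rw [← key, h, map_zero]
  · intro h
    refine ev_ext_two fun p r hr => ?_
    rw [key p (p + 1) r rfl (by omega), h, map_zero]

/-- A perturbation `u` agreeing with `d` modulo `𝔪` differs from it by a map into `𝔪 ⊗ E`. As `𝔪` is
finite-dimensional, the difference has finitely many coordinates, each an `R`-linear map of degree
one, that is, an element of `D¹`. -/
lemma exists_twist (u : ∀ p q : ℤ, p + 1 = q → (A.obj ⊗[K] E.X p →ₗ[A.obj] A.obj ⊗[K] E.X q))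
    (hu : ∀ p q h (b : A.obj ⊗[K] R) z, u p q h (b • z) = b • u p q h z)
    (hr : ∀ p q h z, A.red _ (u p q h z) = dL K E p q (A.red _ z)) :
    ∃ x : (dgla K R E).tens A 1, ∀ p q h, twist x p q h = u p q h := by
  -- The smaller ideal is zero, so the expansion in coordinates is exact.
  obtain ⟨n, w, c, hw, -, hc⟩ := exists_coordinates (K := K) A.𝔪 ⊥
  let F : ∀ p q : ℤ, p + 1 = q → (A.obj ⊗[K] E.X p →ₗ[A.obj] A.obj ⊗[K] E.X q) := fun p q h =>
    u p q h - (dL K E p q).baseChange A.obj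
  have hF : ∀ p q h (b : A.obj ⊗[K] R) z, F p q h (b • z) = b • F p q h z := fun p q h b z => by
    simp only [F, LinearMap.sub_apply, hu, baseChange_dL_smul, smul_sub]
  have hF𝔪 : ∀ p q h z, F p q h z ∈ A.𝔪 • (⊤ : Submodule A.obj (A.obj ⊗[K] E.X q)) := by
    intro p q h z
    rw [← ArtAlg.red_eq_zero_iff, LinearMap.sub_apply, map_sub, hr, ArtAlg.red_baseChange, sub_self]
  have hcr : ∀ (c : A.obj →ₗ[K] K) (p : ℤ) (r : R) (z : A.obj ⊗[K] E.X p),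
      contr _ c (((1 : A.obj) ⊗ₜ[K] r) • z) = r • contr _ c z := by
    intro c p r z
    induction z using TensorProduct.induction_on with
    | zero => simp
    | add z w hz hw => simp only [smul_add, map_add, hz, hw]
    | tmul a' v =>
      rw [tmul_smul_tmul, contr_tmul, contr_tmul, one_mul, smul_comm]
  have hl : ∀ i, ∃ l : (dgla K R E).L 1, ∀ p q h v,
      compL 1 p q h l v = contr _ (c i) (F p q h (1 ⊗ₜ v)) := by
    intro i
    obtain ⟨l, hl⟩ := exists_L_one (K := K) (E := E)
      (fun p q h => contr _ (c i) ∘ₗ (F p q h).restrictScalars K ∘ₗ TensorProduct.mk K A.obj _ 1)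
      (fun p q h r v => by
        have : (1 : A.obj) ⊗ₜ[K] (r • v) = ((1 : A.obj) ⊗ₜ[K] r) • ((1 : A.obj) ⊗ₜ[K] v) := by
          rw [tmul_smul_tmul, one_mul]
        change contr _ (c i) (F p q h (1 ⊗ₜ (r • v))) = r • contr _ (c i) (F p q h (1 ⊗ₜ v))
        rw [this, hF, hcr])
    exact ⟨l, fun p q h v => by rw [hl]; rfl⟩
  choose l hl using hl
  refine ⟨∑ i, l i ⊗ₜ ⟨w i, hw i⟩, fun p q h => ArtAlg.ext_tmul fun v => ?_⟩
  have h1 := hc _ _ (hF𝔪 p q h (1 ⊗ₜ v))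
  rw [Submodule.bot_smul, Submodule.mem_bot, sub_eq_zero] at h1
  have h2 : A.ev (compL 1 p q h) (∑ i, l i ⊗ₜ ⟨w i, hw i⟩) (1 ⊗ₜ v) = F p q h (1 ⊗ₜ v) := by
    rw [h1, map_sum, LinearMap.sum_apply]
    exact Finset.sum_congr rfl fun i _ => by rw [ArtAlg.ev_tmul_tmul, mul_one, hl]
  rw [twist, LinearMap.add_apply, h2]
  simp [F]

end PairDer

/-! ### The gauge action as conjugation by exponentials. -/

section ExponentialGauge
variable (K : Type*) [Field K] [CharZero K]
  {A V W : Type*} [CommRing A] [Algebra K A] [AddCommGroup V] [Module K V]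
  [Module A V] [IsScalarTower K A V] [AddCommGroup W] [Module K W] [Module A W] [IsScalarTower K A W]

/-- Conjugation by exponentials, expressed through iterated commutators. -/
lemma exists_sum_commutator {a : Module.End A V} {b : Module.End A W} (ha : IsNilpotent a)
    (hb : IsNilpotent b) (F : V →ₗ[A] W) (s : ℕ → (V →ₗ[A] W)) (h0 : s 0 = b ∘ₗ F - F ∘ₗ a)
    (hs : ∀ n, s (n + 1) = b ∘ₗ s n - s n ∘ₗ a) :
    ∃ N : ℕ, ∀ n ≥ N, (F + ∑ i ∈ Finset.range n, ((i + 1).factorial : K)⁻¹ • s i) ∘ₗ nexp K a =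
      nexp K b ∘ₗ F := by
  obtain ⟨⟨N, hN⟩, hconj⟩ := nexp_commutatorMap K ha hb
  -- The sequence starts at the first commutator, so `s i` is the power `i + 1` of the commutator
  -- map. This is the origin of the shifted factorials, and `F` itself is the term of index zero.
  have hs' : ∀ i, s i = ((commutatorMap K a b) ^ (i + 1)) F := by
    intro i
    induction i with
    | zero => rw [h0, pow_one, commutatorMap_apply]
    | succ i ih => rw [hs, ih, pow_succ' _ (i + 1), Module.End.mul_apply, commutatorMap_apply]
  refine ⟨N, fun n hn => ?_⟩
  have hn1 : (commutatorMap K a b) ^ (n + 1) = 0 := by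
    obtain ⟨k, rfl⟩ := Nat.exists_eq_add_of_le hn
    rw [add_assoc, pow_add, hN, zero_mul]
  have key : F + ∑ i ∈ Finset.range n, ((i + 1).factorial : K)⁻¹ • s i =
      nexp K (commutatorMap K a b) F := by
    rw [nexp_eq_sum K hn1, Finset.sum_range_succ', LinearMap.add_apply, LinearMap.sum_apply, add_comm]
    congr 1
    · exact Finset.sum_congr rfl fun i _ => by rw [hs']; rfl
    · simp
  rw [key, hconj]
  ext v
  exact congrArg (fun t => nexp K b (F t)) (LinearMap.congr_fun (nexp_neg_mul_nexp K ha) v)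

end ExponentialGauge

namespace PairDer

variable {K : Type u} [Field K] {R : Type u} [CommRing R] [Algebra K R]
  {E : CochainComplex (ModuleCat.{u} R) ℤ} {A : ArtAlg K}

lemma ev_zero_smul (a : (dgla K R E).tens A 0) (p : ℤ) (hp : p + 0 = p) (b : A.obj ⊗[K] R)
    (z : A.obj ⊗[K] E.X p) :
    A.ev (compL 0 p p hp) a (b • z) = b • A.ev (compL 0 p p hp) a z + A.ev (derL 0) a b • z := by
  induction z using TensorProduct.induction_on with
  | zero => simp
  | add z w hz hw => simp only [smul_add, map_add, hz, hw]; abel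
  | tmul a' v =>
    induction b using TensorProduct.induction_on with
    | zero => simp
    | add b c hb hc => simp only [add_smul, map_add, hb, hc]; abel
    | tmul a'' r =>
      induction a using TensorProduct.induction_on with
      | zero => simp
      | add x y hx hy => simp only [map_add, LinearMap.add_apply, hx, hy, smul_add, add_smul]; abel
      | tmul l s =>
        rw [tmul_smul_tmul, ArtAlg.ev_tmul_tmul, ArtAlg.ev_tmul_tmul, tmul_smul_tmul,
          ArtAlg.ev_tmul_tmul, tmul_smul_tmul, compL_smul_zero, TensorProduct.tmul_add]
        congr 2 <;> ring

lemma ev_derL_mul (a : (dgla K R E).tens A 0) (b c : A.obj ⊗[K] R) :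
    A.ev (derL 0) a (b * c) = b * A.ev (derL 0) a c + A.ev (derL 0) a b * c := by
  induction c using TensorProduct.induction_on with
  | zero => simp
  | add z w hz hw => simp only [mul_add, map_add, hz, hw]; abel
  | tmul a' v =>
    induction b using TensorProduct.induction_on with
    | zero => simp
    | add b c hb hc => simp only [add_mul, map_add, hb, hc]; abel
    | tmul a'' r =>
      induction a using TensorProduct.induction_on with
      | zero => simp
      | add x y hx hy => simp only [map_add, LinearMap.add_apply, hx, hy, mul_add, add_mul]; abel
      | tmul l s =>
        rw [Algebra.TensorProduct.tmul_mul_tmul, ArtAlg.ev_tmul_tmul, ArtAlg.ev_tmul_tmul,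
          Algebra.TensorProduct.tmul_mul_tmul, ArtAlg.ev_tmul_tmul,
          Algebra.TensorProduct.tmul_mul_tmul, derL_mul, TensorProduct.tmul_add]
        congr 2 <;> ring

/-- The automorphism of `A ⊗ E^p` given by the exponential of an element of `D^0 ⊗ 𝔪`. -/
noncomputable def autE [CharZero K] (a : (dgla K R E).tens A 0) (p : ℤ) :
    Module.End A.obj (A.obj ⊗[K] E.X p) :=
  nexp K (A.ev (compL 0 p p (add_zero p)) a : Module.End A.obj (A.obj ⊗[K] E.X p))

/-- The automorphism of `A ⊗ R` given by the exponential of an element of `D^0 ⊗ 𝔪`. -/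
noncomputable def autR [CharZero K] (a : (dgla K R E).tens A 0) :
    Module.End A.obj (A.obj ⊗[K] R) :=
  nexp K (A.ev (derL 0) a : Module.End A.obj (A.obj ⊗[K] R))

variable [CharZero K]

lemma autE_neg_autE (a : (dgla K R E).tens A 0) (p : ℤ) (z : A.obj ⊗[K] E.X p) :
    autE (-a) p (autE a p z) = z := by
  have := nexp_neg_mul_nexp K (S := Module.End A.obj (A.obj ⊗[K] E.X p))
    (ArtAlg.isNilpotent_ev (compL 0 p p (add_zero p)) a)
  have h := LinearMap.congr_fun this z
  rw [autE, autE, map_neg]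
  exact h

lemma autR_neg_autR (a : (dgla K R E).tens A 0) (z : A.obj ⊗[K] R) :
    autR (-a) (autR a z) = z := by
  have := nexp_neg_mul_nexp K (S := Module.End A.obj (A.obj ⊗[K] R))
    (ArtAlg.isNilpotent_ev (derL 0) a)
  have h := LinearMap.congr_fun this z
  rw [autR, autR, map_neg]
  exact h

/-- Exponentiation of the Leibniz rule, which says that the commutator with multiplication by `b` is
multiplication by the derivative of `b`. -/
lemma autE_smul (a : (dgla K R E).tens A 0) (p : ℤ) (b : A.obj ⊗[K] R) (z : A.obj ⊗[K] E.X p) :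
    autE a p (b • z) = autR a b • autE a p z := by
  have h := nexp_comp_of_commutator K (ArtAlg.isNilpotent_ev (compL 0 p p (add_zero p)) a)
    (ArtAlg.isNilpotent_ev (derL 0) a) (tensorAct K A.obj (E.X p)).toLinearMap (fun b => by
      refine LinearMap.ext fun z => ?_
      change A.ev (compL 0 p p _) a (b • z) - b • A.ev (compL 0 p p _) a z = A.ev (derL 0) a b • z
      rw [ev_zero_smul, add_sub_cancel_left]) b
  exact LinearMap.congr_fun h z

/-- The same argument for `A ⊗ R` acting on itself: the exponential of a nilpotent derivation is
multiplicative. -/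
lemma autR_mul (a : (dgla K R E).tens A 0) (b c : A.obj ⊗[K] R) :
    autR a (b * c) = autR a b * autR a c := by
  have h := nexp_comp_of_commutator K (ArtAlg.isNilpotent_ev (derL 0) a)
    (ArtAlg.isNilpotent_ev (derL 0) a) (LinearMap.mul A.obj (A.obj ⊗[K] R)) (fun b => by
      refine LinearMap.ext fun z => ?_
      change A.ev (derL 0) a (b * z) - b * A.ev (derL 0) a z = A.ev (derL 0) a b * z
      rw [ev_derL_mul, add_sub_cancel_left]) b
  exact LinearMap.congr_fun h c

lemma autR_one (a : (dgla K R E).tens A 0) : autR a 1 = 1 := by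
  -- Multiplicativity and invertibility suffice: this makes `autR (-a)` fix `1`, and its inverse
  -- then does too.
  have h := autR_mul (-a) 1 (autR a 1)
  rw [autR_neg_autR, one_mul, autR_neg_autR, mul_one] at h
  have := autR_neg_autR (-a) 1
  rw [neg_neg, ← h] at this
  exact this

/-- The automorphism of `A ⊗ R` as a homomorphism of algebras. -/
noncomputable def autAlg (a : (dgla K R E).tens A 0) : A.obj ⊗[K] R →ₐ[A.obj] A.obj ⊗[K] R :=
  AlgHom.ofLinearMap (autR a) (autR_one a) (autR_mul a)

lemma red_autE (a : (dgla K R E).tens A 0) (p : ℤ) (z : A.obj ⊗[K] E.X p) :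
    A.red _ (autE a p z) = A.red _ z := by
  have h := ArtAlg.nexp_sub_mem (A.ev (compL 0 p p (add_zero p)) a :
    Module.End A.obj (A.obj ⊗[K] E.X p)) (fun _ _ => ArtAlg.ev_mem _ a) A.𝔪 A.𝔪 Ideal.mul_le_left
    (ArtAlg.ev_mem_𝔪 _ a) z
  refine ArtAlg.red_eq_of_sub_mem ?_
  have h' := add_mem h (ArtAlg.ev_mem_𝔪 (compL 0 p p (add_zero p)) a z)
  rwa [sub_add_cancel] at h'

lemma red_autR (a : (dgla K R E).tens A 0) (z : A.obj ⊗[K] R) :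
    A.red _ (autR a z) = A.red _ z := by
  have h := ArtAlg.nexp_sub_mem (A.ev (derL 0) a :
    Module.End A.obj (A.obj ⊗[K] R)) (fun _ _ => ArtAlg.ev_mem _ a) A.𝔪 A.𝔪 Ideal.mul_le_left
    (ArtAlg.ev_mem_𝔪 _ a) z
  refine ArtAlg.red_eq_of_sub_mem ?_
  have h' := add_mem h (ArtAlg.ev_mem_𝔪 (derL 0) a z)
  rwa [sub_add_cancel] at h'

/-- The gauge action conjugates the twisted differential. -/
lemma twist_gauge (a : (dgla K R E).tens A 0) (x : (dgla K R E).tens A 1) (p q : ℤ) (hpq : p + 1 = q)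
    (z : A.obj ⊗[K] E.X p) :
    twist ((dgla K R E).gauge A a x) p q hpq (autE a p z) = autE a q (twist x p q hpq z) := by
  let e := A.ev (compL (K := K) (R := R) (E := E) 1 p q hpq)
  let w := (dgla K R E).adT A a x - (dgla K R E).dT A 0 1 rfl a
  have had : ∀ y, e ((dgla K R E).adT A a y) =
      A.ev (compL 0 q q (add_zero q)) a ∘ₗ e y - e y ∘ₗ A.ev (compL 0 p p (add_zero p)) a :=
    fun y => ev_bracketT_zero a y p q hpq
  -- The term `[a, x] - da` is the commutator of `a` with the whole twisted differential `d + x`.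
  -- Since `d` itself is not in `D¹ ⊗ 𝔪`, the gauge formula begins with this term, and the remaining
  -- commutators stay inside `D¹ ⊗ 𝔪`.
  have hw : e w = A.ev (compL 0 q q (add_zero q)) a ∘ₗ twist x p q hpq -
      twist x p q hpq ∘ₗ A.ev (compL 0 p p (add_zero p)) a := by
    have hd : e ((dgla K R E).dT A 0 1 rfl a) = _ := ev_dT_zero a p q hpq
    rw [map_sub, had, hd, twist, LinearMap.comp_add, LinearMap.add_comp]
    abel
  obtain ⟨N, hN⟩ := exists_sum_commutator K (ArtAlg.isNilpotent_ev (compL 0 p p (add_zero p)) a)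
    (ArtAlg.isNilpotent_ev (compL 0 q q (add_zero q)) a) (twist x p q hpq)
    (fun n => e (((dgla K R E).adT A a ^ n) w)) hw
    (fun n => by rw [pow_succ', Module.End.mul_apply, had])
  obtain ⟨N', hN'⟩ := (dgla K R E).exists_adT_pow_eq_zero A a
  have hsum : (dgla K R E).gauge A a x = x + ∑ n ∈ Finset.range (N + N'),
      ((n + 1).factorial : K)⁻¹ • ((dgla K R E).adT A a ^ n) w := by
    rw [DGLieAlgebra.gauge]
    congr 1
    refine finsum_eq_sum_of_support_subset _ fun n hn => ?_
    by_contra h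
    simp only [Finset.coe_range, Set.mem_Iio, not_lt] at h
    exact hn (by simp [hN' n (by omega)])
  have key : twist ((dgla K R E).gauge A a x) p q hpq = twist x p q hpq +
      ∑ n ∈ Finset.range (N + N'), ((n + 1).factorial : K)⁻¹ • e (((dgla K R E).adT A a ^ n) w) := by
    have h1 : twist ((dgla K R E).gauge A a x) p q hpq = twist x p q hpq +
        (e ((dgla K R E).gauge A a x) - e x) := by
      simp only [twist, e]; abel
    rw [h1, hsum, map_add, map_sum]
    simp only [map_smul]
    abel
  rw [key]
  exact LinearMap.congr_fun (hN (N + N') (by omega)) z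

/-- The gauge action on Maurer-Cartan elements. -/
lemma gauge_mem (a : (dgla K R E).tens A 0) (x : (dgla K R E).MC A) :
    ∃ y : (dgla K R E).MC A, y.1 = (dgla K R E).gauge A a x.1 := by
  refine ⟨⟨(dgla K R E).gauge A a x.1, (mc_iff _).2 fun p q r hpq hqr => LinearMap.ext fun z => ?_⟩, rfl⟩
  -- Every `z` is in the image of the automorphism, and on that image the new differential is the
  -- conjugate of the old one.
  have hz := autE_neg_autE (-a) p z
  rw [neg_neg] at hz
  rw [← hz, LinearMap.comp_apply, twist_gauge, twist_gauge]
  have := LinearMap.congr_fun ((mc_iff _).1 x.2 p q r hpq hqr) (autE (-a) p z)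
  rw [LinearMap.comp_apply] at this
  rw [this]
  simp

/-- A semilinear automorphism of `(A ⊗ R, A ⊗ E)` which is the identity modulo `J` is, modulo
`𝔪 J`, the exponential of an element of `D^0 ⊗ 𝔪`. -/
lemma exists_autE (J : Ideal A.obj) (hJ : J ≤ A.𝔪) (φ : A.obj ⊗[K] R →ₐ[A.obj] A.obj ⊗[K] R)
    (G : ∀ p : ℤ, A.obj ⊗[K] E.X p →ₗ[A.obj] A.obj ⊗[K] E.X p)
    (hG : ∀ p b z, G p (b • z) = φ b • G p z)
    (hφJ : ∀ b, φ b - b ∈ J • (⊤ : Submodule A.obj (A.obj ⊗[K] R)))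
    (hGJ : ∀ p z, G p z - z ∈ J • (⊤ : Submodule A.obj (A.obj ⊗[K] E.X p))) :
    ∃ a : (dgla K R E).tens A 0,
      (∀ b, autR a (φ b) - b ∈ (A.𝔪 * J) • (⊤ : Submodule A.obj (A.obj ⊗[K] R))) ∧
      ∀ p z, autE a p (G p z) - z ∈ (A.𝔪 * J) • (⊤ : Submodule A.obj (A.obj ⊗[K] E.X p)) := by
  -- The logarithm is only needed to first order: `φ - 1` and `G - 1` are expanded in coordinates of
  -- `J` modulo `𝔪 J`.
  obtain ⟨n, w, c, hw, hc0, hc⟩ := exists_coordinates (K := K) J (A.𝔪 * J)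
  let h : Fin n → R →ₗ[K] R := fun i => contr R (c i) ∘ₗ
    ((φ.toLinearMap - LinearMap.id : A.obj ⊗[K] R →ₗ[A.obj] _).restrictScalars K) ∘ₗ
      TensorProduct.mk K A.obj _ 1
  let g : Fin n → ∀ p : ℤ, E.X p →ₗ[K] E.X p := fun i p => contr (E.X p) (c i) ∘ₗ
    ((G p - LinearMap.id : A.obj ⊗[K] E.X p →ₗ[A.obj] _).restrictScalars K) ∘ₗ
      TensorProduct.mk K A.obj _ 1
  have hh : ∀ i r, h i r = contr R (c i) (φ (1 ⊗ₜ r) - 1 ⊗ₜ r) := fun i r => rfl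
  have hg : ∀ i p v, g i p v = contr (E.X p) (c i) (G p (1 ⊗ₜ v) - 1 ⊗ₜ v) := fun i p r => rfl
  have cR : ∀ i r (z : A.obj ⊗[K] R), contr R (c i) (((1 : A.obj) ⊗ₜ[K] r) * z) =
      r * contr R (c i) z := by
    intro i r z
    induction z using TensorProduct.induction_on with
    | zero => simp
    | add z w hz hw => simp only [mul_add, map_add, hz, hw]
    | tmul a' v => simp
  have cE : ∀ i (p : ℤ) (r : R) (z : A.obj ⊗[K] E.X p), contr _ (c i) (((1 : A.obj) ⊗ₜ[K] r) • z) =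
      r • contr _ (c i) z := by
    intro i p r z
    induction z using TensorProduct.induction_on with
    | zero => simp
    | add z w hz hw => simp only [smul_add, map_add, hz, hw]
    | tmul a' v => rw [tmul_smul_tmul, contr_tmul, contr_tmul, one_mul, smul_comm]
  have cE' : ∀ i (p : ℤ) (z : A.obj ⊗[K] R) (v : E.X p), contr _ (c i) (z • ((1 : A.obj) ⊗ₜ[K] v)) =
      contr _ (c i) z • v := by
    intro i p z v
    induction z using TensorProduct.induction_on with
    | zero => simp
    | add z w hz hw => simp only [add_smul, map_add, hz, hw]
    | tmul a' r => rw [tmul_smul_tmul, contr_tmul, contr_tmul, mul_one, smul_assoc]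
  have cR' : ∀ i (z : A.obj ⊗[K] R) (v : R), contr _ (c i) (z * ((1 : A.obj) ⊗ₜ[K] v)) =
      v * contr _ (c i) z := by
    intro i z v
    rw [mul_comm, cR]
  have smul_mem : ∀ {p : ℤ} {y : A.obj ⊗[K] R} {t : A.obj ⊗[K] E.X p},
      y ∈ J • (⊤ : Submodule A.obj (A.obj ⊗[K] R)) →
      t ∈ J • (⊤ : Submodule A.obj (A.obj ⊗[K] E.X p)) →
      y • t ∈ (A.𝔪 * J) • (⊤ : Submodule A.obj (A.obj ⊗[K] E.X p)) := by
    intro p y t hy ht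
    rw [Submodule.mul_smul]
    refine Submodule.smul_induction_on hy (fun a ha y _ => ?_) fun x y hx hy => ?_
    · rw [smul_assoc]
      refine Submodule.smul_mem_smul (hJ ha) ?_
      refine Submodule.smul_induction_on ht (fun a ha t _ => ?_) fun x y hx hy => ?_
      · rw [smul_comm]
        exact Submodule.smul_mem_smul ha Submodule.mem_top
      · rw [smul_add]; exact add_mem hx hy
    · rw [add_smul]; exact add_mem hx hy
  have mul_mem : ∀ {y t : A.obj ⊗[K] R},
      y ∈ J • (⊤ : Submodule A.obj (A.obj ⊗[K] R)) →
      t ∈ J • (⊤ : Submodule A.obj (A.obj ⊗[K] R)) →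
      y * t ∈ (A.𝔪 * J) • (⊤ : Submodule A.obj (A.obj ⊗[K] R)) := by
    intro y t hy ht
    rw [Submodule.mul_smul]
    refine Submodule.smul_induction_on hy (fun a ha y _ => ?_) fun x y hx hy => ?_
    · rw [smul_mul_assoc]
      refine Submodule.smul_mem_smul (hJ ha) ?_
      refine Submodule.smul_induction_on ht (fun a ha t _ => ?_) fun x y hx hy => ?_
      · rw [mul_smul_comm]
        exact Submodule.smul_mem_smul ha Submodule.mem_top
      · rw [mul_add]; exact add_mem hx hy
    · rw [add_mul]; exact add_mem hx hy
  -- The defect of the Leibniz rule for `φ - 1` and `G - 1` is a product of two terms in `J`, hence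
  -- in `J² ⊆ 𝔪 J`, where the coordinates vanish. So the coordinates form a derivation of the pair.
  have hl : ∀ i, ∃ l : (dgla K R E).L 0, derL 0 l = h i ∧ ∀ p hp, compL 0 p p hp l = g i p := by
    intro i
    refine exists_L_zero (h i) (fun r s => ?_) (g i) fun p r v => ?_
    · have e : φ (1 ⊗ₜ (r * s)) - 1 ⊗ₜ (r * s) =
          (φ (1 ⊗ₜ r) - 1 ⊗ₜ r) * (φ (1 ⊗ₜ s) - 1 ⊗ₜ s) +
          ((1 ⊗ₜ r) * (φ (1 ⊗ₜ s) - 1 ⊗ₜ s) + (φ (1 ⊗ₜ r) - 1 ⊗ₜ r) * (1 ⊗ₜ s)) := by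
        have : (1 : A.obj) ⊗ₜ[K] (r * s) = (1 ⊗ₜ r) * (1 ⊗ₜ s) := by simp
        rw [this, map_mul]; ring
      rw [hh, e, map_add, contr_eq_zero_of_mem (hc0 i) (mul_mem (hφJ _) (hφJ _)), zero_add, map_add,
        cR, cR', hh, hh]
    · have e : G p (1 ⊗ₜ (r • v)) - 1 ⊗ₜ (r • v) =
          (φ (1 ⊗ₜ r) - 1 ⊗ₜ r) • (G p (1 ⊗ₜ v) - 1 ⊗ₜ v) +
          (((1 : A.obj) ⊗ₜ[K] r) • (G p (1 ⊗ₜ v) - 1 ⊗ₜ v) +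
            (φ (1 ⊗ₜ r) - 1 ⊗ₜ r) • ((1 : A.obj) ⊗ₜ[K] v)) := by
        have : (1 : A.obj) ⊗ₜ[K] (r • v) = ((1 : A.obj) ⊗ₜ[K] r) • ((1 : A.obj) ⊗ₜ[K] v) := by
          rw [tmul_smul_tmul, one_mul]
        rw [this, hG]
        simp only [sub_smul, smul_sub]
        abel
      rw [hg, e, map_add, contr_eq_zero_of_mem (hc0 i) (smul_mem (hφJ _) (hGJ _ _)), zero_add,
        map_add, cE, cE', hg, hh]
  choose l hlh hlg using hl
  let a : (dgla K R E).tens A 0 := ∑ i, l i ⊗ₜ ⟨w i, hJ (hw i)⟩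
  -- the general step, for the components in `R` and in `E`
  have step : ∀ {V : Type u} [AddCommGroup V] [Module K V] (ψ : (dgla K R E).L 0 →ₗ[K] V →ₗ[K] V)
      (F : A.obj ⊗[K] V →ₗ[A.obj] A.obj ⊗[K] V)
      (_ : ∀ z, F z - z ∈ J • (⊤ : Submodule A.obj (A.obj ⊗[K] V)))
      (_ : ∀ i v, ψ (l i) v = contr V (c i) (F (1 ⊗ₜ v) - 1 ⊗ₜ v)) (z : A.obj ⊗[K] V),
      nexp K (A.ev ψ (-a) : Module.End A.obj (A.obj ⊗[K] V)) (F z) - z ∈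
        (A.𝔪 * J) • (⊤ : Submodule A.obj (A.obj ⊗[K] V)) := by
    intro V _ _ ψ F hF hψ z
    have haJ : ∀ z, A.ev ψ a z ∈ J • (⊤ : Submodule A.obj (A.obj ⊗[K] V)) := by
      intro z
      simp only [a, map_sum, LinearMap.sum_apply]
      refine Submodule.sum_mem _ fun i _ => ?_
      rw [ArtAlg.ev_tmul, LinearMap.smul_apply]
      exact Submodule.smul_mem_smul (hw i) Submodule.mem_top
    have h1 : ∀ z, F z - z - A.ev ψ a z ∈ (A.𝔪 * J) • (⊤ : Submodule A.obj (A.obj ⊗[K] V)) := by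
      intro z
      induction z using TensorProduct.induction_on with
      | zero => simp
      | add x y hx hy =>
        convert add_mem hx hy using 1
        simp only [map_add]; abel
      | tmul s v =>
        have e : s ⊗ₜ[K] v = s • ((1 : A.obj) ⊗ₜ[K] v) := by simp [TensorProduct.smul_tmul']
        have e' : ∀ t : A.obj ⊗[K] V, F (s • t) - s • t - A.ev ψ a (s • t) =
            s • (F t - t - A.ev ψ a t) := fun t => by
          rw [map_smul F, map_smul (A.ev ψ a)]; module
        rw [e, e']
        refine Submodule.smul_mem _ _ ?_
        have := hc V _ (hF (1 ⊗ₜ v))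
        convert this using 2
        simp only [a, map_sum, LinearMap.sum_apply]
        refine Finset.sum_congr rfl fun i _ => ?_
        rw [ArtAlg.ev_tmul_tmul, mul_one, hψ]
    -- Modulo `𝔪 J`, the exponential of `-a` sends `F z` to `F z - a (F z)`. Here `a (F z)` agrees
    -- with `a z`, because `F z - z` lies in `J`, and `F z - a z` agrees with `z` by `h1`.
    have h2 := ArtAlg.nexp_sub_mem (A.ev ψ (-a) : Module.End A.obj (A.obj ⊗[K] V))
      (fun _ _ => ArtAlg.ev_mem ψ (-a)) J (A.𝔪 * J) le_rfl (fun z => by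
        rw [map_neg]; exact neg_mem (haJ z)) (F z)
    have h3 := ArtAlg.ev_mem ψ a (hF z)
    have h4 := sub_mem (add_mem h2 (h1 z)) h3
    convert h4 using 1
    rw [map_neg (A.ev ψ), LinearMap.neg_apply, map_sub (A.ev ψ a)]
    abel
  refine ⟨-a, fun b => ?_, fun p z => ?_⟩
  · exact step (derL 0) φ.toLinearMap hφJ (fun i v => by rw [hlh]; rfl) b
  · exact step (compL 0 p p (add_zero p)) (G p) (hGJ p) (fun i v => by rw [hlg]; rfl) z

/-- Maurer-Cartan elements whose twisted complexes are isomorphic, by an isomorphism which is the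
identity modulo `𝔪`, are gauge equivalent. -/
lemma quot_eq_of_semilinear (x y : (dgla K R E).MC A) (φ : A.obj ⊗[K] R →ₐ[A.obj] A.obj ⊗[K] R)
    (G : ∀ p : ℤ, A.obj ⊗[K] E.X p →ₗ[A.obj] A.obj ⊗[K] E.X p)
    (hG : ∀ p b z, G p (b • z) = φ b • G p z)
    (hφr : ∀ b, A.red _ (φ b) = A.red _ b) (hGr : ∀ p z, A.red _ (G p z) = A.red _ z)
    (hc : ∀ p q hpq z, twist y.1 p q hpq (G p z) = G q (twist x.1 p q hpq z)) :
    (Quot.mk _ x : Quot ((dgla K R E).GaugeRel A)) = Quot.mk _ y := by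
  obtain ⟨n, hn⟩ := A.isNilpotent_𝔪
  -- Descent on the distance `k` from `j` to `n`: if the isomorphism is the identity modulo `𝔪^j`,
  -- composing it with an exponential and replacing `y` by a gauge equivalent element makes it the
  -- identity modulo `𝔪^(j+1)`. At `j = n` the isomorphism is the identity and the twisted
  -- differentials agree.
  have key : ∀ k, ∀ (j : ℕ), j + k = n → 0 < j → ∀ (y : (dgla K R E).MC A)
      (φ : A.obj ⊗[K] R →ₐ[A.obj] A.obj ⊗[K] R)
      (G : ∀ p : ℤ, A.obj ⊗[K] E.X p →ₗ[A.obj] A.obj ⊗[K] E.X p),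
      (∀ p b z, G p (b • z) = φ b • G p z) →
      (∀ b, φ b - b ∈ (A.𝔪 ^ j) • (⊤ : Submodule A.obj (A.obj ⊗[K] R))) →
      (∀ p z, G p z - z ∈ (A.𝔪 ^ j) • (⊤ : Submodule A.obj (A.obj ⊗[K] E.X p))) →
      (∀ p q hpq z, twist y.1 p q hpq (G p z) = G q (twist x.1 p q hpq z)) →
      (Quot.mk _ x : Quot ((dgla K R E).GaugeRel A)) = Quot.mk _ y := by
    intro k
    induction k with
    | zero =>
      intro j hj _ y φ G _ _ hGJ hc
      obtain rfl : j = n := by omega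
      have hG1 : ∀ p z, G p z = z := fun p z => by
        have := hGJ p z
        rw [hn] at this
        simpa [sub_eq_zero] using this
      have : x = y := Subtype.ext (twist_injective fun p q hpq => LinearMap.ext fun z => by
        have := hc p q hpq z
        rw [hG1, hG1] at this
        exact this.symm)
      rw [this]
    | succ k ih =>
      intro j hj hj0 y φ G hG hφJ hGJ hc
      obtain ⟨a, ha, ha'⟩ := exists_autE (A.𝔪 ^ j) (Ideal.pow_le_self hj0.ne') φ G hG hφJ hGJ
      obtain ⟨y', hy'⟩ := gauge_mem a y
      rw [← pow_succ'] at ha ha'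
      have h1 := ih (j + 1) (by omega) (by omega) y' ((autAlg a).comp φ)
        (fun p => autE a p ∘ₗ G p) (fun p b z => by
          rw [LinearMap.comp_apply, hG, autE_smul]; rfl) ha ha' (fun p q hpq z => by
          rw [hy', LinearMap.comp_apply, twist_gauge, hc]; rfl)
      exact h1.trans (Quot.sound ⟨a, hy'.symm⟩).symm
  have mem : ∀ {V : Type u} [AddCommGroup V] [Module K V] {z w : A.obj ⊗[K] V},
      A.red V z = A.red V w → z - w ∈ (A.𝔪 ^ 1) • (⊤ : Submodule A.obj (A.obj ⊗[K] V)) := by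
    intro V _ _ z w h
    rw [pow_one, ← ArtAlg.red_eq_zero_iff, map_sub, h, sub_self]
  -- The descent starts at `j = 1`, so `n` must be positive; `𝔪^0 = 0` would make `A` trivial.
  have hn0 : n ≠ 0 := by
    rintro rfl
    rw [pow_zero] at hn
    exact (Ideal.ne_top_iff_one _).1 (bot_ne_top (α := Ideal A.obj))
      (by rw [← Ideal.zero_eq_bot, ← hn]; simp)
  exact key (n - 1) 1 (by omega) one_pos y φ G hG (fun b => mem (hφr b))
    (fun p z => mem (hGr p z)) hc

end PairDer

/-! ### Reduction as an algebra map, and lifting out of projective modules. -/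

namespace ArtAlg
variable {K : Type u} [Field K] (A : ArtAlg K)

/-- Reduction modulo the maximal ideal of `A`, as a homomorphism of algebras. -/
noncomputable def redHom (R : Type u) [CommRing R] [Algebra K R] : A.obj ⊗[K] R →ₐ[K] R :=
  Algebra.TensorProduct.lift ((Algebra.ofId K R).comp A.residue) (AlgHom.id K R)
    fun _ _ => .all _ _

variable {A} {R : Type u} [CommRing R] [Algebra K R]

lemma redHom_tmul (a : A.obj) (r : R) : A.redHom R (a ⊗ₜ r) = A.residue a • r := by
  simp [redHom, Algebra.ofId_apply, Algebra.smul_def]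

lemma redHom_apply (b : A.obj ⊗[K] R) : A.redHom R b = A.red R b := by
  induction b using TensorProduct.induction_on with
  | zero => simp
  | add x y hx hy => simp only [map_add, hx, hy]
  | tmul a v => rw [redHom_tmul, contr_tmul]; rfl

lemma redHom_smul (a : A.obj) (b : A.obj ⊗[K] R) : A.redHom R (a • b) = A.residue a • A.redHom R b := by
  rw [redHom_apply, redHom_apply, red_smul]

instance (A : ArtAlg K) : A.𝔪.IsMaximal := IsLocalRing.maximalIdeal.isMaximal A.obj

end ArtAlg

/-- Lifting along relations out of a projective module. -/
lemma Module.Projective.exists_semilinear {R B P Q : Type*} [CommRing R] [CommRing B]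
    [AddCommGroup P] [Module R P] [Module.Projective R P] [AddCommGroup Q] [Module B Q] (ρ : R →+* B)
    (S : P → Q → Prop) (hadd : ∀ v q v' q', S v q → S v' q' → S (v + v') (q + q'))
    (hsmul : ∀ (r : R) v q, S v q → S (r • v) (ρ r • q)) (hS : ∀ v, ∃ q, S v q) :
    ∃ G : P →ₛₗ[ρ] Q, ∀ v, S v (G v) := by
  let _ : Module R Q := Module.compHom Q ρ
  -- The relation is a submodule of `P × Q` surjecting onto `P`; a section exists by projectivity,
  -- and its second component is the lift.
  let T : Submodule R (P × Q) :=
    { carrier := {z | S z.1 z.2}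
      add_mem' := fun hz hw => hadd _ _ _ _ hz hw
      zero_mem' := by
        obtain ⟨q, hq⟩ := hS 0
        have := hsmul 0 0 q hq
        simpa using this
      smul_mem' := fun r z hz => hsmul r _ _ hz }
  obtain ⟨f, hf⟩ := Module.projective_lifting_property (LinearMap.fst R P Q ∘ₗ T.subtype) LinearMap.id
    fun v => by
      obtain ⟨q, hq⟩ := hS v
      exact ⟨⟨(v, q), hq⟩, rfl⟩
  let g : P →ₗ[R] Q := LinearMap.snd R P Q ∘ₗ T.subtype ∘ₗ f
  refine ⟨{ toFun := g, map_add' := g.map_add, map_smul' := fun r v => g.map_smul r v }, fun v => ?_⟩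
  have h1 : (f v).1.1 = v := LinearMap.congr_fun hf v
  have h2 : S (f v).1.1 (f v).1.2 := (f v).2
  rw [h1] at h2
  exact h2

/-! ### The cokernel of the twisted differential. -/

namespace PairDer

variable {K : Type u} [Field K] {R : Type u} [CommRing R] [Algebra K R]
  {E : CochainComplex (ModuleCat.{u} R) ℤ} {M : Type u} [AddCommGroup M] [Module R M]

/-- The complex `E` is a bounded projective resolution of `M`. -/
structure IsResolution (E : CochainComplex (ModuleCat.{u} R) ℤ) (ε : E.X 0 →ₗ[R] M) : Prop where
  projective : ∀ i, Module.Projective R (E.X i)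
  bounded : ∃ m : ℕ, ∀ i : ℤ, i < -(m : ℤ) → Subsingleton (E.X i)
  subsingleton_of_pos : ∀ i : ℤ, 0 < i → Subsingleton (E.X i)
  surjective : Function.Surjective ε
  exact_zero : Function.Exact (E.d (-1) 0).hom ε
  exact_neg : ∀ i : ℤ, i < 0 → Function.Exact (E.d (i - 1) i).hom (E.d i (i + 1)).hom

lemma IsResolution.exists_dL_eq {ε : E.X 0 →ₗ[R] M} (h : IsResolution E ε) {p q r : ℤ}
    (hpq : p + 1 = q) (hqr : q + 1 = r) (hq : q < 0) (v : E.X q) (hv : dL K E q r v = 0) :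
    ∃ w, dL K E p q w = v := by
  obtain rfl : p = q - 1 := by omega
  obtain rfl : r = q + 1 := by omega
  exact (h.exact_neg q hq v).1 hv

lemma IsResolution.exists_dL_eq_zero {ε : E.X 0 →ₗ[R] M} (h : IsResolution E ε) (v : E.X 0)
    (hv : ε v = 0) : ∃ w, dL K E (-1) 0 w = v :=
  (h.exact_zero v).1 hv

lemma IsResolution.apply_dL {ε : E.X 0 →ₗ[R] M} (h : IsResolution E ε) (v : E.X (-1)) :
    ε (dL K E (-1) 0 v) = 0 := h.exact_zero.apply_apply_eq_zero v

variable {A : ArtAlg K}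

lemma subsingleton_tensor {p : ℤ} (h : Subsingleton (E.X p)) : Subsingleton (A.obj ⊗[K] E.X p) :=
  ⟨fun x y => by
    have : ∀ z : A.obj ⊗[K] E.X p, z = 0 := fun z => by
      induction z using TensorProduct.induction_on with
      | zero => rfl
      | add x y hx hy => rw [hx, hy, add_zero]
      | tmul a v => rw [Subsingleton.elim v 0, TensorProduct.tmul_zero]
    rw [this x, this y]⟩

lemma red_smul_tensor (p : ℤ) (b : A.obj ⊗[K] R) (z : A.obj ⊗[K] E.X p) :
    A.red _ (b • z) = A.redHom R b • A.red _ z := by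
  induction z using TensorProduct.induction_on with
  | zero => simp
  | add z w hz hw => simp only [smul_add, map_add, hz, hw]
  | tmul a' v =>
    induction b using TensorProduct.induction_on with
    | zero => simp
    | add b c hb hc => simp only [add_smul, map_add, hb, hc]
    | tmul a r =>
      rw [tmul_smul_tmul, contr_tmul, contr_tmul, ArtAlg.redHom_tmul]
      change A.residue (a * a') • (r • v) = (A.residue a • r) • A.residue a' • v
      rw [map_mul, mul_smul, smul_assoc, smul_comm r]

/-- Semilinear maps out of `A ⊗ E^p` exist when they exist pointwise. -/
lemma exists_semilinear_tensor {p : ℤ} [Module.Projective R (E.X p)] {Q : Type u} [AddCommGroup Q]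
    [Module (A.obj ⊗[K] R) Q] [Module A.obj Q] [IsScalarTower A.obj (A.obj ⊗[K] R) Q]
    (φ : A.obj ⊗[K] R →ₐ[A.obj] A.obj ⊗[K] R) (S : E.X p → Q → Prop)
    (hadd : ∀ v q v' q', S v q → S v' q' → S (v + v') (q + q'))
    (hsmul : ∀ (r : R) v q, S v q → S (r • v) (φ (1 ⊗ₜ r) • q)) (hS : ∀ v, ∃ q, S v q) :
    ∃ G : A.obj ⊗[K] E.X p →ₗ[A.obj] Q, (∀ b z, G (b • z) = φ b • G z) ∧ ∀ v, S v (G (1 ⊗ₜ v)) := by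
  let ρ : R →+* A.obj ⊗[K] R :=
    φ.toRingHom.comp (Algebra.TensorProduct.includeRight : R →ₐ[K] A.obj ⊗[K] R).toRingHom
  obtain ⟨g, hg⟩ := Module.Projective.exists_semilinear ρ S hadd hsmul hS
  have hgr : ∀ (r : R) v, g (r • v) = φ (1 ⊗ₜ r) • g v := fun r v => g.map_smulₛₗ r v
  let _ : Module K Q := Module.compHom Q (algebraMap K A.obj)
  have : IsScalarTower K A.obj Q := ⟨fun k a q => by rw [Algebra.smul_def, mul_smul]; rfl⟩
  let g' : E.X p →ₗ[K] Q :=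
    { toFun := g
      map_add' := g.map_add
      map_smul' := fun k v => by
        have h1 : k • v = algebraMap K R k • v := rfl
        have h2 : (1 : A.obj) ⊗ₜ[K] algebraMap K R k = algebraMap K A.obj k • 1 := by
          rw [Algebra.algebraMap_eq_smul_one, TensorProduct.tmul_smul, algebraMap_smul]; rfl
        change g (k • v) = algebraMap K A.obj k • g v
        rw [h1, hgr, h2, map_smul, map_one, smul_assoc, one_smul] }
  let G : A.obj ⊗[K] E.X p →ₗ[A.obj] Q :=
    TensorProduct.AlgebraTensorModule.lift (LinearMap.toSpanSingleton A.obj _ g')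
  have hG : ∀ a v, G (a ⊗ₜ v) = a • g v := fun a v => rfl
  refine ⟨G, fun b z => ?_, fun v => by rw [hG, one_smul]; exact hg v⟩
  induction z using TensorProduct.induction_on with
  | zero => simp
  | add z w hz hw => simp only [smul_add, map_add, hz, hw]
  | tmul a' v =>
    induction b using TensorProduct.induction_on with
    | zero => simp
    | add b c hb hc => simp only [add_smul, map_add, hb, hc]
    | tmul a r =>
      have : a ⊗ₜ[K] r = a • ((1 : A.obj) ⊗ₜ[K] r) := by simp [TensorProduct.smul_tmul']
      rw [tmul_smul_tmul, hG, hgr, hG, this, map_smul, smul_assoc, mul_smul]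
      congr 1
      rw [← smul_one_smul (A.obj ⊗[K] R) a' (g v), ← smul_one_smul (A.obj ⊗[K] R) a' (φ _ • g v),
        smul_smul, smul_smul, mul_comm]

/-- The twisted differential as a map of modules over `A ⊗ R`. -/
noncomputable def twistB (x : (dgla K R E).tens A 1) (p q : ℤ) (h : p + 1 = q) :
    A.obj ⊗[K] E.X p →ₗ[A.obj ⊗[K] R] A.obj ⊗[K] E.X q where
  toFun := twist x p q h
  map_add' := map_add _
  map_smul' := twist_smul x p q h

/-- The cokernel of the twisted differential in degree zero. -/
abbrev Coker (x : (dgla K R E).tens A 1) : Type u :=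
  (A.obj ⊗[K] E.X 0) ⧸ LinearMap.range (twistB x (-1) 0 (neg_add_cancel 1))

/-- The projection onto the cokernel. -/
noncomputable def cokerMk (x : (dgla K R E).tens A 1) : A.obj ⊗[K] E.X 0 →ₗ[A.obj] Coker x :=
  (Submodule.mkQ (LinearMap.range (twistB x (-1) 0 (neg_add_cancel 1)))).restrictScalars A.obj

lemma cokerMk_smul (x : (dgla K R E).tens A 1) (b : A.obj ⊗[K] R) (z : A.obj ⊗[K] E.X 0) :
    cokerMk x (b • z) = b • cokerMk x z := rfl

lemma cokerMk_surjective (x : (dgla K R E).tens A 1) : Function.Surjective (cokerMk x) :=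
  fun z => by
    obtain ⟨y, rfl⟩ := Submodule.Quotient.mk_surjective _ z
    exact ⟨y, rfl⟩

lemma cokerMk_eq_zero_iff (x : (dgla K R E).tens A 1) (z : A.obj ⊗[K] E.X 0) :
    cokerMk x z = 0 ↔ ∃ w, twist x (-1) 0 (neg_add_cancel 1) w = z :=
  Submodule.Quotient.mk_eq_zero _

lemma cokerMk_twist (x : (dgla K R E).tens A 1) (w : A.obj ⊗[K] E.X (-1)) :
    cokerMk x (twist x (-1) 0 (neg_add_cancel 1) w) = 0 :=
  (cokerMk_eq_zero_iff x _).2 ⟨w, rfl⟩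

variable {ε : E.X 0 →ₗ[R] M} (hE : IsResolution E ε)

/-- The reduction of the cokernel of the twisted differential. -/
noncomputable def cokerRed (x : (dgla K R E).tens A 1) :
    Coker x →ₛₗ[(A.redHom R : A.obj ⊗[K] R →+* R)] M :=
  Submodule.liftQ _
    ({ toFun := fun z => ε (A.red _ z)
       map_add' := fun z w => by rw [map_add, map_add]
       map_smul' := fun b z => by rw [red_smul_tensor, map_smul]; rfl } :
      A.obj ⊗[K] E.X 0 →ₛₗ[(A.redHom R : A.obj ⊗[K] R →+* R)] M)
    (by
      rintro _ ⟨w, rfl⟩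
      change ε (A.red _ (twist x (-1) 0 (neg_add_cancel 1) w)) = 0
      rw [red_twist, hE.apply_dL])

lemma cokerRed_mk (x : (dgla K R E).tens A 1) (z : A.obj ⊗[K] E.X 0) :
    cokerRed hE x (cokerMk x z) = ε (A.red _ z) := rfl

lemma cokerRed_surjective (x : (dgla K R E).tens A 1) : Function.Surjective (cokerRed hE x) := by
  intro m
  obtain ⟨v, rfl⟩ := hE.surjective m
  exact ⟨cokerMk x (1 ⊗ₜ v), by rw [cokerRed_mk]; simp⟩

lemma sub_twist_mem (x : (dgla K R E).tens A 1) {p q : ℤ} (h : p + 1 = q) {t : A.obj ⊗[K] E.X q}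
    {w : E.X p} (hw : dL K E p q w = A.red _ t) :
    t - twist x p q h (1 ⊗ₜ w) ∈ A.𝔪 • (⊤ : Submodule A.obj (A.obj ⊗[K] E.X q)) := by
  rw [← ArtAlg.red_eq_zero_iff, map_sub, red_twist, ← hw, contr_tmul]
  simp

lemma map_mem_smul {V W : Type*} [AddCommGroup V] [Module A.obj V] [AddCommGroup W] [Module A.obj W]
    (f : V →ₗ[A.obj] W) {z : V} (hz : z ∈ A.𝔪 • (⊤ : Submodule A.obj V)) :
    f z ∈ A.𝔪 • (⊤ : Submodule A.obj W) := by
  have := Submodule.mem_map_of_mem (f := f) hz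
  rw [Submodule.map_smul''] at this
  exact Submodule.smul_mono le_rfl le_top this

/-- The action of `𝔪` on `Q` goes through elements `a • 1` of `A ⊗ R`, which reduce to zero in `R`.
-/
lemma map_eq_zero_of_mem_smul {Q : Type u} [AddCommGroup Q] [Module (A.obj ⊗[K] R) Q] [Module A.obj Q]
    [IsScalarTower A.obj (A.obj ⊗[K] R) Q]
    (ρ : Q →ₛₗ[(A.redHom R : A.obj ⊗[K] R →+* R)] M) {z : Q}
    (hz : z ∈ A.𝔪 • (⊤ : Submodule A.obj Q)) : ρ z = 0 := by
  refine Submodule.smul_induction_on hz (fun a ha z _ => ?_) fun x y hx hy => ?_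
  · rw [← smul_one_smul (A.obj ⊗[K] R) a z, ρ.map_smulₛₗ]
    have : A.redHom R (a • 1) = 0 := by
      rw [ArtAlg.redHom_smul, (A.residue_eq_zero_iff a).2 ha, zero_smul]
    exact (congrArg (· • ρ z) this).trans (zero_smul _ _)
  · rw [map_add, hx, hy, add_zero]

/-- Right exactness: the cokernel modulo `𝔪` is the cokernel of `E⁻¹ → E⁰`, which is `M`. -/
lemma cokerRed_eq_zero_iff (x : (dgla K R E).tens A 1) (z : Coker x) :
    cokerRed hE x z = 0 ↔ z ∈ A.𝔪 • (⊤ : Submodule A.obj (Coker x)) := by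
  refine ⟨fun h => ?_, map_eq_zero_of_mem_smul _⟩
  obtain ⟨z, rfl⟩ := cokerMk_surjective x z
  obtain ⟨w, hw⟩ := hE.exists_dL_eq_zero (K := K) _ h
  have := map_mem_smul (cokerMk x) (sub_twist_mem x (neg_add_cancel 1) hw)
  rwa [map_sub, cokerMk_twist, sub_zero] at this

/-- Modulo `𝔪` the twist disappears, so this is the exactness of `E`, in the form required by the
local criterion. -/
lemma exists_sub_twist_mem (hE : IsResolution E ε) (x : (dgla K R E).tens A 1) {p q r : ℤ} (hpq : p + 1 = q)
    (hqr : q + 1 = r) (hq : q < 0) (t : A.obj ⊗[K] E.X q)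
    (ht : twist x q r hqr t ∈ A.𝔪 • (⊤ : Submodule A.obj (A.obj ⊗[K] E.X r))) :
    ∃ s, t - twist x p q hpq s ∈ A.𝔪 • (⊤ : Submodule A.obj (A.obj ⊗[K] E.X q)) := by
  rw [← ArtAlg.red_eq_zero_iff, red_twist] at ht
  obtain ⟨w, hw⟩ := hE.exists_dL_eq hpq hqr hq _ ht
  exact ⟨_, sub_twist_mem x hpq hw⟩

/-- The local criterion for the end of the twisted complex, in degrees `-2`, `-1`, `0`; the
Maurer-Cartan equation is what makes it a complex. -/
lemma flat_coker [CharZero K] (hE : IsResolution E ε) (x : (dgla K R E).MC A) :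
    Module.Flat A.obj (Coker x.1) :=
  flat_of_isNilpotent A.isNilpotent_𝔪 (f := twist x.1 (-2) (-1) rfl)
    (g := twist x.1 (-1) 0 (neg_add_cancel 1)) ((mc_iff x.1).1 x.2 _ _ _ _ _)
    (exists_sub_twist_mem hE x.1 _ _ (by decide)) (cokerMk x.1) (cokerMk_surjective x.1)
    fun z => cokerMk_eq_zero_iff x.1 z

end PairDer

/-! ### Lifting maps of cokernels to maps of twisted complexes. -/

namespace PairDer

variable {K : Type u} [Field K] {R : Type u} [CommRing R] [Algebra K R]
  {E : CochainComplex (ModuleCat.{u} R) ℤ} {M : Type u} [AddCommGroup M] [Module R M]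
  {ε : E.X 0 →ₗ[R] M} {A : ArtAlg K}

/-- Only `A`-linearity of `f` is asked for, since the maps factored through the cokernel may be
semilinear over a nontrivial automorphism of `A ⊗ R`. -/
lemma exists_cokerLift (x : (dgla K R E).tens A 1) {T : Type u} [AddCommGroup T] [Module A.obj T]
    (f : A.obj ⊗[K] E.X 0 →ₗ[A.obj] T) (hf : ∀ w, f (twist x (-1) 0 (neg_add_cancel 1) w) = 0) :
    ∃ c : Coker x →ₗ[A.obj] T, ∀ z, c (cokerMk x z) = f z := by
  refine ⟨(LinearMap.ker (cokerMk x)).liftQ f (fun z hz => ?_) ∘ₗ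
    ((cokerMk x).quotKerEquivOfSurjective (cokerMk_surjective x)).symm.toLinearMap, fun z => ?_⟩
  · obtain ⟨w, rfl⟩ := (cokerMk_eq_zero_iff x z).1 hz
    exact hf w
  · have : ((cokerMk x).quotKerEquivOfSurjective (cokerMk_surjective x)).symm (cokerMk x z) =
        Submodule.Quotient.mk z := by
      rw [LinearEquiv.symm_apply_eq]; rfl
    rw [LinearMap.comp_apply, LinearEquiv.coe_coe, this, Submodule.liftQ_apply]

/-- The cokernels of two twisted differentials are isomorphic as deformations of `(R, M)`. -/
def CokerRel (hE : IsResolution E ε) (x y : (dgla K R E).tens A 1) : Prop :=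
  ∃ φ : A.obj ⊗[K] R →ₐ[A.obj] A.obj ⊗[K] R, (∀ b, A.redHom R (φ b) = A.redHom R b) ∧
    ∃ c : Coker x →ₗ[A.obj] Coker y, (∀ b n, c (b • n) = φ b • c n) ∧
      ∀ n, cokerRed hE y (c n) = cokerRed hE x n

lemma red_of_red_one_tmul {p : ℤ} (G : A.obj ⊗[K] E.X p →ₗ[A.obj] A.obj ⊗[K] E.X p)
    (h : ∀ v, A.red _ (G (1 ⊗ₜ v)) = v) (z : A.obj ⊗[K] E.X p) : A.red _ (G z) = A.red _ z := by
  induction z using TensorProduct.induction_on with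
  | zero => simp
  | add x y hx hy => simp only [map_add, hx, hy]
  | tmul a v =>
    have : a ⊗ₜ[K] v = a • ((1 : A.obj) ⊗ₜ[K] v) := by simp [TensorProduct.smul_tmul']
    rw [this, map_smul, ArtAlg.red_smul, ArtAlg.red_smul, h]
    simp

lemma ext_semilinear {p : ℤ} {Q : Type u} [AddCommGroup Q] [Module A.obj Q]
    {F G : A.obj ⊗[K] E.X p →ₗ[A.obj] Q} (h : ∀ v, F (1 ⊗ₜ v) = G (1 ⊗ₜ v)) (z) : F z = G z :=
  LinearMap.congr_fun (ArtAlg.ext_tmul h) z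

/-- The first step of the lift of a map of cokernels. -/
lemma exists_lift_cokerRel_zero (hE : IsResolution E ε) (x y : (dgla K R E).tens A 1)
    (φ : A.obj ⊗[K] R →ₐ[A.obj] A.obj ⊗[K] R) (hφ : ∀ b, A.redHom R (φ b) = A.redHom R b)
    (c : Coker x →ₗ[A.obj] Coker y) (hc : ∀ b n, c (b • n) = φ b • c n)
    (hcr : ∀ n, cokerRed hE y (c n) = cokerRed hE x n) :
    ∃ G : A.obj ⊗[K] E.X 0 →ₗ[A.obj] A.obj ⊗[K] E.X 0, (∀ b z, G (b • z) = φ b • G z) ∧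
      ∀ v, cokerMk y (G (1 ⊗ₜ v)) = c (cokerMk x (1 ⊗ₜ v)) ∧ A.red _ (G (1 ⊗ₜ v)) = v := by
  have hφr : ∀ r : R, A.redHom R (φ (1 ⊗ₜ r)) = r := fun r => by
    rw [hφ, ArtAlg.redHom_tmul, map_one, one_smul]
  have := hE.projective 0
  refine exists_semilinear_tensor φ
    (fun v q => cokerMk y q = c (cokerMk x (1 ⊗ₜ v)) ∧ A.red _ q = v) ?_ ?_ ?_
  · rintro v q v' q' ⟨h1, h2⟩ ⟨h1', h2'⟩
    exact ⟨by simp only [map_add, TensorProduct.tmul_add, h1, h1'], by rw [map_add, h2, h2']⟩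
  · rintro r v q ⟨h1, h2⟩
    refine ⟨?_, by rw [red_smul_tensor, hφr, h2]⟩
    have : (1 : A.obj) ⊗ₜ[K] (r • v) = ((1 : A.obj) ⊗ₜ[K] r) • ((1 : A.obj) ⊗ₜ[K] v) := by
      rw [tmul_smul_tmul, one_mul]
    rw [this, cokerMk_smul, cokerMk_smul, hc, h1]
  · intro v
    obtain ⟨q, hq⟩ := cokerMk_surjective y (c (cokerMk x (1 ⊗ₜ v)))
    have h1 : ε (A.red _ q - v) = 0 := by
      have := hcr (cokerMk x (1 ⊗ₜ v))
      rw [← hq, cokerRed_mk, cokerRed_mk] at this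
      rw [map_sub, this]
      simp
    obtain ⟨w, hw⟩ := hE.exists_dL_eq_zero (K := K) _ h1
    -- A boundary is subtracted: the class in the cokernel is unchanged and the reduction becomes
    -- exactly `v`.
    refine ⟨q - twist y (-1) 0 (neg_add_cancel 1) (1 ⊗ₜ w), ?_, ?_⟩
    · rw [map_sub, cokerMk_twist, sub_zero, hq]
    · rw [map_sub, red_twist, contr_tmul, AlgHom.toLinearMap_apply, map_one, one_smul, hw,
        sub_sub_cancel]

variable [CharZero K]

/-- The exponential intertwines the two twisted differentials, so it descends to the cokernels;
being the identity modulo `𝔪`, it respects the reductions. -/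
lemma cokerRel_gauge (hE : IsResolution E ε) (a : (dgla K R E).tens A 0) (x : (dgla K R E).tens A 1) :
    CokerRel hE x ((dgla K R E).gauge A a x) := by
  refine ⟨autAlg a, fun b => ?_, ?_⟩
  · rw [ArtAlg.redHom_apply, ArtAlg.redHom_apply]
    exact red_autR a b
  · obtain ⟨c, hc⟩ := exists_cokerLift x (cokerMk ((dgla K R E).gauge A a x) ∘ₗ autE a 0) (fun w => by
      rw [LinearMap.comp_apply, ← twist_gauge, cokerMk_twist])
    refine ⟨c, fun b n => ?_, fun n => ?_⟩
    · obtain ⟨z, rfl⟩ := cokerMk_surjective x n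
      rw [← cokerMk_smul, hc, hc, LinearMap.comp_apply, LinearMap.comp_apply, autE_smul, cokerMk_smul]
      rfl
    · obtain ⟨z, rfl⟩ := cokerMk_surjective x n
      rw [hc, LinearMap.comp_apply, cokerRed_mk, cokerRed_mk, red_autE]

/-- A boundary of the twisted complex is the boundary of an element with given reduction. -/
lemma exists_twist_eq (hE : IsResolution E ε) (y : (dgla K R E).MC A) {p q : ℤ} (hpq : p + 1 = q)
    (hq : q ≤ 0) (s : A.obj ⊗[K] E.X p) (v : E.X p)
    (hv : A.red _ (twist y.1 p q hpq s) = dL K E p q v) :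
    ∃ s', twist y.1 p q hpq s' = twist y.1 p q hpq s ∧ A.red _ s' = v := by
  suffices h : ∃ s', twist y.1 p q hpq s' = twist y.1 p q hpq s ∧
      s' - 1 ⊗ₜ v ∈ A.𝔪 • (⊤ : Submodule A.obj (A.obj ⊗[K] E.X p)) by
    obtain ⟨s', h1, h2⟩ := h
    exact ⟨s', h1, by rw [ArtAlg.red_eq_of_sub_mem h2]; simp⟩
  have h0 := sub_twist_mem y.1 hpq hv.symm
  -- The lifting lemma needs a flat module following degree `q`: the next term of the complex if `q
  -- < 0`, and the cokernel, flat by `flat_coker`, if `q = 0`.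
  obtain hq | rfl := hq.lt_or_eq
  · exact exists_lift_of_isNilpotent A.isNilpotent_𝔪 ((mc_iff y.1).1 y.2 p q _ hpq rfl)
      (exists_sub_twist_mem hE y.1 hpq rfl hq) _
      (LinearMap.congr_fun ((mc_iff y.1).1 y.2 p q _ hpq rfl) s) _ h0
  · obtain rfl : p = -1 := by omega
    have := flat_coker hE y
    refine exists_lift_of_isNilpotent A.isNilpotent_𝔪 (g' := cokerMk y.1)
      (LinearMap.ext fun w => cokerMk_twist y.1 w) (fun t ht => ?_) _ (cokerMk_twist y.1 s) _ h0
    rw [← cokerRed_eq_zero_iff hE, cokerRed_mk] at ht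
    obtain ⟨w, hw⟩ := hE.exists_dL_eq_zero (K := K) _ ht
    exact ⟨_, sub_twist_mem y.1 _ hw⟩

/-- The twisted complex is exact in negative degrees because its reduction is: a primitive modulo
`𝔪` is corrected to a primitive. -/
lemma exists_twist_eq_of_twist_eq_zero (hE : IsResolution E ε) (y : (dgla K R E).MC A) {p q r : ℤ}
    (hpq : p + 1 = q) (hqr : q + 1 = r) (hq : q < 0) (t : A.obj ⊗[K] E.X q)
    (ht : twist y.1 q r hqr t = 0) : ∃ s, twist y.1 p q hpq s = t := by
  obtain ⟨s₀, hs₀⟩ := exists_sub_twist_mem hE y.1 hpq hqr hq t (by rw [ht]; exact zero_mem _)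
  obtain ⟨s, hs, -⟩ := exists_lift_of_isNilpotent A.isNilpotent_𝔪 ((mc_iff y.1).1 y.2 p q _ hpq hqr)
    (exists_sub_twist_mem hE y.1 hpq hqr hq) t ht s₀ hs₀
  exact ⟨s, hs⟩

/-- The inductive step of the lift of a map of cokernels. -/
lemma exists_lift_step (hE : IsResolution E ε) (x y : (dgla K R E).MC A)
    (φ : A.obj ⊗[K] R →ₐ[A.obj] A.obj ⊗[K] R) (hφ : ∀ b, A.redHom R (φ b) = A.redHom R b)
    (p q : ℤ) (hpq : p + 1 = q) (hq : q ≤ 0)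
      (G : A.obj ⊗[K] E.X q →ₗ[A.obj] A.obj ⊗[K] E.X q) (hG : ∀ b z, G (b • z) = φ b • G z)
      (hGr : ∀ z, A.red _ (G z) = A.red _ z)
      (hGt : ∀ z, ∃ s, twist y.1 p q hpq s = G (twist x.1 p q hpq z)) :
      ∃ G' : A.obj ⊗[K] E.X p →ₗ[A.obj] A.obj ⊗[K] E.X p, (∀ b z, G' (b • z) = φ b • G' z) ∧
        ∀ v, twist y.1 p q hpq (G' (1 ⊗ₜ v)) = G (twist x.1 p q hpq (1 ⊗ₜ v)) ∧
          A.red _ (G' (1 ⊗ₜ v)) = v := by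
  have hφr : ∀ r : R, A.redHom R (φ (1 ⊗ₜ r)) = r := fun r => by
    rw [hφ, ArtAlg.redHom_tmul, map_one, one_smul]
  have := hE.projective p
  refine exists_semilinear_tensor φ
    (fun v t => twist y.1 p q hpq t = G (twist x.1 p q hpq (1 ⊗ₜ v)) ∧ A.red _ t = v) ?_ ?_ ?_
  · rintro v q v' q' ⟨h1, h2⟩ ⟨h1', h2'⟩
    exact ⟨by simp only [map_add, TensorProduct.tmul_add, h1, h1'], by rw [map_add, h2, h2']⟩
  · rintro r v q ⟨h1, h2⟩
    refine ⟨?_, by rw [red_smul_tensor, hφr, h2]⟩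
    have : (1 : A.obj) ⊗ₜ[K] (r • v) = ((1 : A.obj) ⊗ₜ[K] r) • ((1 : A.obj) ⊗ₜ[K] v) := by
      rw [tmul_smul_tmul, one_mul]
    rw [this, twist_smul, twist_smul, hG, h1]
  · intro v
    obtain ⟨s, hs⟩ := hGt (1 ⊗ₜ v)
    obtain ⟨s', hs', hs''⟩ := exists_twist_eq hE y hpq hq s v (by
      rw [hs, hGr, red_twist]; simp)
    exact ⟨s', by rw [hs', hs], hs''⟩

set_option maxHeartbeats 800000 in
/-- Isomorphisms of cokernels lift to isomorphisms of twisted complexes. -/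
lemma exists_lift_cokerRel (hE : IsResolution E ε) (x y : (dgla K R E).MC A)
    (φ : A.obj ⊗[K] R →ₐ[A.obj] A.obj ⊗[K] R) (hφ : ∀ b, A.redHom R (φ b) = A.redHom R b)
    (c : Coker x.1 →ₗ[A.obj] Coker y.1) (hc : ∀ b n, c (b • n) = φ b • c n)
    (hcr : ∀ n, cokerRed hE y.1 (c n) = cokerRed hE x.1 n) :
    ∃ G : ∀ p : ℤ, A.obj ⊗[K] E.X p →ₗ[A.obj] A.obj ⊗[K] E.X p,
      (∀ p b z, G p (b • z) = φ b • G p z) ∧ (∀ p z, A.red _ (G p z) = A.red _ z) ∧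
      ∀ p q hpq z, twist y.1 p q hpq (G p z) = G q (twist x.1 p q hpq z) := by
  have start := exists_lift_cokerRel_zero hE x.1 y.1 φ hφ c hc hcr
  have step := exists_lift_step hE x y φ hφ
  -- At stage `n` the map is under control in degrees at least `-n`. The last clause says that it
  -- carries boundaries in degree `-n` to boundaries, which is what the construction in the next
  -- lower degree requires.
  have key : ∀ n : ℕ, ∃ G : ∀ p : ℤ, A.obj ⊗[K] E.X p →ₗ[A.obj] A.obj ⊗[K] E.X p,
      (∀ p, -(n : ℤ) ≤ p → ∀ b z, G p (b • z) = φ b • G p z) ∧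
      (∀ p, -(n : ℤ) ≤ p → ∀ z, A.red _ (G p z) = A.red _ z) ∧
      (∀ p q hpq, -(n : ℤ) ≤ p → ∀ z, twist y.1 p q hpq (G p z) = G q (twist x.1 p q hpq z)) ∧
      ∀ p q hpq, q = -(n : ℤ) → ∀ z, ∃ s, twist y.1 p q hpq s = G q (twist x.1 p q hpq z) := by
    intro n
    induction n with
    | zero =>
      obtain ⟨G₀, hG₀, hG₀'⟩ := start
      have hs : ∀ p : ℤ, 0 < p → ∀ z w : A.obj ⊗[K] E.X p, z = w := fun p hp z w => by
        have := subsingleton_tensor (A := A) (hE.subsingleton_of_pos p hp)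
        exact Subsingleton.elim z w
      -- The default value zero does no harm: the modules vanish in positive degrees, and nothing is
      -- claimed yet in negative ones.
      refine ⟨Function.update (fun _ => 0) 0 G₀, fun p hp b z => ?_, fun p hp z => ?_,
        fun p q hpq hp z => hs q (by simp at hp; omega) _ _, fun p q hpq hq z => ?_⟩
      · obtain hp | rfl : 0 < p ∨ p = 0 := by simp at hp; omega
        · exact hs p hp _ _
        · rw [Function.update_self, hG₀]
      · obtain hp | rfl : 0 < p ∨ p = 0 := by simp at hp; omega
        · congr 1
          exact hs p hp _ _
        · rw [Function.update_self]
          exact red_of_red_one_tmul G₀ (fun v => (hG₀' v).2) z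
      · obtain rfl : q = 0 := by simpa using hq
        obtain rfl : p = -1 := by omega
        rw [Function.update_self]
        refine (cokerMk_eq_zero_iff y.1 _).1 ?_
        have := ext_semilinear (F := cokerMk y.1 ∘ₗ G₀) (G := c ∘ₗ cokerMk x.1)
          (fun v => (hG₀' v).1) (twist x.1 (-1) 0 hpq z)
        rw [LinearMap.comp_apply, LinearMap.comp_apply, cokerMk_twist, map_zero] at this
        exact this
    | succ n ih =>
      obtain ⟨G, hG, hGr, hGt, hGs⟩ := ih
      set p₀ : ℤ := -((n + 1 : ℕ) : ℤ) with hp₀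
      set q₀ : ℤ := -(n : ℤ) with hq₀
      have hpq₀ : p₀ + 1 = q₀ := by rw [hp₀, hq₀]; push_cast; ring
      obtain ⟨G', hG', hG''⟩ := step p₀ q₀ hpq₀ (by omega) (G q₀) (hG q₀ le_rfl) (hGr q₀ le_rfl)
        (hGs p₀ q₀ hpq₀ rfl)
      have hG't : ∀ z, twist y.1 p₀ q₀ hpq₀ (G' z) = G q₀ (twist x.1 p₀ q₀ hpq₀ z) :=
        ext_semilinear (F := twist y.1 p₀ q₀ hpq₀ ∘ₗ G') (G := G q₀ ∘ₗ twist x.1 p₀ q₀ hpq₀)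
          fun v => (hG'' v).1
      refine ⟨Function.update G p₀ G', fun p hp b z => ?_, fun p hp z => ?_,
        fun p q hpq hp z => ?_, fun p q hpq hq z => ?_⟩
      · obtain rfl | hne := eq_or_ne p p₀
        · rw [Function.update_self, hG']
        · rw [Function.update_of_ne hne, hG p (by omega)]
      · obtain rfl | hne := eq_or_ne p p₀
        · rw [Function.update_self, red_of_red_one_tmul G' fun v => (hG'' v).2]
        · rw [Function.update_of_ne hne, hGr p (by omega)]
      · have hq : q ≠ p₀ := by omega
        rw [Function.update_of_ne hq]
        obtain rfl | hne := eq_or_ne p p₀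
        · obtain rfl : q = q₀ := by omega
          rw [Function.update_self, hG't]
        · rw [Function.update_of_ne hne, hGt p q hpq (by omega)]
      · subst hq
        rw [Function.update_self]
        refine exists_twist_eq_of_twist_eq_zero hE y hpq hpq₀ (by omega) _ ?_
        rw [hG't]
        have := LinearMap.congr_fun ((mc_iff x.1).1 x.2 p _ _ hpq hpq₀) z
        rw [LinearMap.comp_apply] at this
        rw [this]
        simp
  -- Boundedness stops the induction: stage `m` settles all degrees, since the modules vanish below
  -- `-m`.
  obtain ⟨m, hm⟩ := hE.bounded
  obtain ⟨G, hG, hGr, hGt, hGs⟩ := key m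
  have hs : ∀ p : ℤ, p < -(m : ℤ) → ∀ z w : A.obj ⊗[K] E.X p, z = w := fun p hp z w => by
    have := subsingleton_tensor (A := A) (hm p hp)
    exact Subsingleton.elim z w
  refine ⟨G, fun p b z => ?_, fun p z => ?_, fun p q hpq z => ?_⟩
  · by_cases hp : -(m : ℤ) ≤ p
    · exact hG p hp b z
    · exact hs p (by omega) _ _
  · by_cases hp : -(m : ℤ) ≤ p
    · exact hGr p hp z
    · congr 1
      exact hs p (by omega) _ _
  · by_cases hp : -(m : ℤ) ≤ p
    · exact hGt p q hpq hp z
    · rw [hs p (by omega) z 0]; simp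

lemma quot_eq_of_cokerRel (hE : IsResolution E ε) (x y : (dgla K R E).MC A)
    (h : CokerRel hE x.1 y.1) :
    (Quot.mk _ x : Quot ((dgla K R E).GaugeRel A)) = Quot.mk _ y := by
  obtain ⟨φ, hφ, c, hc, hcr⟩ := h
  obtain ⟨G, hG, hGr, hGt⟩ := exists_lift_cokerRel hE x y φ hφ c hc hcr
  exact quot_eq_of_semilinear x y φ G hG (fun b => by
    rw [← ArtAlg.redHom_apply, ← ArtAlg.redHom_apply, hφ]) hGr hGt

end PairDer

/-! ### Every deformation of the module is the cokernel of a twisted differential. -/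

namespace PairDer

variable {K : Type u} [Field K] {R : Type u} [CommRing R] [Algebra K R]
  {E : CochainComplex (ModuleCat.{u} R) ℤ} {M : Type u} [AddCommGroup M] [Module R M]
  {ε : E.X 0 →ₗ[R] M} {A : ArtAlg K}

lemma one_tmul_smul {p : ℤ} (r : R) (v : E.X p) :
    (1 : A.obj) ⊗ₜ[K] (r • v) = ((1 : A.obj) ⊗ₜ[K] r) • ((1 : A.obj) ⊗ₜ[K] v) := by
  rw [tmul_smul_tmul, one_mul]

lemma red_of_red_one_tmul_dL {p q : ℤ} (D : A.obj ⊗[K] E.X p →ₗ[A.obj] A.obj ⊗[K] E.X q)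
    (h : ∀ v, A.red _ (D (1 ⊗ₜ v)) = dL K E p q v) (z : A.obj ⊗[K] E.X p) :
    A.red _ (D z) = dL K E p q (A.red _ z) := by
  induction z using TensorProduct.induction_on with
  | zero => simp
  | add x y hx hy => simp only [map_add, hx, hy]
  | tmul a v =>
    have : a ⊗ₜ[K] v = a • ((1 : A.obj) ⊗ₜ[K] v) := by simp [TensorProduct.smul_tmul']
    rw [this, map_smul, ArtAlg.red_smul, ArtAlg.red_smul, h, map_smul]
    simp

/-- One step of the lift of a resolution to a deformation. -/
lemma exists_differential (hE : IsResolution E ε) {p q : ℤ} {T : Type u}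
    [AddCommGroup T] [Module A.obj T] [Module.Flat A.obj T]
    (g : A.obj ⊗[K] E.X q →ₗ[A.obj] T)
    (hgB : ∀ (b : A.obj ⊗[K] R) t, g t = 0 → g (b • t) = 0)
    (hg : ∀ v : E.X p, ∃ t, g t = 0 ∧ A.red _ t = dL K E p q v)
    (hg' : ∀ t, g t ∈ A.𝔪 • (⊤ : Submodule A.obj T) → ∃ w, dL K E p q w = A.red _ t) :
    ∃ D : A.obj ⊗[K] E.X p →ₗ[A.obj] A.obj ⊗[K] E.X q,
      (∀ (b : A.obj ⊗[K] R) z, D (b • z) = b • D z) ∧ (∀ z, g (D z) = 0) ∧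
      (∀ z, A.red _ (D z) = dL K E p q (A.red _ z)) ∧
      ∀ w : E.X p, dL K E p q w = 0 → ∃ z, D z = 0 ∧ A.red _ z = w := by
  have := hE.projective p
  obtain ⟨D, hD, hD'⟩ := exists_semilinear_tensor (AlgHom.id A.obj (A.obj ⊗[K] R))
    (fun (v : E.X p) t => g t = 0 ∧ A.red _ t = dL K E p q v)
    (by
      rintro v t v' t' ⟨h1, h2⟩ ⟨h1', h2'⟩
      exact ⟨by rw [map_add, h1, h1', add_zero], by rw [map_add, map_add, h2, h2']⟩)
    (by
      rintro r v t ⟨h1, h2⟩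
      refine ⟨hgB _ _ h1, ?_⟩
      rw [AlgHom.id_apply, red_smul_tensor, ArtAlg.redHom_tmul, map_one, one_smul, h2]
      exact ((E.d p q).hom.map_smul r v).symm) hg
  have hgD : ∀ z, g (D z) = 0 := ext_semilinear (F := g ∘ₗ D) (G := 0) fun v => (hD' v).1
  have hDr := red_of_red_one_tmul_dL D fun v => (hD' v).2
  have hmem : ∀ {t w}, dL K E p q w = A.red _ t →
      t - D (1 ⊗ₜ w) ∈ A.𝔪 • (⊤ : Submodule A.obj (A.obj ⊗[K] E.X q)) := fun {t w} h => by
    rw [← ArtAlg.red_eq_zero_iff, map_sub, hDr, ← h]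
    simp
  have hex : ∀ t, g t ∈ A.𝔪 • (⊤ : Submodule A.obj T) → ∃ z, t - D z ∈ A.𝔪 • (⊤ : Submodule A.obj _) :=
    fun t ht => by
      obtain ⟨w, hw⟩ := hg' t ht
      exact ⟨_, hmem hw⟩
  have hgD' : g ∘ₗ D = 0 := LinearMap.ext hgD
  refine ⟨D, hD, hgD, hDr, fun w hw => ?_⟩
  -- Cycles of `E` lift to cycles of `D`; this is the input `hg` for the differential one degree
  -- lower.
  obtain ⟨z, hz, hz'⟩ := exists_lift_of_isNilpotent A.isNilpotent_𝔪 hgD' hex 0 (map_zero g) (1 ⊗ₜ w)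
    (hmem (by rw [hw, map_zero]))
  exact ⟨z, hz, by rw [ArtAlg.red_eq_of_sub_mem hz']; simp⟩

set_option maxHeartbeats 800000 in
/-- Every deformation of `(R, M)` with trivial algebra `A ⊗ R` comes from a twisted complex. -/
lemma exists_coker_equiv [CharZero K] (hE : IsResolution E ε) {N : Type u} [AddCommGroup N]
    [Module (A.obj ⊗[K] R) N] [Module A.obj N] [IsScalarTower A.obj (A.obj ⊗[K] R) N]
    [Module.Flat A.obj N] (ρ : N →ₛₗ[(A.redHom R : A.obj ⊗[K] R →+* R)] M)
    (hρ : Function.Surjective ρ) (hρ' : ∀ n, ρ n = 0 → n ∈ A.𝔪 • (⊤ : Submodule A.obj N)) :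
    ∃ (x : (dgla K R E).MC A) (c : Coker x.1 →ₗ[A.obj] N), Function.Bijective c ∧
      (∀ (b : A.obj ⊗[K] R) n, c (b • n) = b • c n) ∧ ∀ n, ρ (c n) = cokerRed hE x.1 n := by
  have hρB : ∀ (b : A.obj ⊗[K] R) n, ρ (b • n) = A.redHom R b • ρ n := fun b n => ρ.map_smulₛₗ b n
  have hρA : ∀ (a : A.obj) n, ρ (a • n) = algebraMap K R (A.residue a) • ρ n := fun a n => by
    rw [← smul_one_smul (A.obj ⊗[K] R) a n, hρB, ArtAlg.redHom_smul, map_one,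
      Algebra.algebraMap_eq_smul_one]
  -- the augmentation
  obtain ⟨g, hgB, hg⟩ : ∃ g : A.obj ⊗[K] E.X 0 →ₗ[A.obj] N,
      (∀ (b : A.obj ⊗[K] R) z, g (b • z) = b • g z) ∧ ∀ z, ρ (g z) = ε (A.red _ z) := by
    have := hE.projective 0
    obtain ⟨g, hg, hg'⟩ := exists_semilinear_tensor (AlgHom.id A.obj (A.obj ⊗[K] R))
      (fun (v : E.X 0) n => ρ n = ε v)
      (fun v t v' t' h h' => by rw [map_add, map_add, h, h'])
      (fun r v t h => by
        rw [AlgHom.id_apply, hρB, ArtAlg.redHom_tmul, map_one, one_smul, h, map_smul])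
      (fun v => hρ (ε v))
    refine ⟨g, hg, fun z => ?_⟩
    induction z using TensorProduct.induction_on with
    | zero => simp
    | add x y hx hy => simp only [map_add, hx, hy]
    | tmul a v =>
      have : a ⊗ₜ[K] v = a • ((1 : A.obj) ⊗ₜ[K] v) := by simp [TensorProduct.smul_tmul']
      rw [contr_tmul, this, map_smul, hρA, hg', ← map_smul]
      rfl
  have hg𝔪 : ∀ t, g t ∈ A.𝔪 • (⊤ : Submodule A.obj N) → ∃ w, dL K E (-1) 0 w = A.red _ t :=
    fun t ht => hE.exists_dL_eq_zero _ (by rw [← hg]; exact map_eq_zero_of_mem_smul ρ ht)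
  -- The lifting lemma for the surjection `g` onto `N`, with the zero module as next term.
  have hgl : ∀ v : E.X (-1), ∃ t, g t = 0 ∧ A.red _ t = dL K E (-1) 0 v := fun v => by
    obtain ⟨z, hz, hz'⟩ := exists_lift_of_isNilpotent A.isNilpotent_𝔪 (g := g) (T' := PUnit.{u + 1})
      (g' := 0) (by simp) (fun t _ => by
        obtain ⟨v, hv⟩ := hE.surjective (ρ t)
        exact ⟨1 ⊗ₜ v, hρ' _ (by rw [map_sub, hg]; simp [hv])⟩) 0 rfl (1 ⊗ₜ dL K E (-1) 0 v)
      (hρ' _ (by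
        rw [map_sub, map_zero, hg, contr_tmul, AlgHom.toLinearMap_apply, map_one, one_smul,
          hE.apply_dL, sub_zero]))
    exact ⟨z, hz, by rw [ArtAlg.red_eq_of_sub_mem hz']; simp⟩
  obtain ⟨D₀, hD₀B, hD₀, hD₀r, hD₀l⟩ :=
    exists_differential hE g (fun b t h => by rw [hgB, h, smul_zero]) hgl hg𝔪
  -- the differentials
  have key : ∀ n : ℕ, ∃ D : ∀ p q : ℤ, A.obj ⊗[K] E.X p →ₗ[A.obj] A.obj ⊗[K] E.X q,
      D (-1) 0 = D₀ ∧
      (∀ p q, p + 1 = q → -(n : ℤ) - 1 ≤ p → ∀ (b : A.obj ⊗[K] R) z, D p q (b • z) = b • D p q z) ∧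
      (∀ p q, p + 1 = q → -(n : ℤ) - 1 ≤ p → ∀ z, A.red _ (D p q z) = dL K E p q (A.red _ z)) ∧
      (∀ p q r, p + 1 = q → q + 1 = r → -(n : ℤ) - 1 ≤ p → ∀ z, D q r (D p q z) = 0) ∧
      -- Lifting of cycles at the lowest degree constructed so far keeps the induction going.
      ∀ p q, p + 1 = q → p = -(n : ℤ) - 1 → ∀ w : E.X p, dL K E p q w = 0 →
        ∃ z, D p q z = 0 ∧ A.red _ z = w := by
    intro n
    induction n with
    | zero =>
      have hs : ∀ p : ℤ, 0 < p → ∀ z w : A.obj ⊗[K] E.X p, z = w := fun p hp z w => by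
        have := subsingleton_tensor (A := A) (hE.subsingleton_of_pos p hp)
        exact Subsingleton.elim z w
      -- The family depends on two free integers, without a proof of `p + 1 = q`, so that single
      -- differentials can be inserted by `Function.update`; the other values are zero.
      let D : ∀ p q : ℤ, A.obj ⊗[K] E.X p →ₗ[A.obj] A.obj ⊗[K] E.X q :=
        Function.update (fun _ _ => 0) (-1) (Function.update (fun _ => 0) 0 D₀)
      have hD : D (-1) 0 = D₀ := by simp [D]
      refine ⟨D, hD, fun p q hpq hp b z => ?_, fun p q hpq hp z => ?_, fun p q r hpq hqr hp z => ?_,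
        fun p q hpq hp w hw => ?_⟩
      · obtain hq | rfl : 0 < q ∨ q = 0 := by simp at hp; omega
        · exact hs q hq _ _
        · obtain rfl : p = -1 := by omega
          rw [hD, hD₀B]
      · obtain hq | rfl : 0 < q ∨ q = 0 := by simp at hp; omega
        · have := hE.subsingleton_of_pos q hq
          exact Subsingleton.elim _ _
        · obtain rfl : p = -1 := by omega
          rw [hD, hD₀r]
      · exact hs r (by simp at hp; omega) _ _
      · obtain rfl : p = -1 := by simpa using hp
        obtain rfl : q = 0 := by omega
        rw [hD]
        exact hD₀l w hw
    | succ n ih =>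
      obtain ⟨D, hD0, hDB, hDr, hDD, hDl⟩ := ih
      obtain ⟨p₀, hp₀⟩ : ∃ p₀ : ℤ, p₀ = -((n + 1 : ℕ) : ℤ) - 1 := ⟨_, rfl⟩
      obtain ⟨q₀, hq₀⟩ : ∃ q₀ : ℤ, q₀ = -(n : ℤ) - 1 := ⟨_, rfl⟩
      obtain ⟨r₀, hr₀⟩ : ∃ r₀ : ℤ, r₀ = -(n : ℤ) := ⟨_, rfl⟩
      have hpq₀ : p₀ + 1 = q₀ := by rw [hp₀, hq₀]; push_cast; ring
      have hqr₀ : q₀ + 1 = r₀ := by rw [hr₀, hq₀]; ring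
      obtain ⟨D', hD'B, hD'g, hD'r, hD'l⟩ := exists_differential hE (D q₀ r₀)
        (fun b t h => by rw [hDB q₀ r₀ hqr₀ hq₀.ge, h, smul_zero])
        (fun v => hDl q₀ r₀ hqr₀ hq₀ _ (dL_dL _ _ _ _)) (fun t ht => by
          rw [← ArtAlg.red_eq_zero_iff, hDr q₀ r₀ hqr₀ hq₀.ge] at ht
          exact hE.exists_dL_eq hpq₀ hqr₀ (by omega) _ ht)
      let D'' : ∀ p q : ℤ, A.obj ⊗[K] E.X p →ₗ[A.obj] A.obj ⊗[K] E.X q :=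
        Function.update D p₀ (Function.update (D p₀) q₀ D')
      have hD'' : D'' p₀ q₀ = D' := by simp [D'']
      have hne : ∀ p q, p ≠ p₀ → D'' p q = D p q := fun p q hp => by simp [D'', hp]
      refine ⟨D'', by rw [hne _ _ (by omega), hD0], fun p q hpq hp b z => ?_, fun p q hpq hp z => ?_,
        fun p q r hpq hqr hp z => ?_, fun p q hpq hp w hw => ?_⟩
      · obtain rfl | h := eq_or_ne p p₀
        · obtain rfl : q = q₀ := by omega
          rw [hD'', hD'B]
        · rw [hne p q h, hDB p q hpq (by omega)]
      · obtain rfl | h := eq_or_ne p p₀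
        · obtain rfl : q = q₀ := by omega
          rw [hD'', hD'r]
        · rw [hne p q h, hDr p q hpq (by omega)]
      · rw [hne q r (by omega)]
        obtain rfl | h := eq_or_ne p p₀
        · obtain rfl : q = q₀ := by omega
          obtain rfl : r = r₀ := by omega
          rw [hD'', hD'g]
        · rw [hne p q h, hDD p q r hpq hqr (by omega)]
      · obtain rfl : p = p₀ := by omega
        obtain rfl : q = q₀ := by omega
        rw [hD'']
        exact hD'l w hw
  obtain ⟨m, hm⟩ := hE.bounded
  obtain ⟨D, hD0, hDB, hDr, hDD, -⟩ := key m
  have hs : ∀ p : ℤ, p < -(m : ℤ) → ∀ z : A.obj ⊗[K] E.X p, z = 0 := fun p hp z => by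
    have := subsingleton_tensor (A := A) (hm p hp)
    exact Subsingleton.elim z 0
  obtain ⟨x, hx⟩ := exists_twist (fun p q _ => D p q)
    (fun p q hpq b z => by
      by_cases hp : p < -(m : ℤ)
      · rw [hs p hp z, hs p hp (b • 0)]; simp
      · exact hDB p q hpq (by omega) b z)
    (fun p q hpq z => by
      by_cases hp : p < -(m : ℤ)
      · rw [hs p hp z]; simp
      · exact hDr p q hpq (by omega) z)
  have hmc : (dgla K R E).dT A 1 2 rfl x + (2 : K)⁻¹ • (dgla K R E).bracketT A 1 1 2 rfl x x = 0 := by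
    refine (mc_iff x).2 fun p q r hpq hqr => LinearMap.ext fun z => ?_
    rw [hx, hx, LinearMap.comp_apply]
    by_cases hp : p < -(m : ℤ)
    · rw [hs p hp z]; simp
    · exact hDD p q r hpq hqr (by omega) z
  have hx0 : twist x (-1) 0 (neg_add_cancel 1) = D₀ := by rw [hx, hD0]
  obtain ⟨c, hc⟩ := exists_cokerLift x g fun w => by rw [hx0, hD₀]
  have hcρ : ∀ n, ρ (c n) = cokerRed hE x n := fun n => by
    obtain ⟨z, rfl⟩ := cokerMk_surjective x n
    rw [hc, hg, cokerRed_mk]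
  refine ⟨⟨x, hmc⟩, c, ?_, fun b n => ?_, hcρ⟩
  -- Modulo `𝔪` the map `c` is the identity of `M`, and `N` is flat.
  · refine bijective_of_isNilpotent A.isNilpotent_𝔪 (fun n hn => ?_) fun t => ?_
    · rw [← cokerRed_eq_zero_iff hE, ← hcρ]
      exact map_eq_zero_of_mem_smul ρ hn
    · obtain ⟨n, hn⟩ := cokerRed_surjective hE x (ρ t)
      exact ⟨n, hρ' _ (by rw [map_sub, hcρ, hn, sub_self])⟩
  · obtain ⟨z, rfl⟩ := cokerMk_surjective x n
    rw [← cokerMk_smul, hc, hc, hgB]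

end PairDer

/-! ### Affine pairs over unbundled rings and modules, and base change of `A ⊗ R`. -/

section AffinePairs
open AlgebraicGeometry

namespace SchemePair

variable {S T U : Type u} [CommRing S] [CommRing T] [CommRing U] {N N' N'' : Type u}
  [AddCommGroup N] [Module S N] [AddCommGroup N'] [Module T N'] [AddCommGroup N''] [Module U N'']

/-- The pair `(Spec S, Ñ)` for a module over a ring. -/
noncomputable abbrev affine (S : Type u) [CommRing S] (N : Type u) [AddCommGroup N] [Module S N] :
    SchemePair.{u} :=
  spec (S := .of S) (ModuleCat.of S N)

/-- A semilinear map as a morphism of modules. -/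
noncomputable def semilinearHom (φ : S →+* T) (c : N →ₛₗ[φ] N') :
    ModuleCat.of S N ⟶ (ModuleCat.restrictScalars φ).obj (ModuleCat.of T N') :=
  ModuleCat.ofHom (Y := (ModuleCat.restrictScalars φ).obj (ModuleCat.of T N'))
    { toFun := c
      map_add' := c.map_add
      map_smul' := fun s n => c.map_smulₛₗ s n }

/-- The morphism of affine pairs given by a semilinear map. -/
noncomputable def ofSemilinear (φ : S →+* T) (c : N →ₛₗ[φ] N') : affine T N' ⟶ affine S N :=
  specHom (CommRingCat.ofHom φ) (semilinearHom φ c)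

@[simp] lemma ofSemilinear_base (φ : S →+* T) (c : N →ₛₗ[φ] N') :
    (ofSemilinear φ c).base = Spec.map (CommRingCat.ofHom φ) := rfl

lemma ofSemilinear_comp (φ : S →+* T) (ψ : T →+* U) (χ : S →+* U) (hχ : ψ.comp φ = χ)
    (c : N →ₛₗ[φ] N') (c' : N' →ₛₗ[ψ] N'') (c'' : N →ₛₗ[χ] N'') (h : ∀ n, c'' n = c' (c n)) :
    ofSemilinear ψ c' ≫ ofSemilinear φ c = ofSemilinear χ c'' :=
  specHom_comp _ _ _ (by rw [← hχ]; rfl) _ _ _ h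

lemma exists_ofSemilinear (f : affine T N' ⟶ affine S N) :
    ∃ (φ : S →+* T) (c : N →ₛₗ[φ] N'), f = ofSemilinear φ c := by
  obtain ⟨φ, c, rfl⟩ := exists_specHom f
  exact ⟨φ.hom, { toFun := c.hom, map_add' := c.hom.map_add, map_smul' := c.hom.map_smul }, rfl⟩

lemma ofSemilinear_injective {φ ψ : S →+* T} {c : N →ₛₗ[φ] N'} {c' : N →ₛₗ[ψ] N'}
    (h : ofSemilinear φ c = ofSemilinear ψ c') : φ = ψ ∧ ∀ n, c n = c' n := by
  obtain ⟨h1, h2⟩ := specHom_injective h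
  exact ⟨congrArg CommRingCat.Hom.hom h1, h2⟩

lemma isCartesian_ofSemilinear_iff (φ : S →+* T) (c : N →ₛₗ[φ] N') :
    IsCartesian (ofSemilinear φ c) ↔ ∀ (Q : Type u) [AddCommGroup Q] [Module T Q] (c' : N →ₛₗ[φ] Q),
      ∃! α : N' →ₗ[T] Q, ∀ n, α (c n) = c' n := by
  refine (isCartesian_specHom_iff _ _).trans ⟨fun h Q _ _ c' => ?_, fun h Q c' => ?_⟩
  · obtain ⟨α, hα, hα'⟩ := h (ModuleCat.of T Q) (semilinearHom φ c')
    refine ⟨α.hom, fun n => congrArg (fun f => f.hom n) hα, fun β hβ => ?_⟩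
    refine congrArg ModuleCat.Hom.hom (hα' (ModuleCat.ofHom β) ?_)
    exact ModuleCat.hom_ext (LinearMap.ext hβ)
  · obtain ⟨α, hα, hα'⟩ := h Q
      { toFun := c'.hom, map_add' := c'.hom.map_add, map_smul' := c'.hom.map_smul }
    refine ⟨ModuleCat.ofHom α, ModuleCat.hom_ext (LinearMap.ext hα), fun β hβ => ?_⟩
    exact ModuleCat.hom_ext (hα' β.hom fun n => congrArg (fun f => f.hom n) hβ)

lemma isCartesian_ofSemilinear_of_bijective (φ : S →+* T) (c : N →ₛₗ[φ] N')
    (hφ : Function.Surjective φ) (hc : Function.Bijective c) : IsCartesian (ofSemilinear φ c) := by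
  refine (isCartesian_ofSemilinear_iff φ c).2 fun Q _ _ c' => ?_
  obtain ⟨e, he⟩ := hc.2.hasRightInverse
  have he' : ∀ n, e (c n) = n := fun n => hc.1 (he _)
  refine ⟨{ toFun := fun n => c' (e n)
            map_add' := fun n n' => ?_
            map_smul' := fun t n => ?_ }, fun n => congrArg c' (he' n), fun β hβ => ?_⟩
  · rw [← map_add]
    exact congrArg c' (hc.1 (by rw [map_add, he, he, he]))
  · obtain ⟨s, rfl⟩ := hφ t
    rw [RingHom.id_apply, ← c'.map_smulₛₗ]
    exact congrArg c' (hc.1 (by rw [c.map_smulₛₗ, he, he]))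
  · ext n
    exact (congrArg β (he n)).symm.trans (hβ (e n))

lemma isIso_ofSemilinear_base (φ : S →+* T) (c : N →ₛₗ[φ] N') (hφ : Function.Bijective φ) :
    IsIso (ofSemilinear φ c).base := by
  have : IsIso (CommRingCat.ofHom φ) := (ConcreteCategory.isIso_iff_bijective _).2 hφ
  exact inferInstanceAs (IsIso (Spec.map (CommRingCat.ofHom φ)))

end SchemePair

variable {K : Type u} [Field K] {R : Type u} [CommRing R] [Algebra K R]

namespace ArtAlg

/-- The homomorphism `A ⊗ R → B ⊗ R` induced by `A → B`. -/
noncomputable def tensorMap {A B : ArtAlg K} (f : A ⟶ B) (R : Type u) [CommRing R] [Algebra K R] :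
    A.obj ⊗[K] R →ₐ[K] B.obj ⊗[K] R :=
  Algebra.TensorProduct.map f.hom.hom (AlgHom.id K R)

/-- Cancellation of pushouts: `B ⊗ R` is the pushout of `R` along `K → B`, which factors through
`A`, and `A ⊗ R` is the pushout along `K → A`. -/
lemma isPushout_tensorMap {A B : ArtAlg K} (f : A ⟶ B) :
    IsPushout (CommRingCat.ofHom f.hom.hom.toRingHom)
      (CommRingCat.ofHom (algebraMap A.obj (A.obj ⊗[K] R)))
      (CommRingCat.ofHom (algebraMap B.obj (B.obj ⊗[K] R)))
      (CommRingCat.ofHom (tensorMap f R).toRingHom) := by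
  refine IsPushout.of_left (h₁₁ := CommRingCat.ofHom (algebraMap K A.obj))
    (v₁₁ := CommRingCat.ofHom (algebraMap K R))
    (h₂₁ := CommRingCat.ofHom (Algebra.TensorProduct.includeRight : R →ₐ[K] A.obj ⊗[K] R).toRingHom)
    ?_ ?_ (CommRingCat.isPushout_tensorProduct K A.obj R)
  · convert CommRingCat.isPushout_tensorProduct K B.obj R using 1
    · ext k
      exact f.hom.hom.commutes k
    · ext r
      change tensorMap f R (1 ⊗ₜ r) = 1 ⊗ₜ r
      simp [tensorMap]
  · ext a
    change f.hom.hom a ⊗ₜ[K] (1 : R) = tensorMap f R (a ⊗ₜ 1)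
    simp [tensorMap]

/-- The same cancellation with `K` in place of `B`: the composite `K → A → K` is the identity. -/
lemma isPushout_redHom (A : ArtAlg K) :
    IsPushout (CommRingCat.ofHom A.residue.toRingHom)
      (CommRingCat.ofHom (algebraMap A.obj (A.obj ⊗[K] R)))
      (CommRingCat.ofHom (algebraMap K R)) (CommRingCat.ofHom (A.redHom R).toRingHom) := by
  refine IsPushout.of_left (h₁₁ := CommRingCat.ofHom (algebraMap K A.obj))
    (v₁₁ := CommRingCat.ofHom (algebraMap K R))
    (h₂₁ := CommRingCat.ofHom (Algebra.TensorProduct.includeRight : R →ₐ[K] A.obj ⊗[K] R).toRingHom)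
    ?_ ?_ (CommRingCat.isPushout_tensorProduct K A.obj R)
  · have h1 : CommRingCat.ofHom (algebraMap K A.obj) ≫ CommRingCat.ofHom A.residue.toRingHom = 𝟙 _ := by
      ext k
      exact A.residue.commutes k
    have h2 : CommRingCat.ofHom (Algebra.TensorProduct.includeRight : R →ₐ[K] A.obj ⊗[K] R).toRingHom ≫
        CommRingCat.ofHom (A.redHom R).toRingHom = 𝟙 _ := by
      ext r
      change A.redHom R (1 ⊗ₜ r) = r
      rw [redHom_tmul, map_one, one_smul]
    rw [h1, h2]
    exact IsPushout.of_id_fst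
  · ext a
    change algebraMap K R (A.residue a) = A.redHom R (a ⊗ₜ 1)
    rw [redHom_tmul, Algebra.algebraMap_eq_smul_one]

end ArtAlg

lemma SheafIsCoherent.tilde {B : CommRingCat.{u}} (N : ModuleCat.{u} B) [Module.Finite B N] :
    SheafIsCoherent (tilde N) := fun x =>
  ⟨B, 𝟙 _, N, inferInstance, ⟨x, rfl⟩, ⟨(Scheme.Modules.pullbackId (Spec B)).app (AlgebraicGeometry.tilde N)⟩,
    inferInstance⟩

lemma SheafIsFlat.tilde {A B : CommRingCat.{u}} (a : A ⟶ B) (N : ModuleCat.{u} B)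
    (h : Module.Flat A ((ModuleCat.restrictScalars a.hom).obj N)) :
    SheafIsFlat (Spec.map a) (tilde N) := fun x =>
  ⟨B, 𝟙 _, N, inferInstance, ⟨x, rfl⟩, ⟨(Scheme.Modules.pullbackId (Spec B)).app (AlgebraicGeometry.tilde N)⟩, by
    have : Spec.preimage (𝟙 (Spec B) ≫ Spec.map a) = a := by
      rw [Category.id_comp, Spec.preimage_map]
    rw [this]
    exact h⟩

end AffinePairs

/-! ### Deformations over the trivial deformation of the algebra. -/

section AffineDeformation
open AlgebraicGeometry SchemePair PairDer

variable {K : Type u} [Field K] {R : Type u} [CommRing R] [Algebra K R] {A : ArtAlg K}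
  {M : Type u} [AddCommGroup M] [Module R M] {N : Type u} [AddCommGroup N]
  [Module (A.obj ⊗[K] R) N] [Module A.obj N] [IsScalarTower A.obj (A.obj ⊗[K] R) N]
  (ρ : N →ₛₗ[(A.redHom R : A.obj ⊗[K] R →+* R)] M)

lemma ArtAlg.redHom_surjective : Function.Surjective (A.redHom R) := fun r =>
  ⟨1 ⊗ₜ r, by rw [redHom_tmul, map_one, one_smul]⟩

/-- `M` is `N / 𝔪N`, and every map semilinear over the reduction kills `𝔪N`, so it factors uniquely
through `ρ`. -/
lemma isCartesian_of_reduction (hρ : Function.Surjective ρ)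
    (hker : ∀ n, ρ n = 0 → n ∈ A.𝔪 • (⊤ : Submodule A.obj N)) : IsCartesian (ofSemilinear _ ρ) := by
  refine (isCartesian_ofSemilinear_iff _ ρ).2 fun Q _ _ c' => ?_
  obtain ⟨s, hs⟩ := hρ.hasRightInverse
  have key : ∀ {n n'}, ρ n = ρ n' → c' n = c' n' := fun {n n'} h => by
    rw [← sub_eq_zero, ← map_sub]
    exact map_eq_zero_of_mem_smul c' (hker _ (by rw [map_sub, h, sub_self]))
  refine ⟨{ toFun := fun m => c' (s m)
            map_add' := fun m m' => ?_
            map_smul' := fun r m => ?_ }, fun n => key (hs _), fun β hβ => ?_⟩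
  · rw [← map_add]
    exact key (by rw [map_add, hs, hs, hs])
  · obtain ⟨b, rfl⟩ := ArtAlg.redHom_surjective (A := A) r
    rw [RingHom.id_apply]
    refine (key ?_).trans (c'.map_smulₛₗ b (s m))
    rw [hs, ρ.map_smulₛₗ, hs]
    rfl
  · ext m
    exact (congrArg β (hs m)).symm.trans (hβ (s m))

/-- Lifts of generators of `M` generate `N`, by Nakayama for the nilpotent ideal `𝔪`. -/
lemma finite_of_reduction [Module.Finite R M] (hρ : Function.Surjective ρ)
    (hker : ∀ n, ρ n = 0 → n ∈ A.𝔪 • (⊤ : Submodule A.obj N)) : Module.Finite (A.obj ⊗[K] R) N := by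
  obtain ⟨t, ht⟩ := Module.Finite.fg_top (R := R) (M := M)
  obtain ⟨s, hs⟩ := hρ.hasRightInverse
  classical
  have : RingHomSurjective (A.redHom R : A.obj ⊗[K] R →+* R) := ⟨ArtAlg.redHom_surjective⟩
  have hmap : (Submodule.span (A.obj ⊗[K] R) (t.image s : Set N)).map ρ = ⊤ := by
    rw [Submodule.map_span, Finset.coe_image, Set.image_image]
    simp only [hs _, Set.image_id']
    exact ht
  have h := Submodule.eq_top_of_isNilpotent A.isNilpotent_𝔪
    ((Submodule.span (A.obj ⊗[K] R) (t.image s : Set N)).restrictScalars A.obj) fun n => by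
      obtain ⟨n', hn', h⟩ : ρ n ∈ (Submodule.span (A.obj ⊗[K] R) (t.image s : Set N)).map ρ := by
        rw [hmap]; trivial
      exact ⟨n', hn', hker _ (by rw [map_sub, h, sub_self])⟩
  rw [Submodule.restrictScalars_eq_top_iff] at h
  exact ⟨⟨_, h⟩⟩

lemma flat_restrictScalars_algebraMap (A B N : Type u) [CommRing A] [CommRing B] [Algebra A B]
    [AddCommGroup N] [Module B N] [Module A N] [IsScalarTower A B N] [Module.Flat A N] :
    Module.Flat A ((ModuleCat.restrictScalars (algebraMap A B)).obj (ModuleCat.of B N)) := by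
  let e : N ≃ₗ[A] ((ModuleCat.restrictScalars (algebraMap A B)).obj (ModuleCat.of B N)) :=
    { toFun := fun n => n
      invFun := fun n => n
      map_add' := fun _ _ => rfl
      map_smul' := fun a n => (algebraMap_smul B a n).symm
      left_inv := fun _ => rfl
      right_inv := fun _ => rfl }
  exact Module.Flat.of_linearEquiv e.symm

/-- The deformation of `(Spec R, M̃)` given by a deformation `N` of `M` over `A ⊗ R`. -/
noncomputable def affineDeformation [Module.Finite R M] [Module.Flat A.obj N]
    (hρ : Function.Surjective ρ) (hker : ∀ n, ρ n = 0 → n ∈ A.𝔪 • (⊤ : Submodule A.obj N)) :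
    PairDeformation (affine R M) (Spec.map (CommRingCat.ofHom (algebraMap K R))) A where
  total := affine (A.obj ⊗[K] R) N
  π := Spec.map (CommRingCat.ofHom (algebraMap A.obj (A.obj ⊗[K] R)))
  ι := ofSemilinear _ ρ
  isPullback := isPullback_SpecMap_of_isPushout _ _ _ _ A.isPushout_redHom.flip
  flat := Flat.SpecMap_iff.2 (RingHom.flat_algebraMap_iff.2 inferInstance)
  coherent := by
    have := finite_of_reduction ρ hρ hker
    have : Module.Finite (CommRingCat.of (A.obj ⊗[K] R)) (ModuleCat.of (A.obj ⊗[K] R) N) := this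
    exact SheafIsCoherent.tilde _
  flat_sheaf := SheafIsFlat.tilde _ _ (flat_restrictScalars_algebraMap A.obj (A.obj ⊗[K] R) N)
  cartesian := isCartesian_of_reduction ρ hρ hker

variable {N' : Type u} [AddCommGroup N'] [Module (A.obj ⊗[K] R) N'] [Module A.obj N']
  [IsScalarTower A.obj (A.obj ⊗[K] R) N'] {ρ} {ρ' : N' →ₛₗ[(A.redHom R : A.obj ⊗[K] R →+* R)] M}

lemma ArtAlg.redHom_eq_zero_iff (b : A.obj ⊗[K] R) :
    A.redHom R b = 0 ↔ b ∈ A.𝔪 • (⊤ : Submodule A.obj (A.obj ⊗[K] R)) := by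
  rw [redHom_apply, red_eq_zero_iff]

/-- A homomorphism of `A`-algebras to a flat `A`-algebra is bijective if it is so modulo the maximal
ideal. -/
lemma ArtAlg.bijective_of_redHom {B : Type u} [CommRing B] [Algebra A.obj B] [Module.Flat A.obj B]
    (θ : A.obj ⊗[K] R →ₐ[A.obj] B) (σ : B →+* R) (hθ : ∀ b, σ (θ b) = A.redHom R b)
    (hσ : ∀ b, σ b = 0 ↔ b ∈ A.𝔪 • (⊤ : Submodule A.obj B)) : Function.Bijective θ := by
  refine bijective_of_isNilpotent A.isNilpotent_𝔪 (g := θ.toLinearMap) (fun b hb => ?_) fun b => ?_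
  · rw [← redHom_eq_zero_iff, ← hθ]
    exact (hσ _).2 hb
  · obtain ⟨b', hb'⟩ := redHom_surjective (A := A) (σ b)
    refine ⟨b', (hσ _).1 ?_⟩
    rw [map_sub, AlgHom.toLinearMap_apply, hθ, hb', sub_self]

lemma bijective_of_reduction [Module.Flat A.obj N'] (hρ : Function.Surjective ρ)
    (hker : ∀ n, ρ n = 0 → n ∈ A.𝔪 • (⊤ : Submodule A.obj N))
    (hker' : ∀ n, ρ' n = 0 → n ∈ A.𝔪 • (⊤ : Submodule A.obj N')) (c : N →ₗ[A.obj] N')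
    (hc : ∀ n, ρ' (c n) = ρ n) : Function.Bijective c := by
  refine bijective_of_isNilpotent A.isNilpotent_𝔪 (fun n hn => ?_) fun n => ?_
  · exact hker _ (by rw [← hc]; exact map_eq_zero_of_mem_smul ρ' hn)
  · obtain ⟨n', h⟩ := hρ (ρ' n)
    exact ⟨n', hker' _ (by rw [map_sub, hc, h, sub_self])⟩

/-- Arrows are reversed between pairs and modules, hence the order of the two deformations. From
left to right, morphisms of affine pairs are semilinear maps. From right to left, bijectivity of `φ`
and `c` is automatic: both are bijective modulo `𝔪`, with flat target. -/
lemma affineDeformation_isom_iff [Module.Finite R M] [Module.Flat A.obj N] [Module.Flat A.obj N']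
    (hρ : Function.Surjective ρ) (hker : ∀ n, ρ n = 0 → n ∈ A.𝔪 • (⊤ : Submodule A.obj N))
    (hρ' : Function.Surjective ρ') (hker' : ∀ n, ρ' n = 0 → n ∈ A.𝔪 • (⊤ : Submodule A.obj N')) :
    (affineDeformation ρ' hρ' hker').Isom (affineDeformation ρ hρ hker) ↔
      ∃ φ : A.obj ⊗[K] R →ₐ[A.obj] A.obj ⊗[K] R, (∀ b, A.redHom R (φ b) = A.redHom R b) ∧
        ∃ c : N →ₗ[A.obj] N', (∀ b n, c (b • n) = φ b • c n) ∧ ∀ n, ρ' (c n) = ρ n := by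
  constructor
  · rintro ⟨g, -, -, hπ, hι⟩
    obtain ⟨φ, c, rfl⟩ := exists_ofSemilinear g
    have hφ : φ.comp (algebraMap A.obj (A.obj ⊗[K] R)) = algebraMap A.obj (A.obj ⊗[K] R) := by
      have h : Spec.map (CommRingCat.ofHom φ) ≫
          Spec.map (CommRingCat.ofHom (algebraMap A.obj (A.obj ⊗[K] R))) =
          Spec.map (CommRingCat.ofHom (algebraMap A.obj (A.obj ⊗[K] R))) := hπ
      rw [← Spec.map_comp] at h
      exact congrArg CommRingCat.Hom.hom (Spec.map_injective h)
    let c' : N →ₛₗ[(A.redHom R : A.obj ⊗[K] R →+* R).comp φ] M :=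
      { toFun := fun n => ρ' (c n)
        map_add' := fun n n' => by rw [map_add, map_add]
        map_smul' := fun b n => by rw [c.map_smulₛₗ, ρ'.map_smulₛₗ]; rfl }
    have hι' : ofSemilinear _ c' = ofSemilinear _ ρ := by
      rw [← ofSemilinear_comp φ (A.redHom R : A.obj ⊗[K] R →+* R) _ rfl c ρ' c' fun _ => rfl]
      exact hι
    obtain ⟨h1, h2⟩ := ofSemilinear_injective hι'
    refine ⟨{ φ with commutes' := fun a => RingHom.congr_fun hφ a }, fun b => RingHom.congr_fun h1 b,
      { toFun := c
        map_add' := c.map_add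
        map_smul' := fun a n => ?_ }, fun b n => c.map_smulₛₗ b n, h2⟩
    rw [RingHom.id_apply, ← smul_one_smul (A.obj ⊗[K] R) a n, ← smul_one_smul (A.obj ⊗[K] R) a (c n),
      c.map_smulₛₗ, ← Algebra.algebraMap_eq_smul_one]
    exact congrArg (· • c n) (RingHom.congr_fun hφ a)
  · rintro ⟨φ, hφ, c, hc, hcρ⟩
    have hφb : Function.Bijective φ :=
      ArtAlg.bijective_of_redHom φ (A.redHom R : A.obj ⊗[K] R →+* R) hφ ArtAlg.redHom_eq_zero_iff
    have hcb := bijective_of_reduction hρ hker hker' c hcρ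
    let c' : N →ₛₗ[(φ : A.obj ⊗[K] R →+* A.obj ⊗[K] R)] N' :=
      { toFun := c, map_add' := c.map_add, map_smul' := hc }
    refine ⟨ofSemilinear _ c', isIso_ofSemilinear_base _ _ hφb,
      isCartesian_ofSemilinear_of_bijective _ _ hφb.2 hcb, ?_, ?_⟩
    · refine (Spec.map_comp _ _).symm.trans (congrArg Spec.map ?_)
      ext a
      exact φ.commutes a
    · exact ofSemilinear_comp _ _ _ (RingHom.ext hφ) _ _ _ fun n => (hcρ n).symm

end AffineDeformation

/-! ### Cartesian morphisms and reduction of modules. -/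

section CartesianReduction
open AlgebraicGeometry SchemePair

/-- Universality is tested against `M / range c`: the projection and the zero map both restrict to
zero along `c`, so they agree. -/
lemma surjective_of_isCartesian {S T : Type u} [CommRing S] [CommRing T] {N M : Type u}
    [AddCommGroup N] [Module S N] [AddCommGroup M] [Module T M] (φ : S →+* T)
    (hφ : Function.Surjective φ) (c : N →ₛₗ[φ] M) (h : IsCartesian (ofSemilinear φ c)) :
    Function.Surjective c := by
  have : RingHomSurjective φ := ⟨hφ⟩
  have h' := ((isCartesian_ofSemilinear_iff φ c).1 h (M ⧸ LinearMap.range c) 0).unique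
    (y₁ := (LinearMap.range c).mkQ) (y₂ := 0)
    (fun n => (Submodule.Quotient.mk_eq_zero _).2 ⟨n, rfl⟩) (fun n => rfl)
  rw [← LinearMap.range_eq_top, ← Submodule.ker_mkQ (LinearMap.range c), h', LinearMap.ker_zero]

/-- Universality is tested against `T ⊗ N`: the map `n ↦ 1 ⊗ n` factors through `c`, so it kills the
kernel of `c`, while its own kernel is `ker φ • N` by right exactness. -/
lemma mem_smul_of_isCartesian {S T : Type u} [CommRing S] [CommRing T] {N M : Type u}
    [AddCommGroup N] [Module S N] [AddCommGroup M] [Module T M] (φ : S →+* T)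
    (hφ : Function.Surjective φ) (c : N →ₛₗ[φ] M) (h : IsCartesian (ofSemilinear φ c)) (n : N)
    (hn : c n = 0) : n ∈ RingHom.ker φ • (⊤ : Submodule S N) := by
  let _ : Algebra S T := φ.toAlgebra
  let c' : N →ₛₗ[φ] T ⊗[S] N :=
    { toFun := fun n => 1 ⊗ₜ n
      map_add' := fun n n' => TensorProduct.tmul_add _ _ _
      map_smul' := fun s n => by
        rw [TensorProduct.tmul_smul]
        exact (algebraMap_smul T s _).symm }
  obtain ⟨α, hα, -⟩ := (isCartesian_ofSemilinear_iff φ c).1 h (T ⊗[S] N) c'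
  have h0 : (1 : T) ⊗ₜ[S] n = 0 := by
    have := hα n
    rw [hn, map_zero] at this
    exact this.symm
  have hex : Function.Exact (RingHom.ker φ).subtype (Algebra.linearMap S T) := fun s =>
    ⟨fun hs => ⟨⟨s, hs⟩, rfl⟩, by rintro ⟨s, rfl⟩; exact s.2⟩
  obtain ⟨t, ht⟩ := (rTensor_exact N hex hφ ((1 : S) ⊗ₜ n)).1 (by
    rw [LinearMap.rTensor_tmul, Algebra.linearMap_apply, map_one, h0])
  exact (Submodule.mem_smul_top_iff_exists_tmul _ _).2 ⟨t, by rw [ht]; simp⟩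

end CartesianReduction

/-! ### Triviality of deformations of a smooth algebra. -/

section TensorSmooth

variable {K : Type u} [Field K] {R : Type u} [CommRing R] [Algebra K R] {A : ArtAlg K}

/-- Flat deformations of a formally smooth algebra over an Artin algebra are trivial. -/
lemma ArtAlg.exists_tensor_bijective [Algebra.FormallySmooth K R] {S : Type u} [CommRing S]
    [Algebra A.obj S] [Module.Flat A.obj S] (σ : S →+* R) (hσ : Function.Surjective σ)
    (hker : RingHom.ker σ = A.𝔪.map (algebraMap A.obj S))
    (h : ∀ a, σ (algebraMap A.obj S a) = algebraMap K R (A.residue a)) :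
    ∃ θ : A.obj ⊗[K] R →ₐ[A.obj] S, Function.Bijective θ ∧ ∀ b, σ (θ b) = A.redHom R b := by
  let _ : Algebra K S := ((algebraMap A.obj S).comp (algebraMap K A.obj)).toAlgebra
  have : IsScalarTower K A.obj S := .of_algebraMap_eq fun _ => rfl
  let σ' : S →ₐ[K] R :=
    { σ with
      commutes' := fun k => by
        refine (h (algebraMap K A.obj k)).trans ?_
        rw [AlgHom.commutes]
        rfl }
  have hnil : IsNilpotent (RingHom.ker (σ' : S →+* R)) := by
    have hk : RingHom.ker (σ' : S →+* R) = A.𝔪.map (algebraMap A.obj S) := hker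
    obtain ⟨n, hn⟩ := A.isNilpotent_𝔪
    refine ⟨n, ?_⟩
    rw [hk, ← Ideal.map_pow, hn]
    exact Ideal.map_bot
  -- Formal smoothness lifts the identity of `R` through the nilpotent extension `S → R`. Extending
  -- scalars to `A` gives `θ`, which is an isomorphism because it is one modulo `𝔪` and `S` is flat.
  let l : R →ₐ[K] S := Algebra.FormallySmooth.liftOfSurjective (AlgHom.id K R) σ' hσ hnil
  have hl : ∀ r, σ (l r) = r := fun r =>
    Algebra.FormallySmooth.liftOfSurjective_apply (AlgHom.id K R) σ' hσ hnil r
  let θ : A.obj ⊗[K] R →ₐ[A.obj] S :=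
    Algebra.TensorProduct.lift (Algebra.ofId A.obj S) l fun _ _ => .all _ _
  have hθ : ∀ b, σ (θ b) = A.redHom R b := fun b => by
    induction b using TensorProduct.induction_on with
    | zero => simp
    | add x y hx hy => simp only [map_add, hx, hy]
    | tmul a r =>
      have : θ (a ⊗ₜ r) = algebraMap A.obj S a * l r := Algebra.TensorProduct.lift_tmul _ _ _ _ _
      rw [this, map_mul, h, hl, redHom_tmul, Algebra.smul_def]
  refine ⟨θ, bijective_of_redHom θ σ hθ fun s => ?_, hθ⟩
  have : A.𝔪 • (⊤ : Submodule A.obj S) = (A.𝔪.map (algebraMap A.obj S)).restrictScalars A.obj :=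
    Ideal.smul_top_eq_map A.𝔪
  rw [← RingHom.mem_ker, hker, this]
  rfl

end TensorSmooth

/-! ### Every deformation comes from a module over `A ⊗ R`. -/

namespace PairDeformation
open AlgebraicGeometry SchemePair

variable {K : Type u} [Field K] {R : Type u} [CommRing R] [Algebra K R] {A : ArtAlg K}
  {M : Type u} [AddCommGroup M] [Module R M]

/-- The total space of a deformation of an affine pair is an affine pair. -/
lemma exists_affine
    (D : PairDeformation (affine R M) (Spec.map (CommRingCat.ofHom (algebraMap K R))) A) :
    ∃ (S : Type u) (_ : CommRing S) (_ : Algebra A.obj S) (N : Type u) (_ : AddCommGroup N)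
      (_ : Module S N) (_ : Module A.obj N) (_ : IsScalarTower A.obj S N) (σ : S →+* R)
      (c : N →ₛₗ[σ] M) (g : affine S N ⟶ D.total), IsIso g.base ∧ IsCartesian g ∧
      g.base ≫ D.π = Spec.map (CommRingCat.ofHom (algebraMap A.obj S)) ∧
      ofSemilinear σ c ≫ g = D.ι ∧ Function.Surjective σ ∧
      RingHom.ker σ = A.𝔪.map (algebraMap A.obj S) ∧ Module.Flat A.obj S ∧ Module.Flat A.obj N := by
  obtain ⟨B, a, ρ, N, c, g, h1, h2, h3, h4, h5, h6, h7, h8⟩ := D.exists_spec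
  let _ : Algebra A.obj B := a.hom.toAlgebra
  let _ : Module A.obj N := Module.compHom N a.hom
  have : IsScalarTower A.obj B N := ⟨fun s b n => by
    rw [Algebra.smul_def, mul_smul]; rfl⟩
  exact ⟨B, inferInstance, inferInstance, N, inferInstance, inferInstance, inferInstance, this, ρ.hom,
    { toFun := c.hom, map_add' := c.hom.map_add, map_smul' := c.hom.map_smul }, g, h1, h2, h3, h4,
    h5, h6, h7, h8⟩

/-- Every deformation of an affine pair over a smooth algebra is given by a deformation of the module
over the trivial deformation of the algebra. -/
lemma exists_affineDeformation_isom [Module.Finite R M] [Algebra.FormallySmooth K R]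
    (D : PairDeformation (affine R M) (Spec.map (CommRingCat.ofHom (algebraMap K R))) A) :
    ∃ (N : Type u) (_ : AddCommGroup N) (_ : Module (A.obj ⊗[K] R) N) (_ : Module A.obj N)
      (_ : IsScalarTower A.obj (A.obj ⊗[K] R) N) (_ : Module.Flat A.obj N)
      (ρ : N →ₛₗ[(A.redHom R : A.obj ⊗[K] R →+* R)] M) (hρ : Function.Surjective ρ)
      (hker : ∀ n, ρ n = 0 → n ∈ A.𝔪 • (⊤ : Submodule A.obj N)),
      D.Isom (affineDeformation ρ hρ hker) := by
  obtain ⟨S, _, _, N, _, _, _, _, σ, c, g, h1, h2, h3, h4, h5, h6, h7, h8⟩ := D.exists_affine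
  have hcart : IsCartesian (ofSemilinear σ c) := .of_comp (h4 ▸ D.cartesian) h2
  have hσ : ∀ a, σ (algebraMap A.obj S a) = algebraMap K R (A.residue a) := by
    have hw : (ofSemilinear σ c).base ≫ g.base ≫ D.π =
        Spec.map (CommRingCat.ofHom (algebraMap K R)) ≫ A.closedPt := by
      rw [← Category.assoc, ← comp_base, h4]
      exact D.isPullback.w
    rw [h3, ofSemilinear_base, ← Spec.map_comp, ← Spec.map_comp] at hw
    exact fun a => congrArg (fun f => f.hom a) (Spec.map_injective hw)
  obtain ⟨θ, hθ, hθσ⟩ := ArtAlg.exists_tensor_bijective σ h5 h6 hσ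
  -- `N` is kept as an abelian group and viewed over `A ⊗ R` through `θ`; the identity of `N` is
  -- then semilinear over `θ` and gives an isomorphism of pairs.
  let _ : Module (A.obj ⊗[K] R) N := Module.compHom N (θ : A.obj ⊗[K] R →+* S)
  have : IsScalarTower A.obj (A.obj ⊗[K] R) N := ⟨fun a b n => by
    change θ (a • b) • n = a • (θ b • n)
    rw [map_smul, smul_assoc]⟩
  let ρ : N →ₛₗ[(A.redHom R : A.obj ⊗[K] R →+* R)] M :=
    { toFun := c
      map_add' := c.map_add
      map_smul' := fun b n => by
        refine (c.map_smulₛₗ (θ b) n).trans ?_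
        rw [hθσ]; rfl }
  have hρ : Function.Surjective ρ := surjective_of_isCartesian σ h5 c hcart
  have hker : ∀ n, ρ n = 0 → n ∈ A.𝔪 • (⊤ : Submodule A.obj N) := fun n hn => by
    have := mem_smul_of_isCartesian σ h5 c hcart n hn
    rw [h6, ← Submodule.restrictScalars_mem A.obj, Ideal.smul_restrictScalars] at this
    exact this
  refine ⟨N, _, _, _, this, h8, ρ, hρ, hker, ?_⟩
  let e : N →ₛₗ[(θ : A.obj ⊗[K] R →+* S)] N :=
    { toFun := fun n => n, map_add' := fun _ _ => rfl, map_smul' := fun _ _ => rfl }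
  -- A cartesian morphism over an isomorphism of schemes is invertible; `g'` is the inverse of `g`.
  obtain ⟨g', hb, hg⟩ := h2.lift (𝟙 D.total) (inv g.base) (by simp)
  have hg' : g ≫ g' = 𝟙 _ := h2.hom_ext (by simp [hb]) (by rw [Category.assoc, hg]; simp)
  have he := isIso_ofSemilinear_base (θ : A.obj ⊗[K] R →+* S) e hθ
  let h : D.total ⟶ affine (A.obj ⊗[K] R) N := g' ≫ ofSemilinear (θ : A.obj ⊗[K] R →+* S) e
  have hb' : h.base = inv g.base ≫ (ofSemilinear (θ : A.obj ⊗[K] R →+* S) e).base := by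
    rw [← hb]; rfl
  have hi : IsIso h.base := by rw [hb']; infer_instance
  have hc : IsCartesian h := (IsCartesian.of_comp (hg ▸ isCartesian_id _) h2).comp
    (isCartesian_ofSemilinear_of_bijective _ _ hθ.2 Function.bijective_id)
  have hπ : h.base ≫ Spec.map (CommRingCat.ofHom (algebraMap A.obj (A.obj ⊗[K] R))) = D.π := by
    rw [hb', Category.assoc, IsIso.inv_comp_eq, h3]
    refine (Spec.map_comp _ _).symm.trans (congrArg Spec.map ?_)
    ext a
    exact θ.commutes a
  have hgh : g ≫ h = ofSemilinear (θ : A.obj ⊗[K] R →+* S) e := by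
    rw [← Category.assoc, hg', Category.id_comp]
  have hι : D.ι ≫ h = ofSemilinear _ ρ := by
    rw [← h4, Category.assoc, hgh]
    exact ofSemilinear_comp _ _ _ (RingHom.ext hθσ) _ _ _ fun _ => rfl
  exact ⟨h, hi, hc, hπ, hι⟩

end PairDeformation

/-! ### Change of the Artin algebra. -/

namespace ArtAlg

variable {K : Type u} [Field K] {A B : ArtAlg K} (f : A ⟶ B) {L V W : Type u} [AddCommGroup L]
  [Module K L] [AddCommGroup V] [Module K V] [AddCommGroup W] [Module K W]

/-- The map `A ⊗ V → B ⊗ V` induced by `A → B`. -/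
noncomputable def change (V : Type u) [AddCommGroup V] [Module K V] :
    A.obj ⊗[K] V →ₗ[K] B.obj ⊗[K] V :=
  f.hom.hom.toLinearMap.rTensor V

lemma change_tmul (a : A.obj) (v : V) : change f V (a ⊗ₜ v) = f.hom.hom a ⊗ₜ v := rfl

lemma change_one_tmul (v : V) : change f V (1 ⊗ₜ v) = 1 ⊗ₜ v := by
  rw [change_tmul, map_one]

lemma red_change (z : A.obj ⊗[K] V) : B.red V (change f V z) = A.red V z := by
  induction z using TensorProduct.induction_on with
  | zero => simp
  | add x y hx hy => simp only [map_add, hx, hy]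
  | tmul a v =>
    rw [change_tmul, contr_tmul, contr_tmul]
    exact congrArg (· • v) (AlgHom.congr_fun (residue_comp f) a)

lemma redHom_tensorMap {R : Type u} [CommRing R] [Algebra K R] (b : A.obj ⊗[K] R) :
    B.redHom R (tensorMap f R b) = A.redHom R b := by
  rw [redHom_apply, redHom_apply]
  exact red_change f b

lemma ev_change (φ : L →ₗ[K] V →ₗ[K] W) (x : L ⊗[K] A.𝔪) (z : A.obj ⊗[K] V) :
    B.ev φ ((map𝔪 f).lTensor L x) (change f V z) = change f W (A.ev φ x z) := by
  induction z using TensorProduct.induction_on with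
  | zero => simp
  | add z w hz hw => simp only [map_add, hz, hw]
  | tmul a v =>
    induction x using TensorProduct.induction_on with
    | zero => simp
    | add x y hx hy => simp only [map_add, LinearMap.add_apply, hx, hy]
    | tmul l s =>
      rw [ev_tmul_tmul, change_tmul, change_tmul, LinearMap.lTensor_tmul, ev_tmul_tmul, map_mul]
      rfl

lemma baseChange_change (g : V →ₗ[K] W) (z : A.obj ⊗[K] V) :
    g.baseChange B.obj (change f V z) = change f W (g.baseChange A.obj z) := by
  induction z using TensorProduct.induction_on with
  | zero => simp
  | add z w hz hw => simp only [map_add, hz, hw]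
  | tmul a v => rfl

end ArtAlg

/-! ### Naturality and the isomorphism of functors. -/

namespace PairDer
open AlgebraicGeometry SchemePair

variable {K : Type u} [Field K] {R : Type u} [CommRing R] [Algebra K R]
  {E : CochainComplex (ModuleCat.{u} R) ℤ} {M : Type u} [AddCommGroup M] [Module R M]
  {ε : E.X 0 →ₗ[R] M} {A B : ArtAlg K} (f : A ⟶ B)

lemma change_smul (p : ℤ) (b : A.obj ⊗[K] R) (z : A.obj ⊗[K] E.X p) :
    ArtAlg.change f (E.X p) (b • z) = ArtAlg.tensorMap f R b • ArtAlg.change f (E.X p) z := by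
  induction z using TensorProduct.induction_on with
  | zero => simp
  | add z w hz hw => simp only [smul_add, map_add, hz, hw]
  | tmul a v =>
    induction b using TensorProduct.induction_on with
    | zero => simp
    | add b c hb hc => simp only [add_smul, map_add, hb, hc]
    | tmul a' r =>
      rw [tmul_smul_tmul, ArtAlg.change_tmul, ArtAlg.change_tmul, map_mul]
      exact (tmul_smul_tmul p (f.hom.hom a') (f.hom.hom a) r v).symm

lemma twist_change (x : (dgla K R E).tens A 1) (p q : ℤ) (h : p + 1 = q) (z : A.obj ⊗[K] E.X p) :
    twist ((dgla K R E).mapT f 1 x) p q h (ArtAlg.change f _ z) =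
      ArtAlg.change f _ (twist x p q h z) := by
  rw [twist, twist, LinearMap.add_apply, LinearMap.add_apply, map_add, ArtAlg.baseChange_change]
  exact congrArg _ (ArtAlg.ev_change f _ x z)

/-- The map between the cokernels of the twisted differentials induced by `A → B`. -/
noncomputable def cokerMap (x : (dgla K R E).tens A 1) :
    Coker x →ₛₗ[(ArtAlg.tensorMap f R : A.obj ⊗[K] R →+* B.obj ⊗[K] R)]
      Coker ((dgla K R E).mapT f 1 x) :=
  Submodule.liftQ _
    ({ toFun := fun z => cokerMk _ (ArtAlg.change f _ z)
       map_add' := fun z w => by rw [map_add, map_add]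
       map_smul' := fun b z => by rw [change_smul, cokerMk_smul]; rfl } :
      A.obj ⊗[K] E.X 0 →ₛₗ[(ArtAlg.tensorMap f R : A.obj ⊗[K] R →+* B.obj ⊗[K] R)]
        Coker ((dgla K R E).mapT f 1 x))
    (by
      rintro _ ⟨w, rfl⟩
      change cokerMk _ (ArtAlg.change f _ (twist x (-1) 0 (neg_add_cancel 1) w)) = 0
      rw [← twist_change, cokerMk_twist])

/-- Right exactness of base change: a semilinear map out of the cokernel over `A` is determined on
the classes of `1 ⊗ v`, extends to `B ⊗ E⁰`, and still kills boundaries, since the twisted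
differential over `B` is the base change of the one over `A`. -/
lemma isCartesian_cokerMap [Module.Projective R (E.X 0)] (x : (dgla K R E).tens A 1) :
    IsCartesian (ofSemilinear _ (cokerMap f x)) := by
  refine (isCartesian_ofSemilinear_iff _ _).2 fun Q _ _ c' => ?_
  let _ : Module B.obj Q := Module.compHom Q (algebraMap B.obj (B.obj ⊗[K] R))
  have : IsScalarTower B.obj (B.obj ⊗[K] R) Q := ⟨fun a b q => by
    rw [Algebra.smul_def, mul_smul]; rfl⟩
  obtain ⟨G, hG, hG'⟩ := exists_semilinear_tensor (AlgHom.id B.obj (B.obj ⊗[K] R))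
    (fun (v : E.X 0) q => q = c' (cokerMk x (1 ⊗ₜ v)))
    (fun v q v' q' h h' => by rw [h, h', TensorProduct.tmul_add, map_add, map_add])
    (fun r v q h => by
      rw [h, one_tmul_smul, cokerMk_smul, c'.map_smulₛₗ]
      congr 1
      change (1 : B.obj) ⊗ₜ[K] r = f.hom.hom 1 ⊗ₜ[K] r
      rw [map_one]) (fun v => ⟨_, rfl⟩)
  have e : ∀ {C : ArtAlg K} (a : C.obj) (v : E.X 0),
      a ⊗ₜ[K] v = (a ⊗ₜ[K] (1 : R)) • ((1 : C.obj) ⊗ₜ[K] v) := fun a v => by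
    rw [tmul_smul_tmul, mul_one, one_smul]
  have hGc : ∀ z, G (ArtAlg.change f _ z) = c' (cokerMk x z) := fun z => by
    induction z using TensorProduct.induction_on with
    | zero => simp
    | add z w hz hw => simp only [map_add, hz, hw]
    | tmul a v =>
      rw [ArtAlg.change_tmul, e, hG, hG', e a, cokerMk_smul, c'.map_smulₛₗ]
      rfl
  have hG0 : ∀ w, G (twist ((dgla K R E).mapT f 1 x) (-1) 0 (neg_add_cancel 1) w) = 0 := by
    refine ext_semilinear (F := G ∘ₗ twist ((dgla K R E).mapT f 1 x) (-1) 0 (neg_add_cancel 1))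
      (G := 0) fun v => ?_
    rw [LinearMap.comp_apply, ← ArtAlg.change_one_tmul f v, twist_change, hGc, cokerMk_twist, map_zero]
    rfl
  obtain ⟨α, hα⟩ := exists_cokerLift _ G hG0
  refine ⟨{ toFun := α
            map_add' := α.map_add
            map_smul' := fun b n => ?_ }, fun n => ?_, fun β hβ => LinearMap.ext fun n => ?_⟩
  · obtain ⟨z, rfl⟩ := cokerMk_surjective _ n
    rw [← cokerMk_smul, hα, hα, hG]
    rfl
  · obtain ⟨z, rfl⟩ := cokerMk_surjective _ n
    exact (hα _).trans (hGc z)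
  · obtain ⟨z, rfl⟩ := cokerMk_surjective _ n
    refine Eq.trans ?_ (hα z).symm
    induction z using TensorProduct.induction_on with
    | zero => simp
    | add z w hz hw => simp only [map_add, hz, hw]
    | tmul a v =>
      have h1 : β (cokerMk _ (1 ⊗ₜ v)) = c' (cokerMk x (1 ⊗ₜ v)) := by
        rw [← ArtAlg.change_one_tmul f v]
        exact hβ (cokerMk x (1 ⊗ₜ v))
      rw [e, cokerMk_smul, map_smul, hG, hG', h1]
      rfl

variable [CharZero K] [Module.Finite R M] (hE : IsResolution E ε)

/-- The deformation of `(Spec R, M̃)` given by a Maurer-Cartan element. -/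
noncomputable def deformation (x : (dgla K R E).MC A) :
    PairDeformation (affine R M) (Spec.map (CommRingCat.ofHom (algebraMap K R))) A :=
  have := flat_coker hE x
  affineDeformation (cokerRed hE x.1) (cokerRed_surjective hE x.1)
    fun n => (cokerRed_eq_zero_iff hE x.1 n).1

lemma deformation_isom_iff (x y : (dgla K R E).MC A) :
    (deformation hE y).Isom (deformation hE x) ↔ CokerRel hE x.1 y.1 :=
  have := flat_coker hE x
  have := flat_coker hE y
  affineDeformation_isom_iff (cokerRed_surjective hE x.1) (fun n => (cokerRed_eq_zero_iff hE x.1 n).1)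
    (cokerRed_surjective hE y.1) (fun n => (cokerRed_eq_zero_iff hE y.1 n).1)

lemma isBaseChange_deformation (x : (dgla K R E).MC A) :
    PairDeformation.IsBaseChange f (deformation hE x) (deformation hE ((dgla K R E).mapMC f x)) := by
  have := hE.projective 0
  refine ⟨ofSemilinear _ (cokerMap f x.1), ?_, isCartesian_cokerMap f x.1, ?_⟩
  · exact isPullback_SpecMap_of_isPushout _ _ _ _ (ArtAlg.isPushout_tensorMap f).flip
  · refine ofSemilinear_comp _ _ _ (RingHom.ext (ArtAlg.redHom_tensorMap f)) _ _ _ fun n => ?_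
    obtain ⟨z, rfl⟩ := cokerMk_surjective _ n
    exact (congrArg ε (ArtAlg.red_change f z)).symm

/-- Smoothness reduces the deformation to a flat module over `A ⊗ R`, and this module is the
cokernel of a twist by `exists_coker_equiv`; the algebra isomorphism between the two is the
identity. -/
lemma exists_isom_deformation [Algebra.FormallySmooth K R]
    (D : PairDeformation (affine R M) (Spec.map (CommRingCat.ofHom (algebraMap K R))) A) :
    ∃ x : (dgla K R E).MC A, D.Isom (deformation hE x) := by
  obtain ⟨N, _, _, _, _, _, ρ, hρ, hker, h⟩ := D.exists_affineDeformation_isom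
  obtain ⟨x, c, -, hc, hcρ⟩ := exists_coker_equiv hE ρ hρ hker
  have := flat_coker hE x
  exact ⟨x, h.trans ((affineDeformation_isom_iff (cokerRed_surjective hE x.1)
    (fun n => (cokerRed_eq_zero_iff hE x.1 n).1) hρ hker).2
    ⟨AlgHom.id _ _, fun _ => rfl, c, hc, hcρ⟩)⟩

/-- The map from gauge equivalence classes to isomorphism classes of deformations. -/
noncomputable def toDefPair (A : ArtAlg K) : Quot ((dgla K R E).GaugeRel A) →
    Quotient (PairDeformation.setoid (affine R M) (Spec.map (CommRingCat.ofHom (algebraMap K R))) A) :=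
  Quot.lift (fun x => Quotient.mk _ (deformation hE x)) fun x y ⟨a, ha⟩ =>
    (Quotient.sound ((deformation_isom_iff hE x y).2 (ha ▸ cokerRel_gauge hE a x.1))).symm

lemma toDefPair_bijective [Algebra.FormallySmooth K R] (A : ArtAlg K) :
    Function.Bijective (toDefPair hE A) := by
  constructor
  · rintro ⟨x⟩ ⟨y⟩ h
    exact quot_eq_of_cokerRel hE x y
      ((deformation_isom_iff hE x y).1 (PairDeformation.Isom.symm (Quotient.exact h)))
  · intro D
    induction D using Quotient.inductionOn with
    | h D =>
      obtain ⟨x, hx⟩ := exists_isom_deformation hE D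
      exact ⟨Quot.mk _ x, (Quotient.sound hx).symm⟩

/-- Maurer-Cartan elements modulo gauge equivalence are deformations modulo isomorphism. -/
noncomputable def defFunctorIso [Algebra.FormallySmooth K R] :
    (dgla K R E).defFunctor ⋙ uliftFunctor.{u + 1} ≅
      defPair (affine R M) (Spec.map (CommRingCat.ofHom (algebraMap K R))) :=
  NatIso.ofComponents (fun A => (Equiv.ulift.trans
    (Equiv.ofBijective (toDefPair hE A) (toDefPair_bijective hE A))).toIso) (by
    rintro A B f
    ext ⟨⟨x⟩⟩
    exact Quotient.sound ((isBaseChange_deformation f hE x).isom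
      (PairDeformation.isBaseChange_baseChange f _) (.refl _)))

end PairDer

/-- Deformations involve arbitrary schemes, so their isomorphism classes live one universe above
Maurer-Cartan classes; `uliftFunctor` only adjusts for this. -/
theorem proposition7p9 {K : Type u} [Field K] [IsAlgClosed K] [CharZero K]
    {R : Type u} [CommRing R] [Algebra K R] [Algebra.Smooth K R]
    (M : Type u) [AddCommGroup M] [Module R M] [Module.Finite R M]
    (E : CochainComplex (ModuleCat.{u} R) ℤ) (m : ℕ)
    (projective : ∀ i, Module.Projective R (E.X i))
    (eq_zero_of_lt : ∀ i : ℤ, i < -(m : ℤ) → Subsingleton (E.X i))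
    (eq_zero_of_pos : ∀ i : ℤ, 0 < i → Subsingleton (E.X i))
    (ε : E.X 0 →ₗ[R] M) (surjective : Function.Surjective ε)
    (exact_zero : Function.Exact (E.d (-1) 0).hom ε)
    (exact_neg : ∀ i : ℤ, i < 0 → Function.Exact (E.d (i - 1) i).hom (E.d i (i + 1)).hom) :
    Nonempty ((PairDer.dgla K R E).defFunctor ⋙ uliftFunctor.{u + 1} ≅
      defPair ⟨AlgebraicGeometry.Spec (.of R), AlgebraicGeometry.tilde (ModuleCat.of R M)⟩
        (AlgebraicGeometry.Spec.map (CommRingCat.ofHom (algebraMap K R)))) :=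
  ⟨PairDer.defFunctorIso (ε := ε)
    ⟨projective, ⟨m, eq_zero_of_lt⟩, eq_zero_of_pos, surjective, exact_zero, exact_neg⟩⟩
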